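/- Let $n\ge 1$, $1\le p\le\infty$, and let $X\subset\mathbb R^n$ be a bounded open set. Families are indexed by $\epsilon\in(0,1]$ and all $O$-conditions are meant as $\epsilon\to0$. **Function spaces.** Let $L^p_\infty(X)$ be the space of $u\in C^\infty(X)$ all of whose derivatives ($u$ included) belong to $L^p(X)$. Define spaces of families $(u_\epsilon)$ in $L^p_\infty(X)$: $\mathcal E_{L^p}(X)$ (moderate): $\forall\alpha\,\exists N:\ \|\partial^\alpha u_\epsilon\|_{L^p(X)}=O(\epsilon^{-N})$; $\mathcal N_{L^p}(X)$ (null): the moderate families with $\|u_\epsilon\|_{L^p(X)}=O(\epsilon^{N})$ for all $N$; $\mathcal R_{L^p}(X)$ (regular): $\exists N\,\forall\alpha:\ \|\partial^\alpha u_\epsilon\|_{L^p(X)}=O(\epsilon^{-N})$. Put $\mathcal G_{L^p}(X)=\mathcal E_{L^p}(X)/\mathcal N_{L^p}(X)$ and $\mathcal G^\infty_{L^p}(X)=\mathcal R_{L^p}(X)/(\mathcal N_{L^p}(X)\cap\mathcal R_{L^p}(X))$. The first carries the sharp topology, i.e. the quotient of the translation-invariant topology on $\mathcal E_{L^p}(X)$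 whose basic neighbourhoods of $0$ are $\{w:\ \|\partial^\alpha w_\epsilon\|_{L^p(X)}=O(\epsilon^m)\ \forall|\alpha|\le k\}$, $k,m\in\mathbb N$. The second carries the quotient of the translation-invariant topology on $\mathcal R_{L^p}(X)$ whose basic neighbourhoods of $0$ are $\{w:\ \|\partial^\alpha w_\epsilon\|_{L^p(X)}=O(\epsilon^m)\ \forall\alpha\}$, $m\in\mathbb N$. **Operators.** Let $S\subset X\times K$ with $K\subset X$ compact (for example $S=X\times K$, or $S$ a compact subset of $X\times X$). Let $(\phi_\epsilon)$ be a generalised non-degenerate phase function: each $\phi_\epsilon(x,y,\xi)$ is real-valued and smooth on $X\times X\times(\mathbb R^n\setminus0)$, positively homogeneous of degree $1$ in $\xi$, with $\det\partial_y\partial_\xi\phi_\epsilon\neq0$; and, over $(x,y)\in S$, $|\xi|=1$, the supremum of each derivative $|\partial^\alpha_{x,y,\xi}\phi_\epsilon|$ and the supremum of $|\det\partial_y\partial_\xi\phi_\epsilon|^{-1}$ are finite for every $\epsilon$ and $O(\epsilon^{-N})$ for some $N$ (which may depend on $\alpha$). Let $\mu\in\mathbb R$ and let $(a_\epsilon)$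 be a generalised amplitude of order $\mu$ supported over $S$: each $a_\epsilon\in C^\infty(X\times X\times\mathbb R^n)$ vanishes when $(x,y)\notin S$, and for all $\alpha,\beta$ the quantity $$\sup_{(x,y,\xi)\in X\times X\times\mathbb R^n}(1+|\xi|)^{-\mu+|\beta|}\,|\partial_{x,y}^\alpha\partial_\xi^\beta a_\epsilon(x,y,\xi)|$$ is finite for every $\epsilon$ and $O(\epsilon^{-N})$ for some $N$ (which may depend on $\alpha,\beta$). The generalised Fourier integral operator $T$ acts on representatives by $(u_\epsilon)\mapsto(T_\epsilon u_\epsilon)$, where $$T_\epsilon u(x)=(2\pi)^{-n}\int_{\mathbb R^n}\int_X e^{i\phi_\epsilon(x,y,\xi)}a_\epsilon(x,y,\xi)\,u(y)\,dy\,d\xi .$$ **Theorem.** (0) For every $\epsilon$, $u\in L^p_\infty(X)$ and $x\in X$, the inner integral converges absolutely for each $\xi\ne0$ and, as a function of $\xi$, is integrable over $\mathbb R^n$. (1) $T$ maps $\mathcal E_{L^p}(X)$ to itself and induces a well-defined continuous linear map $\mathcal G_{L^p}(X)\to\mathcal G_{L^p}(X)$. (2) Suppose in addition that the phase is slow scale,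 i.e. over $(x,y)\in S$, $|\xi|=1$ the suprema of each derivative of $\phi_\epsilon$ and of $|\det\partial_y\partial_\xi\phi_\epsilon|^{-1}$ are $O(s_\epsilon)$ for slow scale nets $s$ (nets with $|s_\epsilon|^q=O(\epsilon^{-1})$ for all $q\in\mathbb N$, for example the log-type case $s_\epsilon=\log(1/\epsilon)$), and that $(a_\epsilon)$ is regular, i.e. the exponent $N$ in the amplitude estimates can be chosen independently of $\alpha,\beta$. Then $T$ maps $\mathcal R_{L^p}(X)$ to itself and induces a well-defined continuous linear map $\mathcal G^\infty_{L^p}(X)\to\mathcal G^\infty_{L^p}(X)$. -/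

import Mathlib

open Filter Topology MeasureTheory Asymptotics
open scoped ContDiff ENNReal

noncomputable section

namespace ColombeauFIO

/-- The Euclidean space `ℝⁿ`. -/
abbrev Euc (n : ℕ) : Type := EuclideanSpace ℝ (Fin n)

/-- The parameter interval `0 < ε ≤ 1`. -/
abbrev Eps : Type := Set.Ioc (0 : ℝ) 1

/-- The filter `ε → 0` on the parameter interval. -/
def toZero : Filter Eps := comap (fun ε : Eps => (ε : ℝ)) (𝓝 0)

/-! ### The space of functions with all derivatives in `L^p(X)` -/

/-- `u` is smooth on the open set `X` and all its derivatives, `u` included, lie in `L^p(X)`.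
The values of `u` outside `X` are irrelevant. -/
def MemLpSmooth {n : ℕ} (X : Set (Euc n)) (p : ℝ≥0∞) (u : Euc n → ℂ) : Prop :=
  ContDiffOn ℝ ∞ u X ∧ ∀ k : ℕ, MemLp (iteratedFDeriv ℝ k u) p (volume.restrict X)

/-- The `L^p(X)` norm of the `k`-th derivative of `u`, that is (up to equivalence of norms) of all
`∂^α u` with `|α| = k`. For `k = 0` it is the `L^p(X)` norm of `u`. -/
def derivNorm {n : ℕ} (X : Set (Euc n)) (p : ℝ≥0∞) (k : ℕ) (u : Euc n → ℂ) : ℝ :=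
  (eLpNorm (iteratedFDeriv ℝ k u) p (volume.restrict X)).toReal

theorem iteratedFDeriv_add_ae {n : ℕ} {X : Set (Euc n)} (hX : IsOpen X) {u v : Euc n → ℂ}
    (hu : ContDiffOn ℝ ∞ u X) (hv : ContDiffOn ℝ ∞ v X) (k : ℕ) :
    iteratedFDeriv ℝ k (u + v) =ᵐ[volume.restrict X]
      iteratedFDeriv ℝ k u + iteratedFDeriv ℝ k v := by
  refine (ae_restrict_iff' hX.measurableSet).2 (Eventually.of_forall fun x hx => ?_)
  have h1 : ContDiffAt ℝ k u x :=
    (hu.contDiffAt (hX.mem_nhds hx)).of_le (by exact_mod_cast le_top)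
  have h2 : ContDiffAt ℝ k v x :=
    (hv.contDiffAt (hX.mem_nhds hx)).of_le (by exact_mod_cast le_top)
  exact iteratedFDeriv_add_apply h1 h2

theorem iteratedFDeriv_smul_ae {n : ℕ} {X : Set (Euc n)} (hX : IsOpen X) {u : Euc n → ℂ}
    (c : ℂ) (hu : ContDiffOn ℝ ∞ u X) (k : ℕ) :
    iteratedFDeriv ℝ k (c • u) =ᵐ[volume.restrict X] c • iteratedFDeriv ℝ k u := by
  refine (ae_restrict_iff' hX.measurableSet).2 (Eventually.of_forall fun x hx => ?_)
  have h1 : ContDiffAt ℝ k u x :=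
    (hu.contDiffAt (hX.mem_nhds hx)).of_le (by exact_mod_cast le_top)
  exact iteratedFDeriv_const_smul_apply h1

theorem MemLpSmooth.zero {n : ℕ} (X : Set (Euc n)) (p : ℝ≥0∞) :
    MemLpSmooth X p (0 : Euc n → ℂ) := by
  refine ⟨contDiffOn_const, fun k => ?_⟩
  have : iteratedFDeriv ℝ k (0 : Euc n → ℂ) = 0 := iteratedFDeriv_zero
  rw [this]
  exact MemLp.zero

theorem MemLpSmooth.add {n : ℕ} {X : Set (Euc n)} (hX : IsOpen X) {p : ℝ≥0∞}
    {u v : Euc n → ℂ} (hu : MemLpSmooth X p u) (hv : MemLpSmooth X p v) :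
    MemLpSmooth X p (u + v) :=
  ⟨hu.1.add hv.1, fun k =>
    (memLp_congr_ae (iteratedFDeriv_add_ae hX hu.1 hv.1 k)).2 ((hu.2 k).add (hv.2 k))⟩

theorem MemLpSmooth.smul {n : ℕ} {X : Set (Euc n)} (hX : IsOpen X) {p : ℝ≥0∞}
    {u : Euc n → ℂ} (c : ℂ) (hu : MemLpSmooth X p u) : MemLpSmooth X p (c • u) :=
  ⟨hu.1.const_smul c, fun k =>
    (memLp_congr_ae (iteratedFDeriv_smul_ae hX c hu.1 k)).2 ((hu.2 k).const_smul c)⟩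

theorem derivNorm_nonneg {n : ℕ} (X : Set (Euc n)) (p : ℝ≥0∞) (k : ℕ) (u : Euc n → ℂ) :
    0 ≤ derivNorm X p k u := ENNReal.toReal_nonneg

theorem derivNorm_zero {n : ℕ} (X : Set (Euc n)) (p : ℝ≥0∞) (k : ℕ) :
    derivNorm X p k (0 : Euc n → ℂ) = 0 := by
  have : iteratedFDeriv ℝ k (0 : Euc n → ℂ) = 0 := iteratedFDeriv_zero
  simp [derivNorm, this]

theorem derivNorm_add_le {n : ℕ} {X : Set (Euc n)} (hX : IsOpen X) {p : ℝ≥0∞} (hp : 1 ≤ p)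
    {u v : Euc n → ℂ} (hu : MemLpSmooth X p u) (hv : MemLpSmooth X p v) (k : ℕ) :
    derivNorm X p k (u + v) ≤ derivNorm X p k u + derivNorm X p k v := by
  unfold derivNorm
  rw [eLpNorm_congr_ae (iteratedFDeriv_add_ae hX hu.1 hv.1 k),
    ← ENNReal.toReal_add (hu.2 k).2.ne (hv.2 k).2.ne]
  exact ENNReal.toReal_mono (ENNReal.add_ne_top.2 ⟨(hu.2 k).2.ne, (hv.2 k).2.ne⟩)
    (eLpNorm_add_le (hu.2 k).1 (hv.2 k).1 hp)

theorem derivNorm_smul {n : ℕ} {X : Set (Euc n)} (hX : IsOpen X) {p : ℝ≥0∞}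
    {u : Euc n → ℂ} (c : ℂ) (hu : MemLpSmooth X p u) (k : ℕ) :
    derivNorm X p k (c • u) = ‖c‖ * derivNorm X p k u := by
  unfold derivNorm
  rw [eLpNorm_congr_ae (iteratedFDeriv_smul_ae hX c hu.1 k), eLpNorm_const_smul]
  simp

/-- The growth condition `‖∂^α u_ε‖_{L^p(X)} = O(ε^b)` as `ε → 0`, for all `|α| = k`. -/
def DerivO {n : ℕ} (X : Set (Euc n)) (p : ℝ≥0∞) (k : ℕ) (b : ℤ) (u : Eps → Euc n → ℂ) : Prop :=
  (fun ε => derivNorm X p k (u ε)) =O[toZero] fun ε => (ε : ℝ) ^ b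

theorem DerivO.zero {n : ℕ} (X : Set (Euc n)) (p : ℝ≥0∞) (k : ℕ) (b : ℤ) :
    DerivO X p k b (0 : Eps → Euc n → ℂ) := by
  simp only [DerivO, Pi.zero_apply, derivNorm_zero]
  exact isBigO_zero _ _

theorem DerivO.add {n : ℕ} {X : Set (Euc n)} (hX : IsOpen X) {p : ℝ≥0∞} (hp : 1 ≤ p)
    {u v : Eps → Euc n → ℂ} (hu : ∀ ε, MemLpSmooth X p (u ε)) (hv : ∀ ε, MemLpSmooth X p (v ε))
    {k : ℕ} {b : ℤ} (h : DerivO X p k b u) (h' : DerivO X p k b v) : DerivO X p k b (u + v) := by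
  refine IsBigO.trans (IsBigO.of_bound 1 (Eventually.of_forall fun ε => ?_)) (IsBigO.add h h')
  rw [one_mul, Real.norm_of_nonneg (derivNorm_nonneg _ _ _ _), Real.norm_of_nonneg
    (add_nonneg (derivNorm_nonneg _ _ _ _) (derivNorm_nonneg _ _ _ _))]
  exact derivNorm_add_le hX hp (hu ε) (hv ε) k

theorem DerivO.smul {n : ℕ} {X : Set (Euc n)} (hX : IsOpen X) {p : ℝ≥0∞}
    {u : Eps → Euc n → ℂ} (c : ℂ) (hu : ∀ ε, MemLpSmooth X p (u ε))
    {k : ℕ} {b : ℤ} (h : DerivO X p k b u) : DerivO X p k b (c • u) := by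
  have : (fun ε => derivNorm X p k ((c • u) ε)) = fun ε => ‖c‖ * derivNorm X p k (u ε) :=
    funext fun ε => derivNorm_smul hX c (hu ε) k
  unfold DerivO
  rw [this]
  exact IsBigO.const_mul_left h _

theorem DerivO.mono {n : ℕ} {X : Set (Euc n)} {p : ℝ≥0∞} {u : Eps → Euc n → ℂ}
    {k : ℕ} {b c : ℤ} (hbc : c ≤ b) (h : DerivO X p k b u) : DerivO X p k c u := by
  refine IsBigO.trans h (IsBigO.of_bound 1 (Eventually.of_forall fun ε => ?_))
  have h0 : (0 : ℝ) < ε := ε.2.1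
  rw [one_mul, Real.norm_of_nonneg (zpow_nonneg h0.le _), Real.norm_of_nonneg
    (zpow_nonneg h0.le _)]
  exact zpow_le_zpow_right_of_le_one₀ h0 ε.2.2 hbc

/-! ### Moderate, null and regular families, and the Colombeau spaces -/

/-- Moderate families: for every `α` there is `N` with `‖∂^α u_ε‖_{L^p(X)} = O(ε^{-N})`. -/
def moderate {n : ℕ} (X : Set (Euc n)) (hX : IsOpen X) (p : ℝ≥0∞) (hp : 1 ≤ p) :
    Submodule ℂ (Eps → Euc n → ℂ) where
  carrier := {u | (∀ ε, MemLpSmooth X p (u ε)) ∧ ∀ k : ℕ, ∃ N : ℕ, DerivO X p k (-(N : ℤ)) u}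
  zero_mem' := ⟨fun _ => MemLpSmooth.zero X p, fun k => ⟨0, DerivO.zero X p k _⟩⟩
  add_mem' := by
    rintro u v ⟨hu, hu'⟩ ⟨hv, hv'⟩
    refine ⟨fun ε => (hu ε).add hX (hv ε), fun k => ?_⟩
    obtain ⟨N, hN⟩ := hu' k
    obtain ⟨M, hM⟩ := hv' k
    exact ⟨max N M, DerivO.add hX hp hu hv (hN.mono (by simp)) (hM.mono (by simp))⟩
  smul_mem' := by
    rintro c u ⟨hu, hu'⟩
    refine ⟨fun ε => (hu ε).smul hX c, fun k => ?_⟩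
    obtain ⟨N, hN⟩ := hu' k
    exact ⟨N, hN.smul hX c hu⟩

/-- Null families: moderate families with `‖u_ε‖_{L^p(X)} = O(ε^N)` for every `N`. -/
def null {n : ℕ} (X : Set (Euc n)) (hX : IsOpen X) (p : ℝ≥0∞) (hp : 1 ≤ p) :
    Submodule ℂ (Eps → Euc n → ℂ) where
  carrier := {u | u ∈ moderate X hX p hp ∧ ∀ N : ℕ, DerivO X p 0 (N : ℤ) u}
  zero_mem' := ⟨Submodule.zero_mem _, fun _ => DerivO.zero X p 0 _⟩
  add_mem' := by
    rintro u v ⟨hu, hu'⟩ ⟨hv, hv'⟩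
    exact ⟨Submodule.add_mem _ hu hv, fun N => DerivO.add hX hp hu.1 hv.1 (hu' N) (hv' N)⟩
  smul_mem' := by
    rintro c u ⟨hu, hu'⟩
    exact ⟨Submodule.smul_mem _ c hu, fun N => (hu' N).smul hX c hu.1⟩

/-- Regular families: there is one `N` with `‖∂^α u_ε‖_{L^p(X)} = O(ε^{-N})` for every `α`. -/
def regular {n : ℕ} (X : Set (Euc n)) (hX : IsOpen X) (p : ℝ≥0∞) (hp : 1 ≤ p) :
    Submodule ℂ (Eps → Euc n → ℂ) where
  carrier := {u | (∀ ε, MemLpSmooth X p (u ε)) ∧ ∃ N : ℕ, ∀ k : ℕ, DerivO X p k (-(N : ℤ)) u}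
  zero_mem' := ⟨fun _ => MemLpSmooth.zero X p, 0, fun k => DerivO.zero X p k _⟩
  add_mem' := by
    rintro u v ⟨hu, N, hN⟩ ⟨hv, M, hM⟩
    exact ⟨fun ε => (hu ε).add hX (hv ε), max N M, fun k =>
      DerivO.add hX hp hu hv ((hN k).mono (by simp)) ((hM k).mono (by simp))⟩
  smul_mem' := by
    rintro c u ⟨hu, N, hN⟩
    exact ⟨fun ε => (hu ε).smul hX c, N, fun k => (hN k).smul hX c hu⟩

/-- The sharp topology on moderate families: a basis of neighbourhoods of `u` is given by the sets
of all `u + w` with `‖∂^α w_ε‖_{L^p(X)} = O(ε^m)` for `|α| ≤ k`, where `k` and `m` are naturals. -/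
@[reducible] def sharpTopology {n : ℕ} (X : Set (Euc n)) (hX : IsOpen X) (p : ℝ≥0∞) (hp : 1 ≤ p) :
    TopologicalSpace (moderate X hX p hp) where
  IsOpen V := ∀ u ∈ V, ∃ k m : ℕ, ∀ w : moderate X hX p hp,
    (∀ j ≤ k, DerivO X p j (m : ℤ) w.1) → u + w ∈ V
  isOpen_univ := fun _ _ => ⟨0, 0, fun _ _ => trivial⟩
  isOpen_inter := by
    rintro V W hV hW u ⟨huV, huW⟩
    obtain ⟨k, m, h⟩ := hV u huV
    obtain ⟨k', m', h'⟩ := hW u huW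
    refine ⟨max k k', max m m', fun w hw => ⟨h w fun j hj => ?_, h' w fun j hj => ?_⟩⟩
    · exact (hw j (hj.trans (le_max_left _ _))).mono (by simp)
    · exact (hw j (hj.trans (le_max_right _ _))).mono (by simp)
  isOpen_sUnion := by
    rintro s hs u ⟨V, hV, hu⟩
    obtain ⟨k, m, h⟩ := hs V hV u hu
    exact ⟨k, m, fun w hw => ⟨V, hV, h w hw⟩⟩

/-- The topology on regular families: a basis of neighbourhoods of `u` is given by the sets of all
`u + w` with `‖∂^α w_ε‖_{L^p(X)} = O(ε^m)` for all `α`, where `m` is a natural number. -/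
@[reducible] def regularTopology {n : ℕ} (X : Set (Euc n)) (hX : IsOpen X) (p : ℝ≥0∞) (hp : 1 ≤ p) :
    TopologicalSpace (regular X hX p hp) where
  IsOpen V := ∀ u ∈ V, ∃ m : ℕ, ∀ w : regular X hX p hp,
    (∀ j : ℕ, DerivO X p j (m : ℤ) w.1) → u + w ∈ V
  isOpen_univ := fun _ _ => ⟨0, fun _ _ => trivial⟩
  isOpen_inter := by
    rintro V W hV hW u ⟨huV, huW⟩
    obtain ⟨m, h⟩ := hV u huV
    obtain ⟨m', h'⟩ := hW u huW
    exact ⟨max m m', fun w hw => ⟨h w fun j => (hw j).mono (by simp),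
      h' w fun j => (hw j).mono (by simp)⟩⟩
  isOpen_sUnion := by
    rintro s hs u ⟨V, hV, hu⟩
    obtain ⟨m, h⟩ := hs V hV u hu
    exact ⟨m, fun w hw => ⟨V, hV, h w hw⟩⟩

/-- The Colombeau space `𝒢_{L^p}(X)`: moderate families modulo null families. -/
def Colombeau {n : ℕ} (X : Set (Euc n)) (hX : IsOpen X) (p : ℝ≥0∞) (hp : 1 ≤ p) : Type :=
  ↥(moderate X hX p hp) ⧸ (null X hX p hp).submoduleOf (moderate X hX p hp)

/-- The regular Colombeau space `𝒢^∞_{L^p}(X)`: regular families modulo null families. -/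
def RegularColombeau {n : ℕ} (X : Set (Euc n)) (hX : IsOpen X) (p : ℝ≥0∞) (hp : 1 ≤ p) : Type :=
  ↥(regular X hX p hp) ⧸ (null X hX p hp).submoduleOf (regular X hX p hp)

section Instances

variable {n : ℕ} (X : Set (Euc n)) (hX : IsOpen X) (p : ℝ≥0∞) (hp : 1 ≤ p)

instance : AddCommGroup (Colombeau X hX p hp) :=
  inferInstanceAs (AddCommGroup
    (↥(moderate X hX p hp) ⧸ (null X hX p hp).submoduleOf (moderate X hX p hp)))

instance : Module ℂ (Colombeau X hX p hp) :=
  inferInstanceAs (Module ℂ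
    (↥(moderate X hX p hp) ⧸ (null X hX p hp).submoduleOf (moderate X hX p hp)))

instance : AddCommGroup (RegularColombeau X hX p hp) :=
  inferInstanceAs (AddCommGroup
    (↥(regular X hX p hp) ⧸ (null X hX p hp).submoduleOf (regular X hX p hp)))

instance : Module ℂ (RegularColombeau X hX p hp) :=
  inferInstanceAs (Module ℂ
    (↥(regular X hX p hp) ⧸ (null X hX p hp).submoduleOf (regular X hX p hp)))

/-- The class of a moderate family. -/
def Colombeau.mk : moderate X hX p hp →ₗ[ℂ] Colombeau X hX p hp :=
  ((null X hX p hp).submoduleOf (moderate X hX p hp)).mkQ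

/-- The class of a regular family. -/
def RegularColombeau.mk : regular X hX p hp →ₗ[ℂ] RegularColombeau X hX p hp :=
  ((null X hX p hp).submoduleOf (regular X hX p hp)).mkQ

/-- The sharp topology of `𝒢_{L^p}(X)`, as a quotient topology. -/
instance : TopologicalSpace (Colombeau X hX p hp) :=
  TopologicalSpace.coinduced (Colombeau.mk X hX p hp) (sharpTopology X hX p hp)

/-- The topology of `𝒢^∞_{L^p}(X)`, as a quotient topology. -/
instance : TopologicalSpace (RegularColombeau X hX p hp) :=
  TopologicalSpace.coinduced (RegularColombeau.mk X hX p hp) (regularTopology X hX p hp)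

end Instances

/-! ### Generalised phase functions and amplitudes -/

/-- `sup_{z ∈ s} f_ε(z)` is finite for every `ε` and is `O(g_ε)` as `ε → 0`
(used for nonnegative `f`). -/
def SupBigO {α : Type*} (s : Set α) (f : Eps → α → ℝ) (g : Eps → ℝ) : Prop :=
  (∀ ε, ∃ C : ℝ, ∀ z ∈ s, f ε z ≤ C) ∧
    ∃ C : ℝ, ∀ᶠ ε in toZero, ∀ z ∈ s, f ε z ≤ C * g ε

/-- Slow scale nets: `s_ε^q = O(ε^{-1})` for every `q`. -/
def IsSlowScale (s : Eps → ℝ) : Prop :=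
  ∀ q : ℕ, (fun ε => |s ε| ^ q) =O[toZero] fun ε => (ε : ℝ)⁻¹

/-- The matrix `∂_y ∂_ξ φ`, with entries `∂²φ / ∂y_j ∂ξ_k`. -/
def mixedHessian {n : ℕ} (φ : Euc n → Euc n → Euc n → ℝ) (x y ξ : Euc n) :
    Matrix (Fin n) (Fin n) ℝ :=
  Matrix.of fun j k =>
    fderiv ℝ (fun y' => fderiv ℝ (fun ξ' => φ x y' ξ') ξ (EuclideanSpace.single k 1)) y
      (EuclideanSpace.single j 1)

/-- The function `φ(x, y, ξ)` as a function of one variable in `ℝⁿ × ℝⁿ × ℝⁿ`. -/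
def uncurry₃ {n : ℕ} {F : Type*} (φ : Euc n → Euc n → Euc n → F) (z : Euc n × Euc n × Euc n) : F :=
  φ z.1 z.2.1 z.2.2

/-- Non-degenerate phase functions on `X × X`: real-valued, smooth off `ξ = 0`, positively
homogeneous of degree one in `ξ`, with `det ∂_y ∂_ξ φ ≠ 0`. -/
structure IsPhase {n : ℕ} (X : Set (Euc n)) (φ : Euc n → Euc n → Euc n → ℝ) : Prop where
  smooth : ContDiffOn ℝ ∞ (uncurry₃ φ) (X ×ˢ X ×ˢ {0}ᶜ)
  homogeneous : ∀ x ∈ X, ∀ y ∈ X, ∀ ξ : Euc n, ξ ≠ 0 → ∀ t : ℝ, 0 < t →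
    φ x y (t • ξ) = t * φ x y ξ
  nondegenerate : ∀ x ∈ X, ∀ y ∈ X, ∀ ξ : Euc n, ξ ≠ 0 → (mixedHessian φ x y ξ).det ≠ 0

/-- The points `(x, y, ξ)` with `(x, y) ∈ S` and `|ξ| = 1`. -/
def overSphere {n : ℕ} (S : Set (Euc n × Euc n)) : Set (Euc n × Euc n × Euc n) :=
  {z | (z.1, z.2.1) ∈ S ∧ ‖z.2.2‖ = 1}

/-- Generalised non-degenerate phase functions: families of non-degenerate phase functions all of
whose derivatives, and whose inverse determinant `|det ∂_y ∂_ξ φ_ε|⁻¹`, are of moderate growth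
over `S` (by homogeneity it is enough to consider `|ξ| = 1`). -/
structure IsGenPhase {n : ℕ} (X : Set (Euc n)) (S : Set (Euc n × Euc n))
    (φ : Eps → Euc n → Euc n → Euc n → ℝ) : Prop where
  phase : ∀ ε, IsPhase X (φ ε)
  moderate : ∀ k : ℕ, ∃ N : ℕ, SupBigO (overSphere S)
    (fun ε z => ‖iteratedFDeriv ℝ k (uncurry₃ (φ ε)) z‖) fun ε => (ε : ℝ) ^ (-(N : ℤ))
  nondegenerate : ∃ N : ℕ, SupBigO (overSphere S)
    (fun ε z => |(uncurry₃ (mixedHessian (φ ε)) z).det|⁻¹) fun ε => (ε : ℝ) ^ (-(N : ℤ))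

/-- The slow scale condition: the bounds on the derivatives and on the inverse determinant are slow
scale nets (for example powers of `log (1 / ε)`). -/
structure IsSlowScalePhase {n : ℕ} (S : Set (Euc n × Euc n))
    (φ : Eps → Euc n → Euc n → Euc n → ℝ) : Prop where
  slow : ∀ k : ℕ, ∃ s : Eps → ℝ, IsSlowScale s ∧ SupBigO (overSphere S)
    (fun ε z => ‖iteratedFDeriv ℝ k (uncurry₃ (φ ε)) z‖) s
  nondegenerate : ∃ s : Eps → ℝ, IsSlowScale s ∧ SupBigO (overSphere S)
    (fun ε z => |(uncurry₃ (mixedHessian (φ ε)) z).det|⁻¹) s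

/-- The weighted size `(1 + |ξ|)^{l - μ} |∂_{x,y}^α ∂_ξ^β a|`, over all `|α| = k` and `|β| = l`. -/
def symbolSize {n : ℕ} (μ : ℝ) (k l : ℕ) (a : Euc n → Euc n → Euc n → ℂ)
    (z : Euc n × Euc n × Euc n) : ℝ :=
  (1 + ‖z.2.2‖) ^ ((l : ℝ) - μ) *
    ‖iteratedFDeriv ℝ l
      (fun η => iteratedFDeriv ℝ k (fun w : Euc n × Euc n => a w.1 w.2 η) (z.1, z.2.1)) z.2.2‖

/-- Generalised amplitudes of order `μ` with support over `S`: families of smooth amplitudes in the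
symbol class `S^μ`, all of whose symbol estimates are of moderate growth. -/
structure IsGenAmplitude {n : ℕ} (X : Set (Euc n)) (S : Set (Euc n × Euc n)) (μ : ℝ)
    (a : Eps → Euc n → Euc n → Euc n → ℂ) : Prop where
  smooth : ∀ ε, ContDiffOn ℝ ∞ (uncurry₃ (a ε)) (X ×ˢ X ×ˢ Set.univ)
  support : ∀ ε, ∀ x ∈ X, ∀ y ∈ X, (x, y) ∉ S → ∀ ξ, a ε x y ξ = 0
  moderate : ∀ k l : ℕ, ∃ N : ℕ, SupBigO (X ×ˢ X ×ˢ Set.univ)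
    (fun ε => symbolSize μ k l (a ε)) fun ε => (ε : ℝ) ^ (-(N : ℤ))

/-- Regular families of amplitudes: the exponent `N` does not depend on the derivative. -/
def IsRegularAmplitude {n : ℕ} (X : Set (Euc n)) (μ : ℝ)
    (a : Eps → Euc n → Euc n → Euc n → ℂ) : Prop :=
  ∃ N : ℕ, ∀ k l : ℕ, SupBigO (X ×ˢ X ×ˢ Set.univ)
    (fun ε => symbolSize μ k l (a ε)) fun ε => (ε : ℝ) ^ (-(N : ℤ))

/-! ### Generalised Fourier integral operators -/

/-- The integrand `e^{iφ(x,y,ξ)} a(x,y,ξ) u(y)`. -/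
def integrand {n : ℕ} (φ : Euc n → Euc n → Euc n → ℝ) (a : Euc n → Euc n → Euc n → ℂ)
    (u : Euc n → ℂ) (x ξ y : Euc n) : ℂ :=
  Complex.exp (Complex.I * (φ x y ξ : ℂ)) * a x y ξ * u y

/-- The Fourier integral operator
`Tu(x) = (2π)^{-n} ∫_{ℝⁿ} ∫_X e^{iφ(x,y,ξ)} a(x,y,ξ) u(y) dy dξ`. -/
def fio {n : ℕ} (X : Set (Euc n)) (φ : Euc n → Euc n → Euc n → ℝ)
    (a : Euc n → Euc n → Euc n → ℂ) (u : Euc n → ℂ) (x : Euc n) : ℂ :=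
  (((2 * Real.pi) ^ n : ℝ) : ℂ)⁻¹ * ∫ ξ, ∫ y in X, integrand φ a u x ξ y

/-- The generalised Fourier integral operator, on representatives. -/
def genFIO {n : ℕ} (X : Set (Euc n)) (φ : Eps → Euc n → Euc n → Euc n → ℝ)
    (a : Eps → Euc n → Euc n → Euc n → ℂ) (u : Eps → Euc n → ℂ) : Eps → Euc n → ℂ :=
  fun ε => fio X (φ ε) (a ε) (u ε)

end ColombeauFIO

end

/-!
Integrations by parts in `y` give the inner integral any prescribed decay in `ξ`, because the phase
has no stationary points in `y`. By homogeneity, Euler's relation gives `∇_y φ = (∂_y ∂_ξ φ) ξ`, so that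
`det ∂_y ∂_ξ φ ≠ 0` yields `|∇_y φ| ≥ c |ξ|`; Cramer's rule makes `c⁻¹` polynomial in the bounds for
the phase (`inv_sum_mulVec_sq_le`, `exists_phaseBound`). As the amplitude vanishes for `y` outside a
compact subset of `X`, the inner integral can be integrated by parts in `y` on `X` without boundary
terms (`setIntegral_exp_mul_eq`). Each step gains a factor `|ξ|⁻¹` and costs one derivative of `u`
and of the amplitude (`exists_jetLE_oscIntegrand`). After enough steps at the frequencies `|ξ| > 1`,
the double integral and any given number of its derivatives in `x` converge absolutely and uniformly
in `x ∈ X`, and one may differentiate under the integral sign (`fio_estimate`).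

On the bounded set `X` the norm of `L^p` is controlled by the supremum and controls the norm of `L¹`.
Hence `‖∂^k T_ε u‖_p ≤ C b_ε^Q A_ε Σ_{j ≤ R} ‖∂^j u‖_p`, where `b_ε` bounds the phase and `A_ε` the
amplitude, and `C`, `Q`, `R` do not depend on `ε` (`exists_fio_bound`). The loss of derivatives is
harmless, since moderateness, regularity and the neighbourhoods of both topologies involve
derivatives of all orders or of any finite number of orders.

Null families are only required to have small norms in `L^p`, without derivatives. There the
frequencies are split at `|ξ| ~ h⁻¹`: the low ones are estimated trivially by `h^{-e} ‖u‖_p`, the high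
ones by `h Σ_{j ≤ R} ‖∂^j u‖_p` (`norm_fio_le_interpolation`). With `h = ε^L` and `L` large compared
with the growth of the derivatives, both are negligible (`FIOFamily.null_mem`).

If the phase is slow scale, `b_ε` can be chosen slow scale, so that `b_ε^Q = O(ε⁻¹)` whatever `Q` is.
The norms then grow like `ε^{-1-N}` with the exponent `N` of the amplitude, for all orders of
derivatives simultaneously, which is what regular families and their topology require
(`FIOBounded.regular_mem`, `exists_regularColombeau_map`).
-/

namespace ColombeauFIO

/-! ### Pointwise bounds on jets -/

/-- All derivatives of `f` at `w` of order at most `R` are bounded by `A`. -/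
def JetLE {E F : Type*} [NormedAddCommGroup E] [NormedSpace ℝ E] [NormedAddCommGroup F]
    [NormedSpace ℝ F] (R : ℕ) (f : E → F) (w : E) (A : ℝ) : Prop :=
  ∀ k ≤ R, ‖iteratedFDeriv ℝ k f w‖ ≤ A

section Jets

variable {E F : Type*} [NormedAddCommGroup E] [NormedSpace ℝ E] [NormedAddCommGroup F]
  [NormedSpace ℝ F] {O : Set E} {w : E} {R : ℕ}

theorem JetLE.nonneg {f : E → F} {A : ℝ} (h : JetLE R f w A) : 0 ≤ A :=
  (norm_nonneg _).trans (h 0 (Nat.zero_le _))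

theorem JetLE.mono {f : E → F} {A A' : ℝ} {R' : ℕ} (h : JetLE R f w A) (hR : R' ≤ R)
    (hA : A ≤ A') : JetLE R' f w A' :=
  fun k hk => (h k (hk.trans hR)).trans hA

theorem JetLE.norm_le {f : E → F} {A : ℝ} (h : JetLE R f w A) : ‖f w‖ ≤ A := by
  simpa using h 0 (Nat.zero_le _)

theorem JetLE.congr {f g : E → F} {A : ℝ} (h : JetLE R f w A) (hfg : g =ᶠ[𝓝 w] f) :
    JetLE R g w A := fun k hk => by
  rw [(hfg.iteratedFDeriv ℝ k).eq_of_nhds]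
  exact h k hk

theorem JetLE.of_eventuallyEq_zero {f : E → F} {A : ℝ} (hA : 0 ≤ A) (hf : f =ᶠ[𝓝 w] 0) :
    JetLE R f w A := by
  refine JetLE.congr (fun k _ => ?_) hf
  have : iteratedFDeriv ℝ k (0 : E → F) = 0 := iteratedFDeriv_zero
  simpa [this] using hA

theorem JetLE.sum {ι : Type*} {s : Finset ι} {f : ι → E → F} {A : ι → ℝ}
    (hf : ∀ i ∈ s, ContDiffAt ℝ ∞ (f i) w) (h : ∀ i ∈ s, JetLE R (f i) w (A i)) :
    JetLE R (fun z => ∑ i ∈ s, f i z) w (∑ i ∈ s, A i) := fun k hk => by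
  have : iteratedFDeriv ℝ k (fun z => ∑ i ∈ s, f i z) w = ∑ i ∈ s, iteratedFDeriv ℝ k (f i) w :=
    iteratedFDeriv_fun_sum_apply (fun i hi => (hf i hi).of_le (by exact_mod_cast le_top))
  rw [this]
  exact (norm_sum_le _ _).trans (Finset.sum_le_sum fun i hi => h i hi k hk)

theorem JetLE.const_smul {𝕜 : Type*} [RCLike 𝕜] [NormedSpace 𝕜 F] [SMulCommClass ℝ 𝕜 F]
    {f : E → F} {A : ℝ} (c : 𝕜)
    (hf : ContDiffAt ℝ ∞ f w) (h : JetLE R f w A) : JetLE R (fun z => c • f z) w (‖c‖ * A) :=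
  fun k hk => by
  have : iteratedFDeriv ℝ k (fun z => c • f z) w = c • iteratedFDeriv ℝ k f w :=
    iteratedFDeriv_const_smul_apply (hf.of_le (by exact_mod_cast le_top))
  rw [this, norm_smul]
  exact mul_le_mul_of_nonneg_left (h k hk) (norm_nonneg _)

theorem JetLE.smul {𝕜 : Type*} [NormedField 𝕜] [NormedAlgebra ℝ 𝕜] [NormedSpace 𝕜 F]
    [IsScalarTower ℝ 𝕜 F] (hO : IsOpen O) (hw : w ∈ O) {f : E → 𝕜} {g : E → F} {A B : ℝ}
    (hf : ContDiffOn ℝ ∞ f O) (hg : ContDiffOn ℝ ∞ g O) (hfA : JetLE R f w A)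
    (hgB : JetLE R g w B) : JetLE R (fun z => f z • g z) w (2 ^ R * A * B) := fun k hk => by
  have key := norm_iteratedFDerivWithin_smul_le (n := k) hf hg hO.uniqueDiffOn hw
    (by exact_mod_cast le_top)
  simp only [iteratedFDerivWithin_of_isOpen _ hO hw] at key
  refine key.trans ?_
  have hA := hfA.nonneg
  have hB := hgB.nonneg
  calc _ ≤ ∑ i ∈ Finset.range (k + 1), (k.choose i : ℝ) * A * B := by
        refine Finset.sum_le_sum fun i hi => ?_
        have hi' : i ≤ k := Nat.lt_succ_iff.1 (Finset.mem_range.1 hi)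
        gcongr
        · exact hfA i (hi'.trans hk)
        · exact hgB (k - i) ((Nat.sub_le _ _).trans hk)
    _ = 2 ^ k * A * B := by
        rw [← Finset.sum_mul, ← Finset.sum_mul]
        congr 2
        exact_mod_cast Nat.sum_range_choose k
    _ ≤ 2 ^ R * A * B := by
        gcongr
        norm_num

theorem _root_.ContDiffOn.fderiv_apply_const {f : E → F} (hO : IsOpen O) (hf : ContDiffOn ℝ ∞ f O)
    (e : E) : ContDiffOn ℝ ∞ (fun z => fderiv ℝ f z e) O :=
  (hf.fderiv_of_isOpen hO (by simp)).clm_apply contDiffOn_const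

theorem JetLE.fderiv_apply {f : E → F} (hO : IsOpen O) (hw : w ∈ O) {A : ℝ}
    (hf : ContDiffOn ℝ ∞ f O) (h : JetLE (R + 1) f w A) {e : E} (he : ‖e‖ ≤ 1) :
    JetLE R (fun z => fderiv ℝ f z e) w A := fun k hk => by
  have h1 : ContDiffAt ℝ k (fderiv ℝ f) w :=
    ((hf.fderiv_of_isOpen hO (m := ∞) (by simp)).contDiffAt (hO.mem_nhds hw)).of_le
      (by exact_mod_cast le_top)
  refine (norm_iteratedFDeriv_clm_apply_const h1 le_rfl).trans ?_
  rw [norm_iteratedFDeriv_fderiv]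
  exact (mul_le_of_le_one_left (norm_nonneg _) he).trans (h (k + 1) (by omega))

/-- Bound on the jet of a composition, by the Faà di Bruno formula. -/
theorem JetLE.comp {G : Type*} [NormedAddCommGroup G] [NormedSpace ℝ G]
    (hO : IsOpen O) (hw : w ∈ O) {f : E → F} {g : F → G}
    {t : Set F} (ht : IsOpen t) (hg : ContDiffOn ℝ ∞ g t) (hf : ContDiffOn ℝ ∞ f O)
    (hft : Set.MapsTo f O t) {A C : ℝ} (hA : 1 ≤ A) (hfA : JetLE R f w A)
    (hgC : JetLE R g (f w) C) : JetLE R (fun z => g (f z)) w (R.factorial * C * A ^ R) :=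
  fun k hk => by
  have hC := hgC.nonneg
  have key := norm_iteratedFDerivWithin_comp_le (n := k) (C := C) (D := A) hg hf
    (by exact_mod_cast le_top) ht.uniqueDiffOn hO.uniqueDiffOn hft hw
    (fun i hi => by
      rw [iteratedFDerivWithin_of_isOpen _ ht (hft hw)]
      exact hgC i (hi.trans hk))
    (fun i hi hik => by
      rw [iteratedFDerivWithin_of_isOpen _ hO hw]
      exact (hfA i (hik.trans hk)).trans (le_self_pow₀ hA (by omega)))
  rw [iteratedFDerivWithin_of_isOpen _ hO hw] at key
  refine key.trans ?_
  have : (k.factorial : ℝ) ≤ R.factorial := by exact_mod_cast Nat.factorial_le hk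
  gcongr

theorem jetLE_inv {x D : ℝ} (hx : |x|⁻¹ ≤ D) (hD : 1 ≤ D) :
    JetLE R (fun t : ℝ => t⁻¹) x (R.factorial * D ^ (R + 1)) := fun k hk => by
  have h1 : iteratedDeriv k (fun t : ℝ => t⁻¹) x = (-1) ^ k * k.factorial * x ^ (-1 - k : ℤ) := by
    rw [iteratedDeriv_eq_iterate]
    exact iter_deriv_inv k x
  rw [norm_iteratedFDeriv_eq_norm_iteratedDeriv, h1]
  have h2 : ‖x ^ (-1 - k : ℤ)‖ = |x|⁻¹ ^ (k + 1) := by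
    rw [norm_zpow, Real.norm_eq_abs, show (-1 - k : ℤ) = -((k + 1 : ℕ) : ℤ) by push_cast; ring,
      zpow_neg, zpow_natCast, inv_pow]
  rw [norm_mul, norm_mul, h2]
  simp only [norm_pow, norm_neg, norm_one, one_pow, one_mul, RCLike.norm_natCast]
  have h3 : (k.factorial : ℝ) ≤ R.factorial := by exact_mod_cast Nat.factorial_le hk
  calc (k.factorial : ℝ) * |x|⁻¹ ^ (k + 1) ≤ R.factorial * D ^ (k + 1) := by gcongr
    _ ≤ R.factorial * D ^ (R + 1) := by gcongr

theorem jetLE_cexp (x : ℝ) : JetLE R (fun t : ℝ => Complex.exp (Complex.I * t)) x 1 :=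
  fun k _ => by
  have h1 : ∀ k : ℕ, iteratedDeriv k (fun t : ℝ => Complex.exp (Complex.I * t)) =
      fun t : ℝ => Complex.I ^ k * Complex.exp (Complex.I * t) := by
    intro k
    induction k with
    | zero => simp
    | succ k ih =>
      rw [iteratedDeriv_succ, ih]
      funext t
      have h2 : HasDerivAt (fun t : ℝ => Complex.I * (t : ℂ)) Complex.I t := by
        simpa using (Complex.ofRealCLM.hasDerivAt (x := t)).const_mul Complex.I
      have := (h2.cexp.const_mul (Complex.I ^ k)).deriv
      rw [this]
      ring
  rw [norm_iteratedFDeriv_eq_norm_iteratedDeriv, h1]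
  simp [mul_comm Complex.I, Complex.norm_exp_ofReal_mul_I]

theorem contDiff_cexp_I : ContDiff ℝ ∞ (fun t : ℝ => Complex.exp (Complex.I * t)) :=
  (contDiff_const.mul Complex.ofRealCLM.contDiff).cexp

theorem JetLE.cexp (hO : IsOpen O) (hw : w ∈ O) {ψ : E → ℝ} (hψ : ContDiffOn ℝ ∞ ψ O) {A : ℝ}
    (hA : 1 ≤ A) (h : JetLE R ψ w A) :
    JetLE R (fun z => Complex.exp (Complex.I * (ψ z : ℂ))) w (R.factorial * A ^ R) := by
  have := JetLE.comp hO hw isOpen_univ contDiff_cexp_I.contDiffOn hψ (Set.mapsTo_univ _ _) hA h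
    (jetLE_cexp (ψ w))
  simpa using this

theorem JetLE.inv (hO : IsOpen O) (hw : w ∈ O) {f : E → ℝ} (hf : ContDiffOn ℝ ∞ f O)
    (hf0 : ∀ z ∈ O, f z ≠ 0) {A D : ℝ} (hA : 1 ≤ A) (hD : 1 ≤ D) (h : JetLE R f w A)
    (hfD : |f w|⁻¹ ≤ D) :
    JetLE R (fun z => (f z)⁻¹) w (R.factorial * (R.factorial * D ^ (R + 1)) * A ^ R) :=
  JetLE.comp hO hw isOpen_compl_singleton
    (fun _ hx => (contDiffAt_inv ℝ hx).contDiffWithinAt) hf (fun z hz => hf0 z hz) hA h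
    (jetLE_inv hfD hD)

theorem iteratedFDeriv_comp_affine {G : Type*} [NormedAddCommGroup G] [NormedSpace ℝ G]
    (hO : IsOpen O) {f : E → F} (hf : ContDiffOn ℝ ∞ f O) (L : G →L[ℝ] E) (c : E) {x : G}
    (hx : L x + c ∈ O) (k : ℕ) :
    iteratedFDeriv ℝ k (fun z => f (L z + c)) x =
      (iteratedFDeriv ℝ k f (L x + c)).compContinuousLinearMap fun _ => L := by
  set s : Set E := (fun z => z + c) ⁻¹' O
  have hs : IsOpen s := hO.preimage (by fun_prop)
  have hf' : ContDiffOn ℝ ∞ (fun z => f (z + c)) s :=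
    hf.comp (contDiff_id.add contDiff_const).contDiffOn fun z hz => hz
  have hs' : IsOpen (L ⁻¹' s) := hs.preimage L.continuous
  have hx' : L x ∈ s := hx
  have key := L.iteratedFDerivWithin_comp_right hf' hs.uniqueDiffOn hs'.uniqueDiffOn hx' (i := k)
    (by exact_mod_cast le_top)
  rw [iteratedFDerivWithin_of_isOpen _ hs' hx', iteratedFDerivWithin_of_isOpen _ hs hx',
    iteratedFDeriv_comp_add_right] at key
  exact key

theorem norm_iteratedFDeriv_comp_affine_le {G : Type*} [NormedAddCommGroup G] [NormedSpace ℝ G]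
    (hO : IsOpen O) {f : E → F} (hf : ContDiffOn ℝ ∞ f O) (L : G →L[ℝ] E) (hL : ‖L‖ ≤ 1) (c : E)
    {x : G} (hx : L x + c ∈ O) (k : ℕ) :
    ‖iteratedFDeriv ℝ k (fun z => f (L z + c)) x‖ ≤ ‖iteratedFDeriv ℝ k f (L x + c)‖ := by
  rw [iteratedFDeriv_comp_affine hO hf L c hx k]
  refine (ContinuousMultilinearMap.norm_compContinuousLinearMap_le _ _).trans ?_
  refine mul_le_of_le_one_right (norm_nonneg _) ?_
  exact Finset.prod_le_one (fun _ _ => norm_nonneg _) fun _ _ => hL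

end Jets

/-! ### The non-stationary phase operator -/

/-- The unit vector of `ℝⁿ × ℝⁿ` in the direction of `y_j`. -/
noncomputable def yDir {n : ℕ} (j : Fin n) : Euc n × Euc n := (0, EuclideanSpace.single j 1)

theorem norm_yDir {n : ℕ} (j : Fin n) : ‖yDir j‖ = 1 := by
  simp [yDir, Prod.norm_def]

/-- The square `|∇_y ψ|²` of the gradient in the second variable. -/
noncomputable def gradSq {n : ℕ} (ψ : Euc n × Euc n → ℝ) (w : Euc n × Euc n) : ℝ :=
  ∑ j, fderiv ℝ ψ w (yDir j) ^ 2

/-- The components of the vector field `∇_y ψ / |∇_y ψ|²`. -/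
noncomputable def gradField {n : ℕ} (ψ : Euc n × Euc n → ℝ) (j : Fin n) (w : Euc n × Euc n) : ℝ :=
  (gradSq ψ w)⁻¹ * fderiv ℝ ψ w (yDir j)

/-- The operator `g ↦ div_y (g ∇_y ψ / |∇_y ψ|²)`. Up to the factor `i` it is the transpose of
`|∇_y ψ|⁻² ∇_y ψ · ∇_y`, which maps `e^{iψ}` to `i e^{iψ}`. -/
noncomputable def divGrad {n : ℕ} (ψ : Euc n × Euc n → ℝ) (g : Euc n × Euc n → ℂ)
    (w : Euc n × Euc n) : ℂ :=
  ∑ j, fderiv ℝ (fun z => gradField ψ j z • g z) w (yDir j)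

section NonStationary

variable {n : ℕ} {O : Set (Euc n × Euc n)} {w : Euc n × Euc n} {ψ : Euc n × Euc n → ℝ}
  {g : Euc n × Euc n → ℂ} {R : ℕ}

theorem contDiffOn_gradSq (hO : IsOpen O) (hψ : ContDiffOn ℝ ∞ ψ O) :
    ContDiffOn ℝ ∞ (gradSq ψ) O :=
  ContDiffOn.sum fun j _ => (hψ.fderiv_apply_const hO (yDir j)).pow 2

theorem contDiffOn_gradField (hO : IsOpen O) (hψ : ContDiffOn ℝ ∞ ψ O)
    (h0 : ∀ z ∈ O, gradSq ψ z ≠ 0) (j : Fin n) : ContDiffOn ℝ ∞ (gradField ψ j) O :=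
  ((contDiffOn_gradSq hO hψ).inv h0).mul (hψ.fderiv_apply_const hO (yDir j))

theorem contDiffOn_divGrad (hO : IsOpen O) (hψ : ContDiffOn ℝ ∞ ψ O)
    (h0 : ∀ z ∈ O, gradSq ψ z ≠ 0) (hg : ContDiffOn ℝ ∞ g O) : ContDiffOn ℝ ∞ (divGrad ψ g) O :=
  ContDiffOn.sum fun j _ =>
    ((contDiffOn_gradField hO hψ h0 j).smul hg).fderiv_apply_const hO (yDir j)

theorem contDiffOn_divGrad_iterate (hO : IsOpen O) (hψ : ContDiffOn ℝ ∞ ψ O)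
    (h0 : ∀ z ∈ O, gradSq ψ z ≠ 0) (hg : ContDiffOn ℝ ∞ g O) (M : ℕ) :
    ContDiffOn ℝ ∞ ((divGrad ψ)^[M] g) O := by
  induction M with
  | zero => exact hg
  | succ M ih =>
    rw [Function.iterate_succ_apply']
    exact contDiffOn_divGrad hO hψ h0 ih

theorem divGrad_eventuallyEq_zero (hg : g =ᶠ[𝓝 w] 0) : divGrad ψ g =ᶠ[𝓝 w] 0 := by
  filter_upwards [hg.eventuallyEq_nhds] with z hz
  refine Finset.sum_eq_zero fun j _ => ?_
  have : (fun y => gradField ψ j y • g y) =ᶠ[𝓝 z] fun _ => 0 := by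
    filter_upwards [hz] with y hy
    simp [hy]
  rw [this.fderiv_eq]
  simp

theorem divGrad_iterate_eventuallyEq_zero (hg : g =ᶠ[𝓝 w] 0) (M : ℕ) :
    (divGrad ψ)^[M] g =ᶠ[𝓝 w] 0 := by
  induction M with
  | zero => exact hg
  | succ M ih =>
    rw [Function.iterate_succ_apply']
    exact divGrad_eventuallyEq_zero ih

theorem gradField_eqOn_of_eqOn_smul (hO : IsOpen O) {ψ' : Euc n × Euc n → ℝ} {l : ℝ}
    (hψ : DifferentiableOn ℝ ψ O) (h : Set.EqOn ψ' (fun z => l • ψ z) O) (j : Fin n) :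
    Set.EqOn (gradField ψ' j) (fun z => l⁻¹ • gradField ψ j z) O := by
  intro z hz
  have h1 : ∀ i : Fin n, fderiv ℝ ψ' z (yDir i) = l * fderiv ℝ ψ z (yDir i) := fun i => by
    rw [(h.eventuallyEq_of_mem (hO.mem_nhds hz)).fderiv_eq,
      fderiv_fun_const_smul ((hψ z hz).differentiableAt (hO.mem_nhds hz))]
    simp
  simp only [gradField, gradSq, h1, mul_pow, ← Finset.mul_sum, smul_eq_mul, mul_inv]
  by_cases hl : l = 0
  · simp [hl]
  · field_simp

/-- The components of `∇_y ψ / |∇_y ψ|²` have jets of polynomial size in the jet of `ψ` and in the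
inverse of `|∇_y ψ|²`. -/
theorem exists_jetLE_gradField (n R : ℕ) : ∃ C : ℝ, ∃ Q : ℕ, 0 ≤ C ∧
    ∀ {O : Set (Euc n × Euc n)} {w : Euc n × Euc n} {ψ : Euc n × Euc n → ℝ} {B : ℝ},
      IsOpen O → w ∈ O → ContDiffOn ℝ ∞ ψ O → (∀ z ∈ O, gradSq ψ z ≠ 0) → 1 ≤ B →
      JetLE (R + 1) ψ w B → (gradSq ψ w)⁻¹ ≤ B → ∀ j, JetLE R (gradField ψ j) w (C * B ^ Q) := by
  refine ⟨2 ^ R * (R.factorial * R.factorial * ((n + 1) * 2 ^ R) ^ R), 2 * R + (R + 1) + 1,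
    by positivity, ?_⟩
  intro O w ψ B hO hw hψ h0 hB hJ hD j
  have hd : ∀ i : Fin n, JetLE R (fun z => fderiv ℝ ψ z (yDir i)) w B := fun i =>
    hJ.fderiv_apply hO hw hψ (norm_yDir i).le
  have hs : ∀ i : Fin n, ContDiffOn ℝ ∞ (fun z => fderiv ℝ ψ z (yDir i)) O := fun i =>
    hψ.fderiv_apply_const hO _
  have hsq : ∀ i : Fin n, JetLE R (fun z => fderiv ℝ ψ z (yDir i) ^ 2) w (2 ^ R * B * B) :=
    fun i => by
      simpa only [smul_eq_mul, ← pow_two] using JetLE.smul hO hw (hs i) (hs i) (hd i) (hd i)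
  have hG : JetLE R (gradSq ψ) w ((n + 1) * 2 ^ R * B ^ 2) := by
    refine JetLE.mono (JetLE.sum (s := Finset.univ) (fun i _ =>
      ((hs i).pow 2).contDiffAt (hO.mem_nhds hw)) fun i _ => hsq i) le_rfl ?_
    simp only [Finset.sum_const, Finset.card_univ, Fintype.card_fin, nsmul_eq_mul]
    have : 0 ≤ 2 ^ R * B * B := by positivity
    nlinarith
  have hG1 : 1 ≤ (n + 1) * 2 ^ R * B ^ 2 := by
    have h1 : (1 : ℝ) ≤ n + 1 := by simp
    have h2 : (1 : ℝ) ≤ 2 ^ R := one_le_pow₀ (by norm_num)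
    exact one_le_mul_of_one_le_of_one_le (one_le_mul_of_one_le_of_one_le h1 h2) (one_le_pow₀ hB)
  have hpos : 0 ≤ gradSq ψ w := Finset.sum_nonneg fun _ _ => sq_nonneg _
  have hI := JetLE.inv hO hw (contDiffOn_gradSq hO hψ) h0 hG1 hB hG
    (by rwa [abs_of_nonneg hpos])
  have := JetLE.smul hO hw ((contDiffOn_gradSq hO hψ).inv h0) (hs j) hI (hd j)
  refine JetLE.mono this le_rfl (le_of_eq ?_)
  rw [mul_pow ((n + 1 : ℝ) * 2 ^ R), ← pow_mul]
  ring

theorem JetLE.divGrad (hO : IsOpen O) (hw : w ∈ O) (hψ : ContDiffOn ℝ ∞ ψ O)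
    (h0 : ∀ z ∈ O, gradSq ψ z ≠ 0) (hg : ContDiffOn ℝ ∞ g O) {V A : ℝ}
    (hV : ∀ j, JetLE (R + 1) (gradField ψ j) w V) (hA : JetLE (R + 1) g w A) :
    JetLE R (divGrad ψ g) w (n * 2 ^ (R + 1) * V * A) := by
  have hs : ∀ j : Fin n, ContDiffOn ℝ ∞ (fun z => gradField ψ j z • g z) O := fun j =>
    (contDiffOn_gradField hO hψ h0 j).smul hg
  have h1 : ∀ j : Fin n, JetLE R (fun w => fderiv ℝ (fun z => gradField ψ j z • g z) w (yDir j)) w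
      (2 ^ (R + 1) * V * A) := fun j =>
    (JetLE.smul hO hw (contDiffOn_gradField hO hψ h0 j) hg (hV j) hA).fderiv_apply hO hw (hs j)
      (norm_yDir j).le
  refine JetLE.mono (JetLE.sum (s := Finset.univ) (fun j _ =>
    ((hs j).fderiv_apply_const hO (yDir j)).contDiffAt (hO.mem_nhds hw)) fun j _ => h1 j)
    le_rfl (le_of_eq ?_)
  simp only [Finset.sum_const, Finset.card_univ, Fintype.card_fin, nsmul_eq_mul]
  ring

/-- Each application of `divGrad` costs one derivative of `g`; the total order `T` of derivatives of
the vector field that enter is fixed in advance. -/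
theorem JetLE.divGrad_iterate (hO : IsOpen O) (hw : w ∈ O) (hψ : ContDiffOn ℝ ∞ ψ O)
    (h0 : ∀ z ∈ O, gradSq ψ z ≠ 0) {V : ℝ} (T M : ℕ) :
    ∀ {g : Euc n × Euc n → ℂ} {R : ℕ} {A : ℝ}, R + M ≤ T →
      (∀ j, JetLE T (gradField ψ j) w V) → 0 ≤ V → ContDiffOn ℝ ∞ g O → JetLE (R + M) g w A →
      JetLE R ((ColombeauFIO.divGrad ψ)^[M] g) w ((n * 2 ^ T * V) ^ M * A) := by
  induction M with
  | zero => intro g R A _ _ _ _ hA; simpa using hA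
  | succ M ih =>
    intro g R A hT hV hV0 hg hA
    rw [Function.iterate_succ_apply]
    have h1 : JetLE (R + M) (ColombeauFIO.divGrad ψ g) w (n * 2 ^ (R + M + 1) * V * A) :=
      JetLE.divGrad hO hw hψ h0 hg (fun j => (hV j).mono (by omega) le_rfl) hA
    have hA0 := hA.nonneg
    have h2 : JetLE (R + M) (ColombeauFIO.divGrad ψ g) w (n * 2 ^ T * V * A) := by
      refine h1.mono le_rfl ?_
      have : (2 : ℝ) ^ (R + M + 1) ≤ 2 ^ T := pow_le_pow_right₀ (by norm_num) (by omega)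
      gcongr
    have h3 := ih (by omega) hV hV0 (contDiffOn_divGrad hO hψ h0 hg) h2
    refine h3.mono le_rfl (le_of_eq ?_)
    ring

/-! ### Integration by parts -/

theorem integrableOn_of_eq_zero_off_compact {m : ℕ} {X K : Set (Euc m)} (hX : IsOpen X)
    (hK : IsCompact K) (hKX : K ⊆ X) {F : Type*} [NormedAddCommGroup F] {f : Euc m → F}
    (hf : ContinuousOn f X) (h0 : ∀ y ∈ X, y ∉ K → f y = 0) : IntegrableOn f X :=
  ((hf.mono hKX).integrableOn_compact hK).of_forall_sdiff_eq_zero hX.measurableSet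
    fun y hy => h0 y hy.1 hy.2

theorem setIntegral_fderiv_eq_zero {m : ℕ} {X K : Set (Euc m)} (hX : IsOpen X) (hK : IsCompact K)
    (hKX : K ⊆ X) {f : Euc m → ℂ} (hf : ContDiffOn ℝ ∞ f X) (h0 : ∀ y ∈ X, y ∉ K → f y = 0)
    (e : Euc m) : ∫ y in X, fderiv ℝ f y e = 0 := by
  set F : Euc m → ℂ := X.indicator f with hF
  have hFX : ∀ y ∈ X, F =ᶠ[𝓝 y] f := fun y hy =>
    (Set.eqOn_indicator).eventuallyEq_of_mem (hX.mem_nhds hy)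
  have hF0 : ∀ y, y ∉ K → F y = 0 := fun y hy => by
    by_cases hyX : y ∈ X
    · simp [hF, hyX, h0 y hyX hy]
    · simp [hF, hyX]
  have hFK : ∀ y, y ∉ K → F =ᶠ[𝓝 y] fun _ => 0 := fun y hy => by
    filter_upwards [hK.isClosed.isOpen_compl.mem_nhds hy] with z hz using hF0 z hz
  have hsmooth : ContDiff ℝ 1 F := contDiff_iff_contDiffAt.2 fun y => by
    by_cases hy : y ∈ K
    · exact ((hf.contDiffAt (hX.mem_nhds (hKX hy))).of_le (by simp)).congr_of_eventuallyEq
        (hFX y (hKX hy))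
    · exact contDiffAt_const.congr_of_eventuallyEq (hFK y hy)
  have hsupp : HasCompactSupport F := HasCompactSupport.intro hK hF0
  have h1 : ∫ y in X, fderiv ℝ f y e = ∫ y, fderiv ℝ F y e := by
    have h2 : ∀ y, y ∉ X → fderiv ℝ F y e = 0 := fun y hy => by
      rw [(hFK y fun h => hy (hKX h)).fderiv_eq]
      simp
    rw [← setIntegral_eq_integral_of_forall_compl_eq_zero h2]
    refine setIntegral_congr_fun hX.measurableSet fun y hy => ?_
    rw [(hFX y hy).fderiv_eq]
  rw [h1]
  have hint : Integrable F := hsmooth.continuous.integrable_of_hasCompactSupport hsupp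
  have hint' : Integrable fun y => fderiv ℝ F y e :=
    ((hsmooth.continuous_fderiv (by simp)).clm_apply continuous_const).integrable_of_hasCompactSupport
      (hsupp.fderiv_apply ℝ e)
  have := integral_mul_fderiv_eq_neg_fderiv_mul_of_integrable (μ := volume) (f := fun _ => (1 : ℂ))
    (g := F) (v := e) (by simp) (by simpa using hint') (by simpa using hint)
    (fun _ _ => differentiableAt_const _)
    (fun y _ => hsmooth.differentiable (by simp) y)
  simpa using this

theorem fderiv_comp_prodMk {F : Type*} [NormedAddCommGroup F] [NormedSpace ℝ F]
    {f : Euc n × Euc n → F} {x y : Euc n}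
    (hf : DifferentiableAt ℝ f (x, y)) (e : Euc n) :
    fderiv ℝ (fun z => f (x, z)) y e = fderiv ℝ f (x, y) (0, e) := by
  have h1 : HasFDerivAt (fun z : Euc n => (x, z)) (ContinuousLinearMap.inr ℝ (Euc n) (Euc n)) y :=
    hasFDerivAt_prodMk_right x y
  have := (hf.hasFDerivAt.comp y h1).fderiv
  change fderiv ℝ (f ∘ fun z => (x, z)) y e = _
  rw [this]
  simp

theorem contDiffOn_exp_I (hψ : ContDiffOn ℝ ∞ ψ O) :
    ContDiffOn ℝ ∞ (fun z => Complex.exp (Complex.I * (ψ z : ℂ))) O :=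
  contDiff_cexp_I.comp_contDiffOn hψ

/-- Integration by parts against an oscillating exponential without stationary points. -/
theorem setIntegral_exp_mul_eq {X K : Set (Euc n)} (hX : IsOpen X) (hK : IsCompact K)
    (hKX : K ⊆ X) (hψ : ContDiffOn ℝ ∞ ψ (X ×ˢ X)) (h0 : ∀ z ∈ X ×ˢ X, gradSq ψ z ≠ 0)
    (hg : ContDiffOn ℝ ∞ g (X ×ˢ X)) (hgK : ∀ z ∈ X ×ˢ X, z.2 ∉ K → g z = 0) {x : Euc n}
    (hx : x ∈ X) :
    ∫ y in X, Complex.exp (Complex.I * (ψ (x, y) : ℂ)) * g (x, y) =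
      Complex.I * ∫ y in X, Complex.exp (Complex.I * (ψ (x, y) : ℂ)) * divGrad ψ g (x, y) := by
  have hO : IsOpen (X ×ˢ X) := hX.prod hX
  set E : Euc n × Euc n → ℂ := fun z => Complex.exp (Complex.I * (ψ z : ℂ)) with hE
  have hEs : ContDiffOn ℝ ∞ E (X ×ˢ X) := contDiffOn_exp_I hψ
  have hslice : ∀ {f : Euc n × Euc n → ℂ}, ContDiffOn ℝ ∞ f (X ×ˢ X) →
      ContDiffOn ℝ ∞ (fun y => f (x, y)) X := fun hf =>
    hf.comp (contDiff_const.prodMk contDiff_id).contDiffOn fun y hy => ⟨hx, hy⟩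
  have hgz : ∀ y ∈ X, y ∉ K → g =ᶠ[𝓝 (x, y)] 0 := fun y hy hyK => by
    have : (X ×ˢ X) ∩ (Prod.snd ⁻¹' Kᶜ) ∈ 𝓝 (x, y) :=
      (hO.inter (hK.isClosed.isOpen_compl.preimage continuous_snd)).mem_nhds ⟨⟨hx, hy⟩, hyK⟩
    filter_upwards [this] with z hz using hgK z hz.1 hz.2
  have hint : ∀ {f : Euc n × Euc n → ℂ}, ContDiffOn ℝ ∞ f (X ×ˢ X) →
      (∀ y ∈ X, y ∉ K → f (x, y) = 0) → IntegrableOn (fun y => E (x, y) * f (x, y)) X :=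
    fun hf hf0 => integrableOn_of_eq_zero_off_compact hX hK hKX
      ((hslice (hEs.mul hf)).continuousOn) fun y hy hyK => by rw [hf0 y hy hyK, mul_zero]
  have hP := contDiffOn_divGrad hO hψ h0 hg
  have hPz : ∀ y ∈ X, y ∉ K → divGrad ψ g (x, y) = 0 := fun y hy hyK =>
    (divGrad_eventuallyEq_zero (hgz y hy hyK)).eq_of_nhds
  have hgz' : ∀ y ∈ X, y ∉ K → g (x, y) = 0 := fun y hy hyK => (hgz y hy hyK).eq_of_nhds
  have hvg : ∀ j, ContDiffOn ℝ ∞ (fun z => gradField ψ j z • g z) (X ×ˢ X) := fun j =>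
    (contDiffOn_gradField hO hψ h0 j).smul hg
  -- the divergence of `e^{iψ} g ∇_y ψ / |∇_y ψ|²` has two parts, and its integral vanishes
  have hdiv : ∀ y ∈ X, ∑ j, fderiv ℝ (fun y => E (x, y) * (gradField ψ j (x, y) • g (x, y))) y
      (EuclideanSpace.single j 1) =
        Complex.I * (E (x, y) * g (x, y)) + E (x, y) * divGrad ψ g (x, y) := by
    intro y hy
    have hz : (x, y) ∈ X ×ˢ X := ⟨hx, hy⟩
    have hψd : DifferentiableAt ℝ ψ (x, y) :=
      (hψ.contDiffAt (hO.mem_nhds hz)).differentiableAt (by simp)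
    have hEd : HasFDerivAt E ((Complex.I * E (x, y)) •
        (Complex.ofRealCLM.comp (fderiv ℝ ψ (x, y)))) (x, y) := by
      have h1 : HasFDerivAt (fun z => (ψ z : ℂ)) (Complex.ofRealCLM.comp (fderiv ℝ ψ (x, y)))
        (x, y) := Complex.ofRealCLM.hasFDerivAt.comp (x, y) hψd.hasFDerivAt
      have h2 := (h1.const_mul Complex.I).cexp
      rw [smul_smul, mul_comm] at h2
      exact h2
    have hterm : ∀ j, fderiv ℝ (fun y => E (x, y) * (gradField ψ j (x, y) • g (x, y))) y
        (EuclideanSpace.single j 1) =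
          Complex.I * E (x, y) * g (x, y) *
            ((fderiv ℝ ψ (x, y) (yDir j) * gradField ψ j (x, y) : ℝ) : ℂ) +
          E (x, y) * fderiv ℝ (fun z => gradField ψ j z • g z) (x, y) (yDir j) := fun j => by
      have hd : DifferentiableAt ℝ (fun z => gradField ψ j z • g z) (x, y) :=
        ((hvg j).contDiffAt (hO.mem_nhds hz)).differentiableAt (by simp)
      have hm : HasFDerivAt (fun z => E z * (gradField ψ j z • g z)) _ (x, y) :=
        hEd.mul hd.hasFDerivAt
      have := fderiv_comp_prodMk (f := fun z => E z * (gradField ψ j z • g z))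
        hm.differentiableAt (EuclideanSpace.single j 1)
      rw [this, hm.fderiv]
      simp only [yDir, add_apply, smul_apply,
        ContinuousLinearMap.comp_apply, Complex.ofRealCLM_apply, smul_eq_mul, Complex.real_smul,
        Complex.ofReal_mul]
      ring
    simp only [hterm, Finset.sum_add_distrib, ← Finset.mul_sum, divGrad, ← Complex.ofReal_sum]
    have : ∑ j, fderiv ℝ ψ (x, y) (yDir j) * gradField ψ j (x, y) = 1 := by
      have h2 : ∀ j, fderiv ℝ ψ (x, y) (yDir j) * gradField ψ j (x, y) =
          (gradSq ψ (x, y))⁻¹ * fderiv ℝ ψ (x, y) (yDir j) ^ 2 := fun j => by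
        rw [gradField]; ring
      simp only [h2, ← Finset.mul_sum]
      exact inv_mul_cancel₀ (h0 _ hz)
    rw [this]
    push_cast
    ring
  have hzero : ∫ y in X, ∑ j, fderiv ℝ (fun y => E (x, y) * (gradField ψ j (x, y) • g (x, y))) y
      (EuclideanSpace.single j 1) = 0 := by
    rw [integral_finsetSum]
    · refine Finset.sum_eq_zero fun j _ => setIntegral_fderiv_eq_zero hX hK hKX
        (hslice (hEs.mul (hvg j))) (fun y hy hyK => ?_) _
      simp [hgz' y hy hyK]
    · intro j _
      refine integrableOn_of_eq_zero_off_compact hX hK hKX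
        (((hslice (hEs.mul (hvg j))).fderiv_apply_const hX _).continuousOn) fun y hy hyK => ?_
      have : (fun y => E (x, y) * (gradField ψ j (x, y) • g (x, y))) =ᶠ[𝓝 y] fun _ => 0 := by
        filter_upwards [(hX.inter hK.isClosed.isOpen_compl).mem_nhds ⟨hy, hyK⟩] with z hz
        simp [hgz' z hz.1 hz.2]
      rw [this.fderiv_eq]
      simp
  rw [setIntegral_congr_fun hX.measurableSet hdiv, integral_add
    ((hint hg hgz').const_mul _) (hint hP hPz), integral_const_mul] at hzero
  have := eq_neg_of_add_eq_zero_right hzero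
  change ∫ y in X, E (x, y) * g (x, y) = Complex.I * ∫ y in X, E (x, y) * divGrad ψ g (x, y)
  rw [this, mul_neg, ← mul_assoc, Complex.I_mul_I]
  ring

theorem divGrad_iterate_eq_zero {X K : Set (Euc n)} (hX : IsOpen X) (hK : IsClosed K)
    (hgK : ∀ z ∈ X ×ˢ X, z.2 ∉ K → g z = 0) (M : ℕ) :
    ∀ z ∈ X ×ˢ X, z.2 ∉ K → (divGrad ψ)^[M] g z = 0 := fun z hz hzK => by
  have : g =ᶠ[𝓝 z] 0 := by
    filter_upwards [((hX.prod hX).inter (hK.isOpen_compl.preimage continuous_snd)).mem_nhds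
      ⟨hz, hzK⟩] with z' hz' using hgK z' hz'.1 hz'.2
  exact (divGrad_iterate_eventuallyEq_zero this M).eq_of_nhds

theorem setIntegral_exp_mul_eq_iterate {X K : Set (Euc n)} (hX : IsOpen X) (hK : IsCompact K)
    (hKX : K ⊆ X) (hψ : ContDiffOn ℝ ∞ ψ (X ×ˢ X)) (h0 : ∀ z ∈ X ×ˢ X, gradSq ψ z ≠ 0)
    (hg : ContDiffOn ℝ ∞ g (X ×ˢ X)) (hgK : ∀ z ∈ X ×ˢ X, z.2 ∉ K → g z = 0) {x : Euc n}
    (hx : x ∈ X) (M : ℕ) :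
    ∫ y in X, Complex.exp (Complex.I * (ψ (x, y) : ℂ)) * g (x, y) =
      Complex.I ^ M *
        ∫ y in X, Complex.exp (Complex.I * (ψ (x, y) : ℂ)) * (divGrad ψ)^[M] g (x, y) := by
  induction M with
  | zero => simp
  | succ M ih =>
    rw [ih, setIntegral_exp_mul_eq hX hK hKX hψ h0
      (contDiffOn_divGrad_iterate (hX.prod hX) hψ h0 hg M)
      (divGrad_iterate_eq_zero hX hK.isClosed hgK M) hx, Function.iterate_succ_apply', pow_succ]
    ring

end NonStationary

/-! ### Lower bound for the gradient of a non-degenerate phase -/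

theorem _root_.ContDiffOn.continuousOn_iteratedFDeriv_of_isOpen {E F : Type*}
    [NormedAddCommGroup E] [NormedSpace ℝ E] [NormedAddCommGroup F] [NormedSpace ℝ F] {O : Set E}
    {f : E → F} (hf : ContDiffOn ℝ ∞ f O) (hO : IsOpen O) (k : ℕ) :
    ContinuousOn (iteratedFDeriv ℝ k f) O :=
  (hf.continuousOn_iteratedFDerivWithin (m := k) (by exact_mod_cast le_top)
    hO.uniqueDiffOn).congr fun _ hx => (iteratedFDerivWithin_of_isOpen k hO hx).symm

theorem le_of_mem_closure {α : Type*} [TopologicalSpace α] {S : Set α} {f : α → ℝ} {w : α} {B : ℝ}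
    (hf : ContinuousAt f w) (hw : w ∈ closure S) (h : ∀ z ∈ S, f z ≤ B) : f w ≤ B := by
  have : (𝓝[S] w).NeBot := mem_closure_iff_nhdsWithin_neBot.1 hw
  exact le_of_tendsto (hf.tendsto.mono_left nhdsWithin_le_nhds)
    (eventually_mem_nhdsWithin.mono h)

/-- Cramer's rule bounds `|H θ|` from below by the determinant and the entries of `H`. -/
theorem inv_sum_mulVec_sq_le {n : ℕ} (H : Matrix (Fin n) (Fin n) ℝ) {B : ℝ} (hB : 1 ≤ B)
    (hH : ∀ i j, |H i j| ≤ B) (hdet : H.det ≠ 0) (hD : |H.det|⁻¹ ≤ B) {θ : Fin n → ℝ}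
    (hθ : ∑ i, θ i ^ 2 = 1) :
    (∑ i, (H.mulVec θ) i ^ 2)⁻¹ ≤ n ^ 2 * n.factorial ^ 2 * B ^ (2 * n + 2) := by
  set g := H.mulVec θ with hg
  set N := ∑ i, g i ^ 2 with hN
  have hadj : ∀ i k, |H.adjugate i k| ≤ n.factorial * B ^ n := fun i k => by
    have := Matrix.det_le (A := H.updateRow k (Pi.single i 1)) (abv := AbsoluteValue.abs) (x := B)
      (fun a b => by
        rw [Matrix.updateRow_apply]
        split_ifs
        · by_cases h : b = i
          · subst h; simpa using hB
          · simpa [Pi.single_apply, h] using zero_le_one.trans hB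
        · exact hH a b)
    rw [Matrix.adjugate_apply]
    simpa using this
  have hcr : H.adjugate.mulVec g = H.det • θ := by
    rw [hg, Matrix.mulVec_mulVec, Matrix.adjugate_mul, Matrix.smul_mulVec, Matrix.one_mulVec]
  have hdet2 : H.det ^ 2 ≤ n ^ 2 * (n.factorial * B ^ n) ^ 2 * N := by
    have h1 : H.det ^ 2 = ∑ i, (∑ k, H.adjugate i k * g k) ^ 2 := by
      have h2 : ∀ i, ∑ k, H.adjugate i k * g k = H.det * θ i := fun i => by
        have := congrFun hcr i
        simpa [Matrix.mulVec, dotProduct] using this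
      simp only [h2, mul_pow, ← Finset.mul_sum, hθ, mul_one]
    rw [h1]
    calc _ ≤ ∑ i : Fin n, (∑ k, H.adjugate i k ^ 2) * N :=
          Finset.sum_le_sum fun i _ => Finset.sum_mul_sq_le_sq_mul_sq _ _ _
      _ ≤ ∑ i : Fin n, (∑ k : Fin n, (n.factorial * B ^ n) ^ 2) * N := by
          have hN0 : 0 ≤ N := Finset.sum_nonneg fun _ _ => sq_nonneg _
          refine Finset.sum_le_sum fun i _ => mul_le_mul_of_nonneg_right
            (Finset.sum_le_sum fun k _ => ?_) hN0
          rw [← sq_abs]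
          exact pow_le_pow_left₀ (abs_nonneg _) (hadj i k) 2
      _ = _ := by simp; ring
  have hd0 : 0 < H.det ^ 2 := by positivity
  have hN0 : 0 < N := by
    by_contra hcon
    have : n ^ 2 * (n.factorial * B ^ n) ^ 2 * N ≤ 0 :=
      mul_nonpos_of_nonneg_of_nonpos (by positivity) (not_lt.1 hcon)
    linarith
  have h3 : N⁻¹ ≤ n ^ 2 * (n.factorial * B ^ n) ^ 2 * (|H.det|⁻¹) ^ 2 := by
    rw [inv_pow, sq_abs, inv_le_iff_one_le_mul₀ hN0]
    calc (1 : ℝ) = H.det ^ 2 * (H.det ^ 2)⁻¹ := (mul_inv_cancel₀ hd0.ne').symm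
      _ ≤ (n ^ 2 * (n.factorial * B ^ n) ^ 2 * N) * (H.det ^ 2)⁻¹ := by gcongr
      _ = _ := by ring
  refine h3.trans ?_
  calc _ ≤ n ^ 2 * (n.factorial * B ^ n) ^ 2 * B ^ 2 := by gcongr
    _ = _ := by ring

/-- The phase at a fixed frequency, as a function of `(x, y)`. -/
def phaseSlice {n : ℕ} (φ : Euc n → Euc n → Euc n → ℝ) (ξ : Euc n) (w : Euc n × Euc n) : ℝ :=
  φ w.1 w.2 ξ

section Phase

variable {n : ℕ} {X : Set (Euc n)} {φ : Euc n → Euc n → Euc n → ℝ} {x y ξ : Euc n}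

theorem isOpen_phaseDomain (hX : IsOpen X) : IsOpen (X ×ˢ X ×ˢ ({0}ᶜ : Set (Euc n))) :=
  hX.prod (hX.prod isOpen_compl_singleton)

theorem mem_phaseDomain (hx : x ∈ X) (hy : y ∈ X) (hξ : ξ ≠ 0) :
    (x, y, ξ) ∈ X ×ˢ X ×ˢ ({0}ᶜ : Set (Euc n)) := ⟨hx, hy, hξ⟩

theorem IsPhase.contDiffOn_slice (hφ : IsPhase X φ) (hξ : ξ ≠ 0) :
    ContDiffOn ℝ ∞ (phaseSlice φ ξ) (X ×ˢ X) :=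
  hφ.smooth.comp (f := fun w : Euc n × Euc n => (w.1, w.2, ξ))
    (contDiff_fst.prodMk (contDiff_snd.prodMk contDiff_const)).contDiffOn
    fun _ hw => ⟨hw.1, hw.2, hξ⟩

theorem norm_iteratedFDeriv_slice_le (hX : IsOpen X) (hφ : IsPhase X φ) (hξ : ξ ≠ 0)
    {w : Euc n × Euc n} (hw : w ∈ X ×ˢ X) (k : ℕ) :
    ‖iteratedFDeriv ℝ k (phaseSlice φ ξ) w‖ ≤
      ‖iteratedFDeriv ℝ k (uncurry₃ φ) (w.1, w.2, ξ)‖ := by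
  set L : Euc n × Euc n →L[ℝ] Euc n × Euc n × Euc n :=
    (ContinuousLinearMap.fst ℝ _ _).prod ((ContinuousLinearMap.snd ℝ _ _).prod 0) with hLdef
  have hL : ‖L‖ ≤ 1 := L.opNorm_le_bound zero_le_one fun v => by
    simp [hLdef, Prod.norm_def]
  have h1 : ∀ v : Euc n × Euc n, L v + (0, 0, ξ) = (v.1, v.2, ξ) := fun v => by simp [hLdef]
  have := norm_iteratedFDeriv_comp_affine_le (isOpen_phaseDomain hX) hφ.smooth L hL (0, 0, ξ)
    (x := w) (by rw [h1]; exact ⟨hw.1, hw.2, hξ⟩) k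
  simp only [h1] at this
  exact this

theorem IsPhase.slice_eqOn (hφ : IsPhase X φ) (hξ : ξ ≠ 0) :
    Set.EqOn (phaseSlice φ ξ) (fun w => ‖ξ‖ • phaseSlice φ (‖ξ‖⁻¹ • ξ) w) (X ×ˢ X) := by
  intro w hw
  have h0 : 0 < ‖ξ‖ := norm_pos_iff.2 hξ
  have h1 : ‖ξ‖⁻¹ • ξ ≠ 0 := smul_ne_zero (inv_ne_zero h0.ne') hξ
  have := hφ.homogeneous w.1 hw.1 w.2 hw.2 _ h1 _ h0
  rw [smul_smul, mul_inv_cancel₀ h0.ne', one_smul] at this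
  simpa [phaseSlice] using this

theorem IsPhase.fderiv_frequency (hX : IsOpen X) (hφ : IsPhase X φ) (hx : x ∈ X) (hy : y ∈ X)
    (hξ : ξ ≠ 0) (e : Euc n) :
    fderiv ℝ (fun ξ' => φ x y ξ') ξ e = fderiv ℝ (uncurry₃ φ) (x, y, ξ) (0, 0, e) := by
  have hd : DifferentiableAt ℝ (uncurry₃ φ) (x, y, ξ) :=
    (hφ.smooth.contDiffAt ((isOpen_phaseDomain hX).mem_nhds (mem_phaseDomain hx hy hξ))).differentiableAt
      (by simp)
  have h1 : HasFDerivAt (fun ξ' : Euc n => (x, y, ξ'))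
      ((0 : Euc n →L[ℝ] Euc n).prod ((0 : Euc n →L[ℝ] Euc n).prod (.id ℝ (Euc n)))) ξ :=
    (hasFDerivAt_const x ξ).prodMk ((hasFDerivAt_const y ξ).prodMk (hasFDerivAt_id ξ))
  have := (hd.hasFDerivAt.comp ξ h1).fderiv
  change fderiv ℝ (uncurry₃ φ ∘ fun ξ' => (x, y, ξ')) ξ e = _
  rw [this]
  simp

theorem IsPhase.differentiableAt_fderiv_frequency (hX : IsOpen X) (hφ : IsPhase X φ) (hx : x ∈ X)
    (hy : y ∈ X) (hξ : ξ ≠ 0) (e : Euc n) :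
    HasFDerivAt (fun y' => fderiv ℝ (fun ξ' => φ x y' ξ') ξ e)
      (((fderiv ℝ (fderiv ℝ (uncurry₃ φ)) (x, y, ξ)).flip (0, 0, e)).comp
        ((0 : Euc n →L[ℝ] Euc n).prod ((ContinuousLinearMap.id ℝ (Euc n)).prod 0))) y := by
  have hd : DifferentiableAt ℝ (fderiv ℝ (uncurry₃ φ)) (x, y, ξ) :=
    ((hφ.smooth.fderiv_of_isOpen (isOpen_phaseDomain hX) (m := ∞) (by simp)).contDiffAt
      ((isOpen_phaseDomain hX).mem_nhds (mem_phaseDomain hx hy hξ))).differentiableAt (by simp)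
  have h1 : HasFDerivAt (fun y' : Euc n => (x, y', ξ))
      ((0 : Euc n →L[ℝ] Euc n).prod ((ContinuousLinearMap.id ℝ (Euc n)).prod 0)) y :=
    (hasFDerivAt_const x y).prodMk ((hasFDerivAt_id y).prodMk (hasFDerivAt_const ξ y))
  have h2 := (hd.hasFDerivAt.comp y h1).clm_apply (hasFDerivAt_const (0, 0, e) y)
  have h3 : HasFDerivAt (fun y' => fderiv ℝ (uncurry₃ φ) (x, y', ξ) (0, 0, e))
      (((fderiv ℝ (fderiv ℝ (uncurry₃ φ)) (x, y, ξ)).flip (0, 0, e)).comp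
        ((0 : Euc n →L[ℝ] Euc n).prod ((ContinuousLinearMap.id ℝ (Euc n)).prod 0))) y := by
    refine h2.congr_fderiv ?_
    ext v
    simp
  refine h3.congr_of_eventuallyEq ?_
  filter_upwards [hX.mem_nhds hy] with y' hy' using hφ.fderiv_frequency hX hx hy' hξ e

theorem IsPhase.abs_mixedHessian_le (hX : IsOpen X) (hφ : IsPhase X φ) (hx : x ∈ X) (hy : y ∈ X)
    (hξ : ξ ≠ 0) (j k : Fin n) :
    |mixedHessian φ x y ξ j k| ≤ ‖iteratedFDeriv ℝ 2 (uncurry₃ φ) (x, y, ξ)‖ := by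
  have h1 : mixedHessian φ x y ξ j k = fderiv ℝ (fderiv ℝ (uncurry₃ φ)) (x, y, ξ)
      (0, EuclideanSpace.single j 1, 0) (0, 0, EuclideanSpace.single k 1) := by
    rw [mixedHessian, Matrix.of_apply,
      (hφ.differentiableAt_fderiv_frequency hX hx hy hξ (EuclideanSpace.single k 1)).fderiv]
    simp
  have h2 : ‖iteratedFDeriv ℝ 2 (uncurry₃ φ) (x, y, ξ)‖ =
      ‖fderiv ℝ (fderiv ℝ (uncurry₃ φ)) (x, y, ξ)‖ := by
    rw [← norm_iteratedFDeriv_fderiv, norm_iteratedFDeriv_one]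
  rw [h1, h2, ← Real.norm_eq_abs]
  refine (ContinuousLinearMap.le_opNorm₂ _ _ _).trans (le_of_eq ?_)
  simp [Prod.norm_def]

/-- Euler's relation `Σ_k ξ_k ∂_{ξ_k} φ = φ`. -/
theorem IsPhase.euler (hX : IsOpen X) (hφ : IsPhase X φ) (hx : x ∈ X) (hy : y ∈ X) (hξ : ξ ≠ 0) :
    ∑ k, ξ k * fderiv ℝ (fun ξ' => φ x y ξ') ξ (EuclideanSpace.single k 1) = φ x y ξ := by
  have h1 : fderiv ℝ (fun ξ' => φ x y ξ') ξ ξ =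
      ∑ k, ξ k * fderiv ℝ (fun ξ' => φ x y ξ') ξ (EuclideanSpace.single k 1) := by
    have h2 : ξ = ∑ k, ξ k • EuclideanSpace.single k (1 : ℝ) := by
      simpa using ((EuclideanSpace.basisFun (Fin n) ℝ).sum_repr ξ).symm
    have h3 := congrArg (fderiv ℝ (fun ξ' => φ x y ξ') ξ) h2
    rw [h3, map_sum]
    simp
  rw [← h1]
  have hd : DifferentiableAt ℝ (fun ξ' => φ x y ξ') ξ := by
    have h : ContDiffAt ℝ ∞ (uncurry₃ φ) (x, y, ξ) :=
      hφ.smooth.contDiffAt ((isOpen_phaseDomain hX).mem_nhds (mem_phaseDomain hx hy hξ))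
    have h' : ContDiffAt ℝ ∞ (fun ξ' : Euc n => (x, y, ξ')) ξ :=
      contDiffAt_const.prodMk (contDiffAt_const.prodMk contDiffAt_id)
    exact (h.comp ξ h').differentiableAt (by simp)
  have hl : HasDerivAt (fun t : ℝ => t • ξ) ξ 1 := by
    simpa using (hasDerivAt_id (1 : ℝ)).smul_const ξ
  have hc : HasDerivAt (fun t : ℝ => φ x y (t • ξ)) (fderiv ℝ (fun ξ' => φ x y ξ') ξ ξ) 1 := by
    have hd' : HasFDerivAt (fun ξ' => φ x y ξ') (fderiv ℝ (fun ξ' => φ x y ξ') ξ)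
        ((fun t : ℝ => t • ξ) 1) := by simpa using hd.hasFDerivAt
    exact hd'.comp_hasDerivAt (1 : ℝ) hl
  have hc' : HasDerivAt (fun t : ℝ => φ x y (t • ξ)) (φ x y ξ) 1 := by
    have : HasDerivAt (fun t : ℝ => t * φ x y ξ) (φ x y ξ) 1 := by
      simpa using (hasDerivAt_id (1 : ℝ)).mul_const (φ x y ξ)
    refine this.congr_of_eventuallyEq ?_
    filter_upwards [lt_mem_nhds (zero_lt_one' ℝ)] with t ht using hφ.homogeneous x hx y hy ξ hξ t ht
  exact hc.unique hc'

/-- Differentiating Euler's relation in `y` gives `∇_y φ = (∂_y ∂_ξ φ) ξ`. -/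
theorem IsPhase.mixedHessian_mulVec (hX : IsOpen X) (hφ : IsPhase X φ) (hx : x ∈ X) (hy : y ∈ X)
    (hξ : ξ ≠ 0) (j : Fin n) :
    ((mixedHessian φ x y ξ).mulVec ξ) j = fderiv ℝ (phaseSlice φ ξ) (x, y) (yDir j) := by
  have hO : IsOpen (X ×ˢ X) := hX.prod hX
  have h1 := fderiv_comp_prodMk (((hφ.contDiffOn_slice hξ).contDiffAt
    (hO.mem_nhds (show (x, y) ∈ X ×ˢ X from ⟨hx, hy⟩))).differentiableAt (by simp))
    (EuclideanSpace.single j 1)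
  rw [yDir, ← h1]
  have h2 : (fun z => phaseSlice φ ξ (x, z)) =ᶠ[𝓝 y] fun y' =>
      ∑ k, ξ k * fderiv ℝ (fun ξ' => φ x y' ξ') ξ (EuclideanSpace.single k 1) := by
    filter_upwards [hX.mem_nhds hy] with y' hy' using (hφ.euler hX hx hy' hξ).symm
  have h3 : ∀ k : Fin n, DifferentiableAt ℝ
      (fun y' => fderiv ℝ (fun ξ' => φ x y' ξ') ξ (EuclideanSpace.single k 1)) y := fun k =>
    (hφ.differentiableAt_fderiv_frequency hX hx hy hξ _).differentiableAt
  rw [h2.fderiv_eq, fderiv_fun_sum fun k _ => (h3 k).const_mul (ξ k)]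
  simp only [fderiv_const_mul (h3 _), Matrix.mulVec, dotProduct, mixedHessian, Matrix.of_apply,
    sum_apply, smul_apply, smul_eq_mul]
  exact Finset.sum_congr rfl fun k _ => mul_comm _ _

theorem IsPhase.gradSq_slice (hX : IsOpen X) (hφ : IsPhase X φ) (hx : x ∈ X) (hy : y ∈ X)
    (hξ : ξ ≠ 0) :
    gradSq (phaseSlice φ ξ) (x, y) = ∑ j, ((mixedHessian φ x y ξ).mulVec ξ) j ^ 2 := by
  simp only [gradSq, hφ.mixedHessian_mulVec hX hx hy hξ]

theorem IsPhase.gradSq_ne_zero (hX : IsOpen X) (hφ : IsPhase X φ) (hξ : ξ ≠ 0) :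
    ∀ z ∈ X ×ˢ X, gradSq (phaseSlice φ ξ) z ≠ 0 := by
  rintro ⟨x, y⟩ ⟨hx, hy⟩ h
  rw [hφ.gradSq_slice hX hx hy hξ, Finset.sum_eq_zero_iff_of_nonneg fun _ _ => sq_nonneg _] at h
  have h1 : (mixedHessian φ x y ξ).mulVec ξ = 0 := by
    funext j
    simpa using h j (Finset.mem_univ j)
  have := Matrix.eq_zero_of_mulVec_eq_zero (hφ.nondegenerate x hx y hy ξ hξ) h1
  exact hξ (by ext j; exact congrFun this j)

/-- Over the set `S`, at unit frequencies, the phase has its derivatives in `(x, y)` of order at most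
`R` bounded by `B`, and `|∇_y φ|²` is at least `B⁻¹`. -/
def PhaseBound {n : ℕ} (S : Set (Euc n × Euc n)) (φ : Euc n → Euc n → Euc n → ℝ) (R : ℕ) (B : ℝ) :
    Prop :=
  1 ≤ B ∧ ∀ w ∈ S, ∀ θ : Euc n, ‖θ‖ = 1 →
    JetLE R (phaseSlice φ θ) w B ∧ (gradSq (phaseSlice φ θ) w)⁻¹ ≤ B

/-- The lower bound for `|∇_y φ|` follows from the bounds for the second derivatives and for the
mixed Hessian. All bounds extend to the closure of `S` in `X × X` by continuity, and there the
amplitude and its derivatives are supported. -/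
theorem exists_phaseBound (n R : ℕ) : ∃ C : ℝ, ∃ Q : ℕ, 1 ≤ C ∧
    ∀ {X : Set (Euc n)} {φ : Euc n → Euc n → Euc n → ℝ} {S : Set (Euc n × Euc n)} {b : ℝ},
      IsOpen X → IsPhase X φ → S ⊆ X ×ˢ X → 1 ≤ b →
      (∀ k ≤ R + 2, ∀ z ∈ overSphere S, ‖iteratedFDeriv ℝ k (uncurry₃ φ) z‖ ≤ b) →
      (∀ z ∈ overSphere S, |(uncurry₃ (mixedHessian φ) z).det|⁻¹ ≤ b) →
      PhaseBound (closure S ∩ X ×ˢ X) φ R (C * b ^ Q) := by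
  refine ⟨n ^ 2 * n.factorial ^ 2 + 1, 2 * n + 2, by simp; positivity, ?_⟩
  intro X φ S b hX hφ hS hb hJ hD
  have hO : IsOpen (X ×ˢ X) := hX.prod hX
  set c : ℝ := n ^ 2 * n.factorial ^ 2 with hc
  have hc0 : 0 ≤ c := by positivity
  have hbp : 1 ≤ b ^ (2 * n + 2) := one_le_pow₀ hb
  have hB1 : b ≤ (c + 1) * b ^ (2 * n + 2) := by
    have : b ≤ b ^ (2 * n + 2) := le_self_pow₀ hb (by omega)
    nlinarith
  refine ⟨hb.trans hB1, ?_⟩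
  rintro w ⟨hwS, hwO⟩ θ hθ
  have hθ0 : θ ≠ 0 := fun h => by simp [h] at hθ
  have hs := hφ.contDiffOn_slice hθ0
  constructor
  · intro k hk
    refine le_of_mem_closure (f := fun z => ‖iteratedFDeriv ℝ k (phaseSlice φ θ) z‖)
      ((hs.continuousOn_iteratedFDeriv_of_isOpen hO k).continuousAt (hO.mem_nhds hwO)).norm hwS
      fun z hz => ?_
    exact (norm_iteratedFDeriv_slice_le hX hφ hθ0 (hS hz) k).trans
      ((hJ k (by omega) (z.1, z.2, θ) ⟨hz, hθ⟩).trans hB1)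
  · have hc : ContinuousAt (gradSq (phaseSlice φ θ)) w :=
      (contDiffOn_gradSq hO hs).continuousOn.continuousAt (hO.mem_nhds hwO)
    have hc' : ContinuousAt (fun z => (gradSq (phaseSlice φ θ) z)⁻¹) w :=
      hc.inv₀ (hφ.gradSq_ne_zero hX hθ0 w hwO)
    refine le_of_mem_closure (f := fun z => (gradSq (phaseSlice φ θ) z)⁻¹) hc' hwS fun z hz => ?_
    obtain ⟨x, y⟩ := z
    have hx := (hS hz).1
    have hy := (hS hz).2
    rw [hφ.gradSq_slice hX hx hy hθ0]
    refine (inv_sum_mulVec_sq_le _ hb (fun i j => ?_) (hφ.nondegenerate x hx y hy θ hθ0)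
      (hD (x, y, θ) ⟨hz, hθ⟩) ?_).trans ?_
    · exact (hφ.abs_mixedHessian_le hX hx hy hθ0 i j).trans (hJ 2 (by omega) (x, y, θ) ⟨hz, hθ⟩)
    · have := EuclideanSpace.real_norm_sq_eq θ
      rw [← this, hθ, one_pow]
    · nlinarith

end Phase

/-! ### Smooth dependence of integrals on parameters -/

/-- Differentiation under the integral sign, to order `N`: if the derivatives of `f · ζ` up to order
`N + 1` are dominated on the open set `X` by an integrable function, then the integral is of class
`C^N` on `X`, and is differentiated under the integral sign. -/
theorem contDiffOn_integral_of_dominated {E F α : Type*} [NormedAddCommGroup E] [NormedSpace ℝ E]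
    [FiniteDimensional ℝ E] [NormedAddCommGroup F] [NormedSpace ℝ F] [CompleteSpace F]
    [MeasurableSpace α] {μ : Measure α}
    {X : Set E} (hX : IsOpen X) {f : E → α → F} (N : ℕ) {bound : α → ℝ}
    (hf : ∀ᵐ ζ ∂μ, ContDiffOn ℝ ∞ (fun x => f x ζ) X)
    (hmeas : ∀ k ≤ N + 1, ∀ x ∈ X,
      AEStronglyMeasurable (fun ζ => iteratedFDeriv ℝ k (fun x => f x ζ) x) μ)
    (hbound : ∀ᵐ ζ ∂μ, ∀ k ≤ N + 1, ∀ x ∈ X, ‖iteratedFDeriv ℝ k (fun x => f x ζ) x‖ ≤ bound ζ)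
    (hint : Integrable bound μ) :
    ContDiffOn ℝ N (fun x => ∫ ζ, f x ζ ∂μ) X ∧ ∀ k ≤ N, ∀ x ∈ X,
      iteratedFDeriv ℝ k (fun x => ∫ ζ, f x ζ ∂μ) x =
        ∫ ζ, iteratedFDeriv ℝ k (fun x => f x ζ) x ∂μ := by
  set p : E → FormalMultilinearSeries ℝ E F := fun x k =>
    ∫ ζ, iteratedFDeriv ℝ k (fun x => f x ζ) x ∂μ with hp
  have hI : ∀ k ≤ N + 1, ∀ x ∈ X,
      Integrable (fun ζ => iteratedFDeriv ℝ k (fun x => f x ζ) x) μ := fun k hk x hx =>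
    hint.mono' (hmeas k hk x hx) (hbound.mono fun ζ h => h k hk x hx)
  have hder : ∀ k ≤ N, ∀ x ∈ X, HasFDerivAt (fun x => p x k) (p x (k + 1)).curryLeft x := by
    intro k hk x hx
    set L := (continuousMultilinearCurryLeftEquiv ℝ (fun _ : Fin (k + 1) => E) F)
    have h1 : (p x (k + 1)).curryLeft =
        ∫ ζ, (iteratedFDeriv ℝ (k + 1) (fun x => f x ζ) x).curryLeft ∂μ := by
      let Lc : (E [×(k + 1)]→L[ℝ] F) →L[ℝ] (E →L[ℝ] (E [×k]→L[ℝ] F)) :=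
        L.toContinuousLinearEquiv.toContinuousLinearMap
      exact (ContinuousLinearMap.integral_comp_comm (𝕜 := ℝ) (E := E [×(k + 1)]→L[ℝ] F)
        (Fₗ := E →L[ℝ] (E [×k]→L[ℝ] F)) Lc (hI (k + 1) (by omega) x hx)).symm
    rw [h1]
    refine hasFDerivAt_integral_of_dominated_of_fderiv_le
      (F' := fun x ζ => (iteratedFDeriv ℝ (k + 1) (fun x => f x ζ) x).curryLeft)
      (bound := bound) (hX.mem_nhds hx) ?_ (hI k (by omega) x hx) ?_ ?_ hint ?_
    · filter_upwards [hX.mem_nhds hx] with z hz using hmeas k (by omega) z hz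
    · exact L.continuous.comp_aestronglyMeasurable (hmeas (k + 1) (by omega) x hx)
    · filter_upwards [hbound] with ζ hζ z hz
      rw [ContinuousMultilinearMap.curryLeft_norm]
      exact hζ (k + 1) (by omega) z hz
    · filter_upwards [hf] with ζ hζ z hz
      have h2 : DifferentiableAt ℝ (iteratedFDeriv ℝ k (fun x => f x ζ)) z :=
        (hζ.contDiffAt (hX.mem_nhds hz)).differentiableAt_iteratedFDeriv
          (by exact_mod_cast WithTop.coe_lt_coe.2 (ENat.natCast_lt_top k))
      have h3 := h2.hasFDerivAt
      have h4 : (iteratedFDeriv ℝ (k + 1) (fun x => f x ζ) z).curryLeft =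
          fderiv ℝ (iteratedFDeriv ℝ k (fun x => f x ζ)) z := by
        ext v m
        simp [ContinuousMultilinearMap.curryLeft_apply, iteratedFDeriv_succ_apply_left]
      rw [h4]
      exact h3
  have hT : HasFTaylorSeriesUpToOn (N : ℕ∞) (fun x => ∫ ζ, f x ζ ∂μ) p X := by
    refine ⟨fun x hx => ?_, fun m hm x hx => ?_, fun m hm x hx => ?_⟩
    · exact (ContinuousLinearEquiv.integral_comp_comm
        (continuousMultilinearCurryFin0 ℝ E F).toContinuousLinearEquiv
        fun ζ => iteratedFDeriv ℝ 0 (fun x => f x ζ) x).symm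
    · exact (hder m (by exact_mod_cast hm.le) x hx).hasFDerivWithinAt
    · exact (hder m (by exact_mod_cast hm) x hx).continuousAt.continuousWithinAt
  refine ⟨by exact_mod_cast hT.contDiffOn, fun k hk x hx => ?_⟩
  rw [← iteratedFDerivWithin_of_isOpen k hX hx]
  exact (hT.eq_iteratedFDerivWithin_of_uniqueDiffOn (by exact_mod_cast hk) hX.uniqueDiffOn hx).symm

/-- The partial derivatives of a smooth function of two variables are jointly continuous. -/
theorem continuousOn_iteratedFDeriv_left {E G F : Type*} [NormedAddCommGroup E] [NormedSpace ℝ E]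
    [NormedAddCommGroup G] [NormedSpace ℝ G] [NormedAddCommGroup F] [NormedSpace ℝ F]
    {O : Set (E × G)} (hO : IsOpen O) {f : E × G → F} (hf : ContDiffOn ℝ ∞ f O) (k : ℕ) :
    ContinuousOn (fun z : E × G => iteratedFDeriv ℝ k (fun x => f (x, z.2)) z.1) O := by
  have h1 : ∀ z ∈ O, iteratedFDeriv ℝ k (fun x => f (x, z.2)) z.1 =
      (iteratedFDeriv ℝ k f z).compContinuousLinearMap
        fun _ => ContinuousLinearMap.inl ℝ E G := fun z hz => by
    have := iteratedFDeriv_comp_affine hO hf (ContinuousLinearMap.inl ℝ E G) (0, z.2)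
      (x := z.1) (by simpa using hz) k
    simpa using this
  refine ContinuousOn.congr ?_ h1
  exact (ContinuousMultilinearMap.compContinuousLinearMapL
    (F := F) fun _ : Fin k => ContinuousLinearMap.inl ℝ E G).continuous.comp_continuousOn
      (hf.continuousOn_iteratedFDeriv_of_isOpen hO k)

/-! ### Jets of the integrand after integration by parts -/

/-- The amplitude at a fixed frequency, as a function of `(x, y)`. -/
def ampSlice {n : ℕ} (a : Euc n → Euc n → Euc n → ℂ) (ξ : Euc n) (w : Euc n × Euc n) : ℂ :=
  a w.1 w.2 ξ

/-- The derivatives of the amplitude in `(x, y)` of order at most `R` are bounded by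
`A (1 + |ξ|)^m`. -/
def AmpBound {n : ℕ} (X : Set (Euc n)) (a : Euc n → Euc n → Euc n → ℂ) (m R : ℕ) (A : ℝ) : Prop :=
  0 ≤ A ∧ ∀ w ∈ X ×ˢ X, ∀ ξ, JetLE R (ampSlice a ξ) w (A * (1 + ‖ξ‖) ^ m)

/-- The sum of the norms of the derivatives of `u` of order at most `R` at a point. -/
noncomputable def jetSum {n : ℕ} (R : ℕ) (u : Euc n → ℂ) (y : Euc n) : ℝ :=
  ∑ j ∈ Finset.range (R + 1), ‖iteratedFDeriv ℝ j u y‖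

/-- The product `a(x, y, ξ) u(y)` as a function of `(x, y)`. -/
noncomputable def ampMul {n : ℕ} (a : Euc n → Euc n → Euc n → ℂ) (u : Euc n → ℂ) (ξ : Euc n)
    (w : Euc n × Euc n) : ℂ := ampSlice a ξ w * u w.2

/-- The integrand `e^{iφ} a u` after `M` integrations by parts, up to the factor `i^M`. -/
noncomputable def oscIntegrand {n : ℕ} (φ : Euc n → Euc n → Euc n → ℝ)
    (a : Euc n → Euc n → Euc n → ℂ) (u : Euc n → ℂ) (M : ℕ) (ξ : Euc n) (w : Euc n × Euc n) : ℂ :=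
  Complex.exp (Complex.I * (phaseSlice φ ξ w : ℂ)) *
    (divGrad (phaseSlice φ ξ))^[M] (ampMul a u ξ) w

/-- The integrand of the operator, integrated by parts `M` times at the frequencies `|ξ| > 1`. -/
noncomputable def fioKernel {n : ℕ} (φ : Euc n → Euc n → Euc n → ℝ)
    (a : Euc n → Euc n → Euc n → ℂ) (u : Euc n → ℂ) (M : ℕ) (ξ : Euc n) (w : Euc n × Euc n) : ℂ :=
  if ‖ξ‖ ≤ 1 then oscIntegrand φ a u 0 ξ w else Complex.I ^ M * oscIntegrand φ a u M ξ w

theorem jetSum_nonneg {n : ℕ} (R : ℕ) (u : Euc n → ℂ) (y : Euc n) : 0 ≤ jetSum R u y :=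
  Finset.sum_nonneg fun _ _ => norm_nonneg _

theorem jetSum_mono {n : ℕ} {R R' : ℕ} (h : R ≤ R') (u : Euc n → ℂ) (y : Euc n) :
    jetSum R u y ≤ jetSum R' u y :=
  Finset.sum_le_sum_of_subset_of_nonneg (Finset.range_mono (by omega)) fun _ _ _ => norm_nonneg _

section Kernel

variable {n : ℕ} {X K : Set (Euc n)} {S : Set (Euc n × Euc n)}
  {φ : Euc n → Euc n → Euc n → ℝ} {a : Euc n → Euc n → Euc n → ℂ} {u : Euc n → ℂ} {ξ : Euc n}
  {w : Euc n × Euc n} {R M m q k : ℕ} {A B : ℝ}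

theorem contDiffOn_ampSlice (ha : ContDiffOn ℝ ∞ (uncurry₃ a) (X ×ˢ X ×ˢ Set.univ)) (ξ : Euc n) :
    ContDiffOn ℝ ∞ (ampSlice a ξ) (X ×ˢ X) :=
  ha.comp (f := fun w : Euc n × Euc n => (w.1, w.2, ξ))
    (contDiff_fst.prodMk (contDiff_snd.prodMk contDiff_const)).contDiffOn
    fun _ hw => ⟨hw.1, hw.2, trivial⟩

theorem contDiffOn_comp_snd (hu : ContDiffOn ℝ ∞ u X) :
    ContDiffOn ℝ ∞ (fun w : Euc n × Euc n => u w.2) (X ×ˢ X) :=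
  hu.comp contDiff_snd.contDiffOn fun _ hw => hw.2

theorem contDiffOn_ampMul (ha : ContDiffOn ℝ ∞ (uncurry₃ a) (X ×ˢ X ×ˢ Set.univ))
    (hu : ContDiffOn ℝ ∞ u X) (ξ : Euc n) : ContDiffOn ℝ ∞ (ampMul a u ξ) (X ×ˢ X) :=
  (contDiffOn_ampSlice ha ξ).mul (contDiffOn_comp_snd hu)

theorem jetLE_comp_snd (hX : IsOpen X) (hu : ContDiffOn ℝ ∞ u X) (hw : w ∈ X ×ˢ X) :
    JetLE R (fun w : Euc n × Euc n => u w.2) w (jetSum R u w.2) := fun k hk => by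
  have := norm_iteratedFDeriv_comp_affine_le hX hu (ContinuousLinearMap.snd ℝ (Euc n) (Euc n))
    (ContinuousLinearMap.norm_snd_le ..) 0 (x := w) (by simpa using hw.2) k
  simp only [ContinuousLinearMap.coe_snd', add_zero] at this
  refine this.trans ?_
  exact Finset.single_le_sum (f := fun j => ‖iteratedFDeriv ℝ j u w.2‖) (fun _ _ => norm_nonneg _)
    (Finset.mem_range.2 (by omega))

theorem ampMul_eventuallyEq_zero (hX : IsOpen X)
    (hsupp : ∀ x ∈ X, ∀ y ∈ X, (x, y) ∉ S → ∀ ξ, a x y ξ = 0) (hw : w ∈ X ×ˢ X)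
    (hwS : w ∉ closure S) : ampMul a u ξ =ᶠ[𝓝 w] 0 := by
  filter_upwards [((hX.prod hX).inter isClosed_closure.isOpen_compl).mem_nhds ⟨hw, hwS⟩] with z hz
  have := hsupp z.1 hz.1.1 z.2 hz.1.2 (fun h => hz.2 (subset_closure h)) ξ
  simp [ampMul, ampSlice, this]

theorem jetLE_ampMul (hX : IsOpen X) (ha : ContDiffOn ℝ ∞ (uncurry₃ a) (X ×ˢ X ×ˢ Set.univ))
    (hu : ContDiffOn ℝ ∞ u X) (hA : AmpBound X a m R A) (hw : w ∈ X ×ˢ X) :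
    JetLE R (ampMul a u ξ) w (2 ^ R * (A * (1 + ‖ξ‖) ^ m) * jetSum R u w.2) :=
  JetLE.smul (f := ampSlice a ξ) (g := fun w : Euc n × Euc n => u w.2) (hX.prod hX) hw
    (contDiffOn_ampSlice ha ξ) (contDiffOn_comp_snd hu) (hA.2 w hw ξ) (jetLE_comp_snd hX hu hw)

theorem contDiffOn_oscIntegrand (hX : IsOpen X) (hφ : IsPhase X φ)
    (ha : ContDiffOn ℝ ∞ (uncurry₃ a) (X ×ˢ X ×ˢ Set.univ)) (hu : ContDiffOn ℝ ∞ u X)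
    (hξ : ξ ≠ 0) (M : ℕ) : ContDiffOn ℝ ∞ (oscIntegrand φ a u M ξ) (X ×ˢ X) :=
  (contDiffOn_exp_I (hφ.contDiffOn_slice hξ)).mul
    (contDiffOn_divGrad_iterate (hX.prod hX) (hφ.contDiffOn_slice hξ) (hφ.gradSq_ne_zero hX hξ)
      (contDiffOn_ampMul ha hu ξ) M)

/-- Every integration by parts gains a factor `|ξ|⁻¹`, and every derivative loses a factor
`1 + |ξ|`; the constants are polynomial in the bounds for the phase and linear in the bounds for the
amplitude. -/
theorem exists_jetLE_oscIntegrand (n k M : ℕ) : ∃ C : ℝ, ∃ Q : ℕ, 0 ≤ C ∧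
    ∀ {X : Set (Euc n)} {S : Set (Euc n × Euc n)} {φ : Euc n → Euc n → Euc n → ℝ}
      {a : Euc n → Euc n → Euc n → ℂ} {u : Euc n → ℂ} {m : ℕ} {A B : ℝ},
      IsOpen X → IsPhase X φ → PhaseBound (closure S ∩ X ×ˢ X) φ (k + M + 1) B →
      ContDiffOn ℝ ∞ (uncurry₃ a) (X ×ˢ X ×ˢ Set.univ) →
      (∀ x ∈ X, ∀ y ∈ X, (x, y) ∉ S → ∀ ξ, a x y ξ = 0) → AmpBound X a m (k + M) A →
      ContDiffOn ℝ ∞ u X → ∀ w ∈ X ×ˢ X, ∀ ξ ≠ 0,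
      JetLE k (oscIntegrand φ a u M ξ) w
        (C * B ^ Q * A * jetSum (k + M) u w.2 * (‖ξ‖⁻¹ ^ M * (1 + ‖ξ‖) ^ (k + m))) := by
  obtain ⟨C₁, Q₁, hC₁, hV⟩ := exists_jetLE_gradField n (k + M)
  refine ⟨2 ^ k * k.factorial * (n * 2 ^ (k + M) * C₁) ^ M * 2 ^ (k + M), k + Q₁ * M,
    by positivity, ?_⟩
  intro X S φ a u m A B hX hφ hPB ha hsupp hA hu w hw ξ hξ
  have hO : IsOpen (X ×ˢ X) := hX.prod hX
  have hA0 := hA.1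
  have hB := hPB.1
  have hU := jetSum_nonneg (k + M) u w.2
  have hl : 0 < ‖ξ‖ := norm_pos_iff.2 hξ
  by_cases hwS : w ∈ closure S
  swap
  · refine JetLE.of_eventuallyEq_zero (by positivity) ?_
    filter_upwards [divGrad_iterate_eventuallyEq_zero (ψ := phaseSlice φ ξ)
      (ampMul_eventuallyEq_zero (u := u) (ξ := ξ) hX hsupp hw hwS) M] with z hz
    simp [oscIntegrand, hz]
  set θ : Euc n := ‖ξ‖⁻¹ • ξ with hθ
  have hθ1 : ‖θ‖ = 1 := by
    rw [hθ, norm_smul, norm_inv, norm_norm, inv_mul_cancel₀ hl.ne']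
  have hθ0 : θ ≠ 0 := fun h => by simp [h] at hθ1
  obtain ⟨hJ, hD⟩ := hPB.2 w ⟨hwS, hw⟩ θ hθ1
  have hsθ := hφ.contDiffOn_slice hθ0
  have hsξ := hφ.contDiffOn_slice hξ
  have hEq := hφ.slice_eqOn hξ
  -- the vector field is homogeneous of degree `-1` in the frequency
  have hgf : ∀ j, JetLE (k + M) (gradField (phaseSlice φ ξ) j) w (‖ξ‖⁻¹ * (C₁ * B ^ Q₁)) := by
    intro j
    have h1 := hV hO hw hsθ (hφ.gradSq_ne_zero hX hθ0) hB hJ hD j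
    have h2 := h1.const_smul (‖ξ‖⁻¹)
      ((contDiffOn_gradField hO hsθ (hφ.gradSq_ne_zero hX hθ0) j).contDiffAt (hO.mem_nhds hw))
    rw [norm_inv, norm_norm] at h2
    exact h2.congr ((gradField_eqOn_of_eqOn_smul hO (hsθ.differentiableOn (by simp)) hEq
      j).eventuallyEq_of_mem (hO.mem_nhds hw))
  have hg := jetLE_ampMul (ξ := ξ) hX ha hu hA hw
  have hit := JetLE.divGrad_iterate hO hw hsξ (hφ.gradSq_ne_zero hX hξ) (k + M) M le_rfl hgf
    (by positivity) (contDiffOn_ampMul ha hu ξ) hg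
  have hψ : JetLE k (phaseSlice φ ξ) w ((1 + ‖ξ‖) * B) := by
    have h1 := (hJ.const_smul ‖ξ‖ (hsθ.contDiffAt (hO.mem_nhds hw))).congr
      (hEq.eventuallyEq_of_mem (hO.mem_nhds hw))
    rw [norm_norm] at h1
    refine h1.mono (by omega) ?_
    have : 0 ≤ B := by linarith
    nlinarith
  have he := JetLE.cexp hO hw hsξ (one_le_mul_of_one_le_of_one_le (by linarith) hB) hψ
  have := JetLE.smul hO hw (contDiffOn_exp_I hsξ) (contDiffOn_divGrad_iterate hO hsξ
    (hφ.gradSq_ne_zero hX hξ) (contDiffOn_ampMul ha hu ξ) M) he hit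
  refine JetLE.mono this le_rfl (le_of_eq ?_)
  rw [mul_pow, mul_pow _ (_ * _) M, mul_pow (‖ξ‖⁻¹) _ M, mul_pow C₁, mul_pow (_ * _) C₁,
    ← pow_mul B Q₁ M, pow_add B, pow_add (1 + ‖ξ‖)]
  ring

theorem inv_pow_mul_one_add_pow_le {l : ℝ} (hl : 1 < l) (k m q : ℕ) :
    l⁻¹ ^ (k + m + q) * (1 + l) ^ (k + m) ≤ 2 ^ (k + m + q) * ((1 + l) ^ q)⁻¹ := by
  have h1 : l⁻¹ ≤ 2 * (1 + l)⁻¹ := by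
    rw [← div_eq_mul_inv, inv_eq_one_div, div_le_div_iff₀ (by linarith) (by linarith)]
    linarith
  have h0 : 0 < l⁻¹ := inv_pos.2 (by linarith)
  calc l⁻¹ ^ (k + m + q) * (1 + l) ^ (k + m)
      ≤ (2 * (1 + l)⁻¹) ^ (k + m + q) * (1 + l) ^ (k + m) := by gcongr
    _ = 2 ^ (k + m + q) * ((1 + l) ^ q)⁻¹ * ((1 + l)⁻¹ ^ (k + m) * (1 + l) ^ (k + m)) := by
        rw [mul_pow, pow_add (1 + l)⁻¹, inv_pow _ q]; ring
    _ = _ := by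
        rw [← mul_pow, inv_mul_cancel₀ (by linarith), one_pow, mul_one]

theorem one_add_pow_le {l : ℝ} (h0 : 0 ≤ l) (hl : l ≤ 1) (r q : ℕ) :
    (1 + l) ^ r ≤ 2 ^ (r + q) * ((1 + l) ^ q)⁻¹ := by
  rw [← div_eq_mul_inv, le_div_iff₀ (by positivity), ← pow_add]
  exact pow_le_pow_left₀ (by linarith) (by linarith) _

theorem contDiffOn_fioKernel (hX : IsOpen X) (hφ : IsPhase X φ)
    (ha : ContDiffOn ℝ ∞ (uncurry₃ a) (X ×ˢ X ×ˢ Set.univ)) (hu : ContDiffOn ℝ ∞ u X)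
    (hξ : ξ ≠ 0) (M : ℕ) : ContDiffOn ℝ ∞ (fioKernel φ a u M ξ) (X ×ˢ X) := by
  by_cases h : ‖ξ‖ ≤ 1
  · exact (contDiffOn_oscIntegrand hX hφ ha hu hξ 0).congr fun w _ => by simp [fioKernel, h]
  · exact ((contDiffOn_const (c := Complex.I ^ M)).mul (contDiffOn_oscIntegrand hX hφ ha hu hξ M)).congr
      fun w _ => by simp [fioKernel, h]

/-- With `k + m + q` integrations by parts, the derivatives of the kernel of order at most `k` decay
like `(1 + |ξ|)^{-q}`: `k` of them pay for the derivatives that fall on the exponential, and `m` for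
the order of the amplitude. -/
theorem exists_jetLE_fioKernel (n k m q : ℕ) : ∃ C : ℝ, ∃ Q : ℕ, 0 ≤ C ∧
    ∀ {X : Set (Euc n)} {S : Set (Euc n × Euc n)} {φ : Euc n → Euc n → Euc n → ℝ}
      {a : Euc n → Euc n → Euc n → ℂ} {u : Euc n → ℂ} {A B : ℝ},
      IsOpen X → IsPhase X φ → PhaseBound (closure S ∩ X ×ˢ X) φ (k + (k + m + q) + 1) B →
      ContDiffOn ℝ ∞ (uncurry₃ a) (X ×ˢ X ×ˢ Set.univ) →
      (∀ x ∈ X, ∀ y ∈ X, (x, y) ∉ S → ∀ ξ, a x y ξ = 0) → AmpBound X a m (k + (k + m + q)) A →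
      ContDiffOn ℝ ∞ u X → ∀ w ∈ X ×ˢ X, ∀ ξ ≠ 0,
      JetLE k (fioKernel φ a u (k + m + q) ξ) w
        (C * B ^ Q * A * (((1 + ‖ξ‖) ^ q)⁻¹ * jetSum (k + (k + m + q)) u w.2)) := by
  obtain ⟨C₀, Q₀, hC₀, h₀⟩ := exists_jetLE_oscIntegrand n k 0
  obtain ⟨C₁, Q₁, hC₁, h₁⟩ := exists_jetLE_oscIntegrand n k (k + m + q)
  refine ⟨(C₀ + C₁) * 2 ^ (k + m + q), Q₀ + Q₁, by positivity, ?_⟩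
  intro X S φ a u A B hX hφ hPB ha hsupp hA hu w hw ξ hξ
  have hB := hPB.1
  have hA0 := hA.1
  have hU := jetSum_nonneg (k + (k + m + q)) u w.2
  have hU' := jetSum_nonneg (k + 0) u w.2
  have hUU : jetSum (k + 0) u w.2 ≤ jetSum (k + (k + m + q)) u w.2 := jetSum_mono (by omega) _ _
  by_cases h : ‖ξ‖ ≤ 1
  · have hPB' : PhaseBound (closure S ∩ X ×ˢ X) φ (k + 0 + 1) B :=
      ⟨hB, fun w hw θ hθ => ⟨((hPB.2 w hw θ hθ).1).mono (by omega) le_rfl, (hPB.2 w hw θ hθ).2⟩⟩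
    have hA' : AmpBound X a m (k + 0) A :=
      ⟨hA0, fun w hw ξ => (hA.2 w hw ξ).mono (by omega) le_rfl⟩
    have hk : fioKernel φ a u (k + m + q) ξ = oscIntegrand φ a u 0 ξ := by
      funext w; simp [fioKernel, h]
    rw [hk]
    refine (h₀ hX hφ hPB' ha hsupp hA' hu w hw ξ hξ).mono le_rfl ?_
    have h1 := one_add_pow_le (norm_nonneg ξ) h (k + m) q
    have h2 : B ^ Q₀ ≤ B ^ (Q₀ + Q₁) := pow_le_pow_right₀ hB (by omega)
    rw [pow_zero, one_mul]
    calc _ ≤ (C₀ + C₁) * B ^ (Q₀ + Q₁) * A * jetSum (k + (k + m + q)) u w.2 *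
          (2 ^ (k + m + q) * ((1 + ‖ξ‖) ^ q)⁻¹) := by
          gcongr
          linarith
      _ = _ := by ring
  · have hk : fioKernel φ a u (k + m + q) ξ =
        fun w => Complex.I ^ (k + m + q) • oscIntegrand φ a u (k + m + q) ξ w := by
      funext w; simp [fioKernel, h]
    rw [hk]
    refine (JetLE.const_smul (Complex.I ^ (k + m + q))
      ((contDiffOn_oscIntegrand hX hφ ha hu hξ _).contDiffAt ((hX.prod hX).mem_nhds hw))
      (h₁ hX hφ hPB ha hsupp hA hu w hw ξ hξ)).mono le_rfl ?_
    have h1 := inv_pow_mul_one_add_pow_le (not_le.1 h) k m q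
    have h2 : B ^ Q₁ ≤ B ^ (Q₀ + Q₁) := pow_le_pow_right₀ hB (by omega)
    rw [norm_pow, Complex.norm_I, one_pow, one_mul]
    calc _ ≤ (C₀ + C₁) * B ^ (Q₀ + Q₁) * A * jetSum (k + (k + m + q)) u w.2 *
          (2 ^ (k + m + q) * ((1 + ‖ξ‖) ^ q)⁻¹) := by
          gcongr
          linarith
      _ = _ := by ring

/-! ### Joint measurability -/

theorem contDiffOn_fderiv_slice {E G F : Type*} [NormedAddCommGroup E] [NormedSpace ℝ E]
    [NormedAddCommGroup G] [NormedSpace ℝ G] [NormedAddCommGroup F] [NormedSpace ℝ F]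
    {O : Set (G × E)} (hO : IsOpen O) {f : G → E → F}
    (hf : ContDiffOn ℝ ∞ (fun z : G × E => f z.1 z.2) O) (e : E) :
    ContDiffOn ℝ ∞ (fun z : G × E => fderiv ℝ (f z.1) z.2 e) O := by
  refine (hf.fderiv_apply_const hO (0, e)).congr fun z hz => ?_
  have hd : DifferentiableAt ℝ (fun z : G × E => f z.1 z.2) z :=
    (hf.contDiffAt (hO.mem_nhds hz)).differentiableAt (by simp)
  have h1 : HasFDerivAt (fun v : E => (z.1, v)) (ContinuousLinearMap.inr ℝ G E) z.2 :=
    hasFDerivAt_prodMk_right z.1 z.2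
  have := (hd.hasFDerivAt.comp z.2 h1).fderiv
  change fderiv ℝ ((fun z : G × E => f z.1 z.2) ∘ fun v => (z.1, v)) z.2 e = _
  rw [this]
  simp

/-- Joint smoothness in the frequency and the space variables survives integration by parts. -/
theorem contDiffOn_divGrad_joint {G : Type*} [NormedAddCommGroup G] [NormedSpace ℝ G]
    {O : Set (G × (Euc n × Euc n))} (hO : IsOpen O) {ψ : G → Euc n × Euc n → ℝ}
    {g : G → Euc n × Euc n → ℂ} (hψ : ContDiffOn ℝ ∞ (fun z : G × (Euc n × Euc n) => ψ z.1 z.2) O)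
    (h0 : ∀ z ∈ O, gradSq (ψ z.1) z.2 ≠ 0)
    (hg : ContDiffOn ℝ ∞ (fun z : G × (Euc n × Euc n) => g z.1 z.2) O) (M : ℕ) :
    ContDiffOn ℝ ∞ (fun z : G × (Euc n × Euc n) => (divGrad (ψ z.1))^[M] (g z.1) z.2) O := by
  have hd : ∀ j : Fin n, ContDiffOn ℝ ∞
      (fun z : G × (Euc n × Euc n) => fderiv ℝ (ψ z.1) z.2 (yDir j)) O := fun j =>
    contDiffOn_fderiv_slice hO hψ _
  have hs : ContDiffOn ℝ ∞ (fun z : G × (Euc n × Euc n) => gradSq (ψ z.1) z.2) O :=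
    ContDiffOn.sum fun j _ => (hd j).pow 2
  have hgf : ∀ j, ContDiffOn ℝ ∞ (fun z : G × (Euc n × Euc n) => gradField (ψ z.1) j z.2) O :=
    fun j => (hs.inv h0).mul (hd j)
  induction M with
  | zero => exact hg
  | succ M ih =>
    simp only [Function.iterate_succ_apply']
    refine ContDiffOn.sum fun j _ => ?_
    exact contDiffOn_fderiv_slice (f := fun p w =>
      gradField (ψ p) j w • (divGrad (ψ p))^[M] (g p) w) hO ((hgf j).smul ih) (yDir j)

theorem contDiffOn_oscIntegrand_joint (hX : IsOpen X) (hφ : IsPhase X φ)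
    (ha : ContDiffOn ℝ ∞ (uncurry₃ a) (X ×ˢ X ×ˢ Set.univ)) (hu : ContDiffOn ℝ ∞ u X) (M : ℕ) :
    ContDiffOn ℝ ∞ (fun z : Euc n × (Euc n × Euc n) => oscIntegrand φ a u M z.2.1 (z.1, z.2.2))
      (X ×ˢ ({0}ᶜ ×ˢ X)) := by
  have hO : IsOpen (({0}ᶜ : Set (Euc n)) ×ˢ (X ×ˢ X)) :=
    isOpen_compl_singleton.prod (hX.prod hX)
  have hψ : ContDiffOn ℝ ∞ (fun z : Euc n × (Euc n × Euc n) => phaseSlice φ z.1 z.2)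
      ({0}ᶜ ×ˢ (X ×ˢ X)) :=
    hφ.smooth.comp (f := fun z : Euc n × (Euc n × Euc n) => (z.2.1, z.2.2, z.1))
      (by fun_prop) fun z hz => ⟨hz.2.1, hz.2.2, hz.1⟩
  have hg : ContDiffOn ℝ ∞ (fun z : Euc n × (Euc n × Euc n) => ampMul a u z.1 z.2)
      ({0}ᶜ ×ˢ (X ×ˢ X)) := by
    refine ContDiffOn.mul ?_ ?_
    · exact ha.comp (f := fun z : Euc n × (Euc n × Euc n) => (z.2.1, z.2.2, z.1))
        (by fun_prop) fun z hz => ⟨hz.2.1, hz.2.2, trivial⟩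
    · exact hu.comp (f := fun z : Euc n × (Euc n × Euc n) => z.2.2)
        (by fun_prop) fun z hz => hz.2.2
  have hP := contDiffOn_divGrad_joint hO hψ
    (fun z hz => hφ.gradSq_ne_zero hX hz.1 z.2 hz.2) hg M
  have hE : ContDiffOn ℝ ∞ (fun z : Euc n × (Euc n × Euc n) => oscIntegrand φ a u M z.1 z.2)
      ({0}ᶜ ×ˢ (X ×ˢ X)) := (contDiff_cexp_I.comp_contDiffOn hψ).mul hP
  exact hE.comp (f := fun z : Euc n × (Euc n × Euc n) => (z.2.1, (z.1, z.2.2)))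
    (by fun_prop) fun z hz => ⟨hz.2.1, hz.1, hz.2.2⟩

theorem aestronglyMeasurable_iteratedFDeriv_fioKernel (hX : IsOpen X) (hφ : IsPhase X φ)
    (ha : ContDiffOn ℝ ∞ (uncurry₃ a) (X ×ˢ X ×ˢ Set.univ)) (hu : ContDiffOn ℝ ∞ u X) (M j : ℕ)
    {x : Euc n} (hx : x ∈ X) :
    AEStronglyMeasurable
      (fun ζ : Euc n × Euc n => iteratedFDeriv ℝ j (fun x => fioKernel φ a u M ζ.1 (x, ζ.2)) x)
      ((volume.prod volume).restrict ({0}ᶜ ×ˢ X)) := by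
  have hO : IsOpen (({0}ᶜ : Set (Euc n)) ×ˢ X) := isOpen_compl_singleton.prod hX
  have hc : ∀ M, ContinuousOn (fun ζ : Euc n × Euc n =>
      iteratedFDeriv ℝ j (fun x => oscIntegrand φ a u M ζ.1 (x, ζ.2)) x) ({0}ᶜ ×ˢ X) := fun M =>
    (continuousOn_iteratedFDeriv_left (hX.prod hO)
      (contDiffOn_oscIntegrand_joint hX hφ ha hu M) j).comp
      (f := fun ζ : Euc n × Euc n => (x, ζ)) (by fun_prop) fun ζ hζ => ⟨hx, hζ⟩
  have hm : ∀ M, AEStronglyMeasurable (fun ζ : Euc n × Euc n =>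
      iteratedFDeriv ℝ j (fun x => oscIntegrand φ a u M ζ.1 (x, ζ.2)) x)
      ((volume.prod volume).restrict ({0}ᶜ ×ˢ X)) := fun M =>
    (hc M).aestronglyMeasurable hO.measurableSet
  set s : Set (Euc n × Euc n) := {ζ | ‖ζ.1‖ ≤ 1} with hs
  have hsm : MeasurableSet s := (isClosed_le (by fun_prop) continuous_const).measurableSet
  have hsmooth : ∀ ζ ∈ ({0}ᶜ : Set (Euc n)) ×ˢ X,
      ContDiffAt ℝ ∞ (fun x => oscIntegrand φ a u M ζ.1 (x, ζ.2)) x := fun ζ hζ =>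
    ((contDiffOn_oscIntegrand hX hφ ha hu hζ.1 M).comp (f := fun x : Euc n => (x, ζ.2))
      (by fun_prop) fun x hx => ⟨hx, hζ.2⟩).contDiffAt (hX.mem_nhds hx)
  classical
  have hp := AEStronglyMeasurable.piecewise hsm (hm 0).restrict
    ((hm M).const_smul (Complex.I ^ M)).restrict
  refine hp.congr ((ae_restrict_iff' hO.measurableSet).2 (Eventually.of_forall fun ζ hζ => ?_))
  by_cases h : ‖ζ.1‖ ≤ 1
  · have h1 : ζ ∈ s := h
    simp [Set.piecewise, h1, fioKernel, h]
  · have h1 : ζ ∉ s := h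
    simp only [Set.piecewise, h1, if_false, fioKernel, h]
    exact (iteratedFDeriv_const_smul_apply ((hsmooth ζ hζ).of_le
      (by exact_mod_cast le_top))).symm

end Kernel

/-! ### Pointwise estimates for the operator -/

theorem integrable_inv_one_add_norm_pow {n q : ℕ} (hq : n + 1 ≤ q) :
    Integrable (fun ξ : Euc n => ((1 + ‖ξ‖) ^ q)⁻¹) := by
  have h := integrable_one_add_norm (E := Euc n) (μ := volume) (r := (q : ℝ)) (by
    rw [finrank_euclideanSpace_fin]
    exact_mod_cast hq)
  refine h.congr (Eventually.of_forall fun ξ => ?_)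
  simp only
  rw [Real.rpow_neg (by positivity), Real.rpow_natCast]

/-- The integral of the weight `(1 + |ξ|)^{-q}`. -/
noncomputable def weightInt (n q : ℕ) : ℝ := ∫ ξ : Euc n, ((1 + ‖ξ‖) ^ q)⁻¹

theorem weightInt_nonneg (n q : ℕ) : 0 ≤ weightInt n q :=
  integral_nonneg fun _ => by positivity

section Operator

variable {n : ℕ} {X K : Set (Euc n)}
  {φ : Euc n → Euc n → Euc n → ℝ} {a : Euc n → Euc n → Euc n → ℂ} {u : Euc n → ℂ} {x ξ : Euc n}
  {R M m q k N : ℕ} {A D : ℝ}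

/-- In positive dimension the frequency `ξ = 0`, where the phase is not smooth, is negligible. -/
theorem restrict_compl_zero_prod (hn : 1 ≤ n) (X : Set (Euc n)) :
    (volume.prod volume).restrict (({0}ᶜ : Set (Euc n)) ×ˢ X) =
      volume.prod (volume.restrict X) := by
  have : Nonempty (Fin n) := ⟨⟨0, hn⟩⟩
  rw [← Measure.prod_restrict, restrict_compl_singleton]

theorem setIntegral_integrand_eq (hX : IsOpen X) (hK : IsCompact K) (hKX : K ⊆ X)
    (hφ : IsPhase X φ) (ha : ContDiffOn ℝ ∞ (uncurry₃ a) (X ×ˢ X ×ˢ Set.univ))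
    (hsupp : ∀ x ∈ X, ∀ y ∈ X, y ∉ K → ∀ ξ, a x y ξ = 0) (hu : ContDiffOn ℝ ∞ u X) (hξ : ξ ≠ 0)
    (hx : x ∈ X) (M : ℕ) :
    ∫ y in X, integrand φ a u x ξ y = ∫ y in X, fioKernel φ a u M ξ (x, y) := by
  have h1 : ∀ y, integrand φ a u x ξ y =
      Complex.exp (Complex.I * (phaseSlice φ ξ (x, y) : ℂ)) * ampMul a u ξ (x, y) := fun y => by
    simp [integrand, phaseSlice, ampMul, ampSlice, mul_assoc]
  simp only [h1]
  by_cases h : ‖ξ‖ ≤ 1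
  · simp [fioKernel, h, oscIntegrand]
  · simp only [fioKernel, h, if_false, oscIntegrand, integral_const_mul]
    exact setIntegral_exp_mul_eq_iterate hX hK hKX (hφ.contDiffOn_slice hξ)
      (hφ.gradSq_ne_zero hX hξ) (contDiffOn_ampMul ha hu ξ)
      (fun z hz hzK => by simp [ampMul, ampSlice, hsupp z.1 hz.1 z.2 hz.2 hzK]) hx M

theorem integrableOn_integrand (hX : IsOpen X) (hK : IsCompact K) (hKX : K ⊆ X)
    (hφ : IsPhase X φ) (ha : ContDiffOn ℝ ∞ (uncurry₃ a) (X ×ˢ X ×ˢ Set.univ))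
    (hsupp : ∀ x ∈ X, ∀ y ∈ X, y ∉ K → ∀ ξ, a x y ξ = 0) (hu : ContDiffOn ℝ ∞ u X) (hξ : ξ ≠ 0)
    (hx : x ∈ X) : IntegrableOn (integrand φ a u x ξ) X := by
  have hc : ContDiffOn ℝ ∞ (fun y => oscIntegrand φ a u 0 ξ (x, y)) X :=
    (contDiffOn_oscIntegrand hX hφ ha hu hξ 0).comp (f := fun y : Euc n => (x, y)) (by fun_prop)
      fun y hy => ⟨hx, hy⟩
  refine integrableOn_of_eq_zero_off_compact hX hK hKX (hc.continuousOn.congr fun y _ => ?_)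
    fun y hy hyK => ?_
  · simp [integrand, oscIntegrand, phaseSlice, ampMul, ampSlice, mul_assoc]
  · simp [integrand, hsupp x hx y hy hyK ξ]

theorem norm_setIntegral_integrand_le (hX : IsOpen X) (hA : AmpBound X a m R A) (hx : x ∈ X)
    (hint : IntegrableOn u X) :
    ‖∫ y in X, integrand φ a u x ξ y‖ ≤ A * (1 + ‖ξ‖) ^ m * ∫ y in X, ‖u y‖ := by
  rw [← integral_const_mul]
  refine norm_integral_le_of_norm_le (hint.norm.const_mul _)
    ((ae_restrict_iff' hX.measurableSet).2 (Eventually.of_forall fun y hy => ?_))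
  have h1 : ‖a x y ξ‖ ≤ A * (1 + ‖ξ‖) ^ m := (hA.2 (x, y) ⟨hx, hy⟩ ξ).norm_le
  rw [integrand, norm_mul, norm_mul, mul_comm Complex.I, Complex.norm_exp_ofReal_mul_I, one_mul]
  gcongr

theorem norm_setIntegral_fioKernel_le (hX : IsOpen X) (hξ : ξ ≠ 0) (hx : x ∈ X)
    (hint : IntegrableOn (jetSum R u) X)
    (hb : ∀ w ∈ X ×ˢ X, ∀ ξ ≠ 0,
      JetLE k (fioKernel φ a u M ξ) w (D * (((1 + ‖ξ‖) ^ q)⁻¹ * jetSum R u w.2))) :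
    ‖∫ y in X, fioKernel φ a u M ξ (x, y)‖ ≤ D * ((1 + ‖ξ‖) ^ q)⁻¹ * ∫ y in X, jetSum R u y := by
  rw [← integral_const_mul]
  refine norm_integral_le_of_norm_le (hint.const_mul _)
    ((ae_restrict_iff' hX.measurableSet).2 (Eventually.of_forall fun y hy => ?_))
  rw [mul_assoc]
  exact (hb (x, y) ⟨hx, hy⟩ ξ hξ).norm_le

/-- The operator is an absolutely convergent integral over `ℝⁿ × X` of a kernel whose derivatives
are integrable, uniformly in `x`. -/
theorem fio_estimate (hn : 1 ≤ n) (hX : IsOpen X) (hK : IsCompact K) (hKX : K ⊆ X)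
    (hφ : IsPhase X φ) (ha : ContDiffOn ℝ ∞ (uncurry₃ a) (X ×ˢ X ×ˢ Set.univ))
    (hsupp : ∀ x ∈ X, ∀ y ∈ X, y ∉ K → ∀ ξ, a x y ξ = 0) (hu : ContDiffOn ℝ ∞ u X)
    (hint : IntegrableOn (jetSum R u) X) (hq : n + 1 ≤ q)
    (hb : ∀ w ∈ X ×ˢ X, ∀ ξ ≠ 0,
      JetLE (N + 1) (fioKernel φ a u M ξ) w (D * (((1 + ‖ξ‖) ^ q)⁻¹ * jetSum R u w.2))) :
    ContDiffOn ℝ N (fio X φ a u) X ∧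
      (∀ j ≤ N, ∀ x ∈ X, ‖iteratedFDeriv ℝ j (fio X φ a u) x‖ ≤
        D * weightInt n q * ∫ y in X, jetSum R u y) ∧
      ∀ x ∈ X, Integrable fun ξ => ∫ y in X, integrand φ a u x ξ y := by
  have : Nonempty (Fin n) := ⟨⟨0, hn⟩⟩
  set ν : Measure (Euc n × Euc n) := volume.prod (volume.restrict X) with hν
  set bound : Euc n × Euc n → ℝ := fun ζ => D * (((1 + ‖ζ.1‖) ^ q)⁻¹ * jetSum R u ζ.2) with hbd
  have hae : ∀ᵐ ζ ∂ν, ζ ∈ ({0}ᶜ : Set (Euc n)) ×ˢ X := by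
    rw [hν, ← restrict_compl_zero_prod hn X]
    exact ae_restrict_mem (isOpen_compl_singleton.prod hX).measurableSet
  have hbint : Integrable bound ν :=
    ((integrable_inv_one_add_norm_pow hq).mul_prod hint).const_mul D
  have hbval : ∫ ζ, bound ζ ∂ν = D * weightInt n q * ∫ y in X, jetSum R u y := by
    simp only [hbd, integral_const_mul, mul_assoc]
    congr 1
    exact integral_prod_mul (fun ξ : Euc n => ((1 + ‖ξ‖) ^ q)⁻¹) (jetSum R u)
  have hmeas : ∀ j, ∀ x ∈ X, AEStronglyMeasurable (fun ζ : Euc n × Euc n =>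
      iteratedFDeriv ℝ j (fun x => fioKernel φ a u M ζ.1 (x, ζ.2)) x) ν := fun j x hx => by
    rw [hν, ← restrict_compl_zero_prod hn X]
    exact aestronglyMeasurable_iteratedFDeriv_fioKernel hX hφ ha hu M j hx
  have hbnd : ∀ ζ ∈ ({0}ᶜ : Set (Euc n)) ×ˢ X, ∀ j ≤ N + 1, ∀ x ∈ X,
      ‖iteratedFDeriv ℝ j (fun x => fioKernel φ a u M ζ.1 (x, ζ.2)) x‖ ≤ bound ζ := by
    intro ζ hζ j hj x hx
    have h1 := norm_iteratedFDeriv_comp_affine_le (hX.prod hX)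
      (contDiffOn_fioKernel hX hφ ha hu hζ.1 M) (ContinuousLinearMap.inl ℝ (Euc n) (Euc n))
      (ContinuousLinearMap.norm_inl_le_one ℝ (Euc n) (Euc n)) (0, ζ.2) (x := x)
      (by simpa using ⟨hx, hζ.2⟩) j
    simp only [ContinuousLinearMap.inl_apply, Prod.mk_add_mk, add_zero, zero_add] at h1
    exact h1.trans (hb (x, ζ.2) ⟨hx, hζ.2⟩ ζ.1 hζ.1 j hj)
  obtain ⟨hcd, hder⟩ := contDiffOn_integral_of_dominated (μ := ν) hX
    (f := fun x ζ => fioKernel φ a u M ζ.1 (x, ζ.2)) N (bound := bound)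
    (hae.mono fun ζ hζ => (contDiffOn_fioKernel hX hφ ha hu hζ.1 M).comp
      (f := fun x : Euc n => (x, ζ.2)) (by fun_prop) fun x hx => ⟨hx, hζ.2⟩)
    (fun j _ x hx => hmeas j x hx) (hae.mono fun ζ hζ => hbnd ζ hζ) hbint
  have hkint : ∀ x ∈ X, Integrable (fun ζ : Euc n × Euc n => fioKernel φ a u M ζ.1 (x, ζ.2)) ν := by
    intro x hx
    refine hbint.mono' ?_ (hae.mono fun ζ hζ => ?_)
    · have := (continuousMultilinearCurryFin0 ℝ (Euc n) ℂ).continuous.comp_aestronglyMeasurable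
        (hmeas 0 x hx)
      exact this
    · simpa using hbnd ζ hζ 0 (Nat.zero_le _) x hx
  have hinner : ∀ x ∈ X, (fun ξ => ∫ y in X, fioKernel φ a u M ξ (x, y)) =ᵐ[volume]
      fun ξ => ∫ y in X, integrand φ a u x ξ y := fun x hx => by
    have h0 : ∀ᵐ ξ : Euc n, ξ ∈ ({0}ᶜ : Set (Euc n)) := compl_mem_ae_iff.2 (by simp)
    filter_upwards [h0] with ξ hξ
    exact (setIntegral_integrand_eq hX hK hKX hφ ha hsupp hu hξ hx M).symm
  set c : ℂ := (((2 * Real.pi) ^ n : ℝ) : ℂ)⁻¹ with hc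
  have hc1 : ‖c‖ ≤ 1 := by
    rw [hc, norm_inv, Complex.norm_real, Real.norm_of_nonneg (by positivity)]
    exact inv_le_one_of_one_le₀ (one_le_pow₀ (by linarith [Real.pi_gt_three]))
  have hfio : Set.EqOn (fio X φ a u) (fun x => c • ∫ ζ, fioKernel φ a u M ζ.1 (x, ζ.2) ∂ν) X := by
    intro x hx
    simp only [fio, smul_eq_mul]
    rw [hν, integral_prod _ (hkint x hx), integral_congr_ae (hinner x hx)]
  refine ⟨(hcd.const_smul c).congr hfio, fun j hj x hx => ?_, fun x hx => ?_⟩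
  · have h1 : ContDiffAt ℝ j (fun x => ∫ ζ, fioKernel φ a u M ζ.1 (x, ζ.2) ∂ν) x :=
      (hcd.contDiffAt (hX.mem_nhds hx)).of_le (by exact_mod_cast hj)
    rw [((hfio.eventuallyEq_of_mem (hX.mem_nhds hx)).iteratedFDeriv ℝ j).eq_of_nhds,
      iteratedFDeriv_const_smul_apply' (a := c) h1, hder j hj x hx, norm_smul, ← hbval]
    refine (mul_le_of_le_one_left (norm_nonneg _) hc1).trans ?_
    exact norm_integral_le_of_norm_le hbint (hae.mono fun ζ hζ => hbnd ζ hζ j (by omega) x hx)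
  · exact (hkint x hx).integral_prod_left.congr (hinner x hx)

/-- Of two bounds for `v`, a large one of growth `(1 + t)^m` and one with decay, the first is used
for `1 + t ≤ h⁻¹` and the second beyond. -/
theorem min_weight_le {t h b c : ℝ} (ht : 0 ≤ t) (hh : 0 < h) (hb : 0 ≤ b) (hc : 0 ≤ c) {v : ℝ}
    (n m : ℕ) (h1 : v ≤ c * (1 + t) ^ m) (h2 : v ≤ b * ((1 + t) ^ (n + 2))⁻¹) :
    v ≤ (h * b + (h⁻¹) ^ (m + (n + 1)) * c) * ((1 + t) ^ (n + 1))⁻¹ := by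
  have hp : 0 < 1 + t := by linarith
  by_cases hcase : 1 + t ≤ h⁻¹
  · refine h1.trans ?_
    calc c * (1 + t) ^ m = (1 + t) ^ (m + (n + 1)) * c * ((1 + t) ^ (n + 1))⁻¹ := by
          rw [pow_add]; field_simp
      _ ≤ (h⁻¹) ^ (m + (n + 1)) * c * ((1 + t) ^ (n + 1))⁻¹ := by gcongr
      _ ≤ _ := by gcongr; linarith [mul_nonneg hh.le hb]
  · refine h2.trans ?_
    have h3 : (1 + t)⁻¹ ≤ h := inv_le_of_inv_le₀ hh (not_le.1 hcase).le
    calc b * ((1 + t) ^ (n + 2))⁻¹ = (1 + t)⁻¹ * b * ((1 + t) ^ (n + 1))⁻¹ := by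
          rw [pow_succ, mul_inv]; ring
      _ ≤ h * b * ((1 + t) ^ (n + 1))⁻¹ := by gcongr
      _ ≤ _ := by
          gcongr
          have : 0 ≤ (h⁻¹) ^ (m + (n + 1)) * c := by positivity
          linarith

/-- Splitting the frequencies at `|ξ| ~ h⁻¹` bounds the operator by a large multiple of the norm of
`u` and a small multiple of the norms of its derivatives. -/
theorem norm_fio_le_interpolation (hn : 1 ≤ n) (hX : IsOpen X) (hK : IsCompact K) (hKX : K ⊆ X)
    (hφ : IsPhase X φ) (ha : ContDiffOn ℝ ∞ (uncurry₃ a) (X ×ˢ X ×ˢ Set.univ))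
    (hsupp : ∀ x ∈ X, ∀ y ∈ X, y ∉ K → ∀ ξ, a x y ξ = 0) (hu : ContDiffOn ℝ ∞ u X)
    (hint : IntegrableOn (jetSum R u) X) (huint : IntegrableOn u X) (hA : AmpBound X a m R A)
    (hD : 0 ≤ D) (hb : ∀ w ∈ X ×ˢ X, ∀ ξ ≠ 0,
      JetLE k (fioKernel φ a u M ξ) w (D * (((1 + ‖ξ‖) ^ (n + 2))⁻¹ * jetSum R u w.2)))
    {h : ℝ} (hh : 0 < h) (hx : x ∈ X) :
    ‖fio X φ a u x‖ ≤ weightInt n (n + 1) *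
      (h * (D * ∫ y in X, jetSum R u y) + (h⁻¹) ^ (m + (n + 1)) * (A * ∫ y in X, ‖u y‖)) := by
  have : Nonempty (Fin n) := ⟨⟨0, hn⟩⟩
  have hU : 0 ≤ ∫ y in X, jetSum R u y := integral_nonneg fun y => jetSum_nonneg R u y
  have hu0 : 0 ≤ ∫ y in X, ‖u y‖ := integral_nonneg fun y => norm_nonneg _
  have hA0 := hA.1
  set E := h * (D * ∫ y in X, jetSum R u y) + (h⁻¹) ^ (m + (n + 1)) * (A * ∫ y in X, ‖u y‖)
  have hc1 : ‖(((2 * Real.pi) ^ n : ℝ) : ℂ)⁻¹‖ ≤ 1 := by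
    rw [norm_inv, Complex.norm_real, Real.norm_of_nonneg (by positivity)]
    exact inv_le_one_of_one_le₀ (one_le_pow₀ (by linarith [Real.pi_gt_three]))
  have h0 : ∀ᵐ ξ : Euc n, ξ ∈ ({0}ᶜ : Set (Euc n)) := compl_mem_ae_iff.2 (by simp)
  rw [fio, norm_mul]
  refine (mul_le_of_le_one_left (norm_nonneg _) hc1).trans ?_
  have hle : ‖∫ ξ, ∫ y in X, integrand φ a u x ξ y‖ ≤ ∫ ξ : Euc n, E * ((1 + ‖ξ‖) ^ (n + 1))⁻¹ := by
    refine norm_integral_le_of_norm_le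
      ((integrable_inv_one_add_norm_pow le_rfl).const_mul E) (h0.mono fun ξ hξ => ?_)
    refine min_weight_le (norm_nonneg ξ) hh (by positivity) (by positivity) n m ?_ ?_
    · refine (norm_setIntegral_integrand_le hX hA hx huint).trans (le_of_eq (by ring))
    · rw [setIntegral_integrand_eq hX hK hKX hφ ha hsupp hu hξ hx M]
      exact (norm_setIntegral_fioKernel_le hX hξ hx hint hb).trans (le_of_eq (by ring))
  refine hle.trans (le_of_eq ?_)
  rw [integral_const_mul, weightInt, mul_comm]

end Operator

/-! ### Estimates in the norms of `L^p(X)` -/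

section Lp

variable {n : ℕ} {X : Set (Euc n)} {p : ℝ≥0∞} {u : Euc n → ℂ}

theorem integrableOn_of_memLp (hp : 1 ≤ p) (hXb : Bornology.IsBounded X) {F : Type*}
    [NormedAddCommGroup F] {f : Euc n → F} (hf : MemLp f p (volume.restrict X)) :
    IntegrableOn f X := by
  have : IsFiniteMeasure (volume.restrict X) := ⟨by
    rw [Measure.restrict_apply_univ]; exact hXb.measure_lt_top⟩
  exact hf.integrable hp

theorem integrableOn_jetSum (hp : 1 ≤ p) (hXb : Bornology.IsBounded X) (hu : MemLpSmooth X p u)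
    (R : ℕ) : IntegrableOn (jetSum R u) X :=
  integrable_finsetSum _ fun j _ => (integrableOn_of_memLp hp hXb (hu.2 j)).norm

/-- Hölder's inequality on the bounded set `X`. -/
theorem exists_setIntegral_norm_le (hp : 1 ≤ p) (hXb : Bornology.IsBounded X) :
    ∃ C : ℝ, 0 ≤ C ∧ ∀ u : Euc n → ℂ, MemLpSmooth X p u → ∀ k,
      ∫ y in X, ‖iteratedFDeriv ℝ k u y‖ ≤ C * derivNorm X p k u := by
  have hfin : volume X < ⊤ := hXb.measure_lt_top
  have : IsFiniteMeasure (volume.restrict X) := ⟨by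
    rw [Measure.restrict_apply_univ]; exact hfin⟩
  set c : ℝ≥0∞ := (volume.restrict X) Set.univ ^ (1 / (1 : ℝ≥0∞).toReal - 1 / p.toReal) with hc
  have hcfin : c ≠ ⊤ := by
    refine ENNReal.rpow_ne_top_of_nonneg ?_ (measure_ne_top _ _)
    rcases eq_or_ne p ⊤ with rfl | hp'
    · simp
    · have : 1 ≤ p.toReal := by
        rw [← ENNReal.toReal_one]
        exact ENNReal.toReal_mono hp' hp
      have h2 : 1 / p.toReal ≤ 1 := (div_le_one (by linarith)).2 this
      simpa using h2
  refine ⟨c.toReal, ENNReal.toReal_nonneg, fun u hu k => ?_⟩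
  have h1 := eLpNorm_le_eLpNorm_mul_rpow_measure_univ hp (hu.2 k).1
  rw [← hc] at h1
  have h2 : ∫ y in X, ‖iteratedFDeriv ℝ k u y‖ =
      (eLpNorm (iteratedFDeriv ℝ k u) 1 (volume.restrict X)).toReal := by
    rw [eLpNorm_one_eq_lintegral_enorm, integral_norm_eq_lintegral_enorm (hu.2 k).1]
  rw [h2, derivNorm, mul_comm, ← ENNReal.toReal_mul]
  exact ENNReal.toReal_mono (ENNReal.mul_ne_top (hu.2 k).2.ne hcfin) h1

theorem exists_setIntegral_jetSum_le (hp : 1 ≤ p) (hXb : Bornology.IsBounded X) :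
    ∃ C : ℝ, 0 ≤ C ∧ ∀ u : Euc n → ℂ, MemLpSmooth X p u → ∀ R,
      ∫ y in X, jetSum R u y ≤ C * ∑ j ∈ Finset.range (R + 1), derivNorm X p j u := by
  obtain ⟨C, hC, h⟩ := exists_setIntegral_norm_le (n := n) hp hXb
  refine ⟨C, hC, fun u hu R => ?_⟩
  simp only [jetSum]
  rw [integral_finsetSum _ fun j _ => (integrableOn_of_memLp hp hXb (hu.2 j)).norm, Finset.mul_sum]
  exact Finset.sum_le_sum fun j _ => h u hu j

theorem exists_derivNorm_le (p : ℝ≥0∞) (hX : IsOpen X) (hXb : Bornology.IsBounded X) :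
    ∃ C : ℝ, 0 ≤ C ∧ ∀ (v : Euc n → ℂ) (k : ℕ) (b : ℝ), 0 ≤ b →
      (∀ x ∈ X, ‖iteratedFDeriv ℝ k v x‖ ≤ b) → derivNorm X p k v ≤ C * b := by
  have hfin : volume X < ⊤ := hXb.measure_lt_top
  set c : ℝ≥0∞ := (volume.restrict X) Set.univ ^ p.toReal⁻¹ with hc
  have hcfin : c ≠ ⊤ := by
    refine ENNReal.rpow_ne_top_of_nonneg (by positivity) ?_
    rw [Measure.restrict_apply_univ]; exact hfin.ne
  refine ⟨c.toReal, ENNReal.toReal_nonneg, fun v k b hb0 hb => ?_⟩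
  have h1 : eLpNorm (iteratedFDeriv ℝ k v) p (volume.restrict X) ≤ c * ENNReal.ofReal b :=
    eLpNorm_le_of_ae_bound ((ae_restrict_iff' hX.measurableSet).2 (Eventually.of_forall hb))
  rw [derivNorm, ← ENNReal.toReal_ofReal hb0, ← ENNReal.toReal_mul]
  exact ENNReal.toReal_mono (ENNReal.mul_ne_top hcfin ENNReal.ofReal_ne_top) h1

theorem memLpSmooth_of_bounded (hX : IsOpen X) (hXb : Bornology.IsBounded X) {v : Euc n → ℂ}
    (hv : ContDiffOn ℝ ∞ v X) (hb : ∀ k, ∃ b, ∀ x ∈ X, ‖iteratedFDeriv ℝ k v x‖ ≤ b) :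
    MemLpSmooth X p v := by
  have : IsFiniteMeasure (volume.restrict X) := ⟨by
    rw [Measure.restrict_apply_univ]; exact hXb.measure_lt_top⟩
  refine ⟨hv, fun k => ?_⟩
  obtain ⟨b, hb⟩ := hb k
  exact MemLp.of_bound ((hv.continuousOn_iteratedFDeriv_of_isOpen hX k).aestronglyMeasurable
    hX.measurableSet) b ((ae_restrict_iff' hX.measurableSet).2 (Eventually.of_forall hb))

end Lp

/-! ### Norm estimates with explicit dependence on the phase and the amplitude -/

section Estimates

variable {n : ℕ} {X K : Set (Euc n)} {S : Set (Euc n × Euc n)} {p : ℝ≥0∞}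

/-- The sum of the norms `‖∂^j u‖_{L^p(X)}` over the orders `j ≤ R`. -/
noncomputable def sobSum (X : Set (Euc n)) (p : ℝ≥0∞) (R : ℕ) (u : Euc n → ℂ) : ℝ :=
  ∑ j ∈ Finset.range (R + 1), derivNorm X p j u

theorem sobSum_nonneg (X : Set (Euc n)) (p : ℝ≥0∞) (R : ℕ) (u : Euc n → ℂ) :
    0 ≤ sobSum X p R u :=
  Finset.sum_nonneg fun _ _ => derivNorm_nonneg _ _ _ _

theorem sobSum_mono {R R' : ℕ} (h : R ≤ R') (u : Euc n → ℂ) : sobSum X p R u ≤ sobSum X p R' u :=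
  Finset.sum_le_sum_of_subset_of_nonneg (Finset.range_mono (by omega))
    fun _ _ _ => derivNorm_nonneg _ _ _ _

/-- The phase `φ` and the amplitude `a` satisfy over `S` the bounds needed for the operator, up to
order `R`: with the constant `b` for the phase and `A` for the amplitude. -/
structure FIOData (X : Set (Euc n)) (S : Set (Euc n × Euc n)) (m R : ℕ)
    (φ : Euc n → Euc n → Euc n → ℝ) (a : Euc n → Euc n → Euc n → ℂ) (b A : ℝ) : Prop where
  phase : IsPhase X φ
  one_le : 1 ≤ b
  phase_le : ∀ k ≤ R, ∀ z ∈ overSphere S, ‖iteratedFDeriv ℝ k (uncurry₃ φ) z‖ ≤ b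
  det_le : ∀ z ∈ overSphere S, |(uncurry₃ (mixedHessian φ) z).det|⁻¹ ≤ b
  smooth : ContDiffOn ℝ ∞ (uncurry₃ a) (X ×ˢ X ×ˢ Set.univ)
  support : ∀ x ∈ X, ∀ y ∈ X, (x, y) ∉ S → ∀ ξ, a x y ξ = 0
  amp : AmpBound X a m R A

theorem FIOData.mono {m R R' : ℕ} {φ : Euc n → Euc n → Euc n → ℝ}
    {a : Euc n → Euc n → Euc n → ℂ} {b A : ℝ} (h : FIOData X S m R φ a b A) (hR : R' ≤ R) :
    FIOData X S m R' φ a b A where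
  phase := h.phase
  one_le := h.one_le
  phase_le k hk := h.phase_le k (hk.trans hR)
  det_le := h.det_le
  smooth := h.smooth
  support := h.support
  amp := ⟨h.amp.1, fun w hw ξ => (h.amp.2 w hw ξ).mono hR le_rfl⟩

theorem FIOData.support_compact {m R : ℕ} {φ : Euc n → Euc n → Euc n → ℝ}
    {a : Euc n → Euc n → Euc n → ℂ} {b A : ℝ} (h : FIOData X S m R φ a b A)
    (hS : S ⊆ X ×ˢ K) : ∀ x ∈ X, ∀ y ∈ X, y ∉ K → ∀ ξ, a x y ξ = 0 :=
  fun x hx y hy hyK => h.support x hx y hy fun h => hyK (hS h).2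

theorem exists_fioKernel_bound (hX : IsOpen X) (hKX : K ⊆ X) (hS : S ⊆ X ×ˢ K) (k m q : ℕ) :
    ∃ C : ℝ, ∃ Q R : ℕ, 0 ≤ C ∧ ∀ {φ : Euc n → Euc n → Euc n → ℝ}
      {a : Euc n → Euc n → Euc n → ℂ} {b A : ℝ} {u : Euc n → ℂ},
      FIOData X S m (R + 3) φ a b A → ContDiffOn ℝ ∞ u X → ∀ w ∈ X ×ˢ X, ∀ ξ ≠ 0,
      JetLE k (fioKernel φ a u (k + m + q) ξ) w
        (C * b ^ Q * A * (((1 + ‖ξ‖) ^ q)⁻¹ * jetSum R u w.2)) := by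
  obtain ⟨C₁, Q₁, hC₁, h₁⟩ := exists_jetLE_fioKernel n k m q
  obtain ⟨C₂, Q₂, hC₂, h₂⟩ := exists_phaseBound n (k + (k + m + q) + 1)
  refine ⟨C₁ * C₂ ^ Q₁, Q₂ * Q₁, k + (k + m + q), by positivity, ?_⟩
  intro φ a b A u h hu w hw ξ hξ
  have hPB := h₂ hX h.phase (hS.trans (Set.prod_mono_right hKX)) h.one_le h.phase_le h.det_le
  have := h₁ hX h.phase hPB h.smooth h.support (h.mono (by omega)).amp hu w hw ξ hξ
  refine this.mono le_rfl (le_of_eq ?_)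
  rw [mul_pow, ← pow_mul]
  ring

/-- The derivatives of `Tu` of order at most `N` are bounded by finitely many derivatives of `u`,
with a constant polynomial in the bounds for the phase and linear in those for the amplitude. -/
theorem exists_fio_bound (hn : 1 ≤ n) (hp : 1 ≤ p) (hX : IsOpen X) (hXb : Bornology.IsBounded X)
    (hK : IsCompact K) (hKX : K ⊆ X) (hS : S ⊆ X ×ˢ K) (m N : ℕ) :
    ∃ C : ℝ, ∃ Q R : ℕ, 0 ≤ C ∧ ∀ {φ : Euc n → Euc n → Euc n → ℝ}
      {a : Euc n → Euc n → Euc n → ℂ} {b A : ℝ} {u : Euc n → ℂ},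
      FIOData X S m R φ a b A → MemLpSmooth X p u →
      ContDiffOn ℝ N (fio X φ a u) X ∧
        (∀ j ≤ N, ∀ x ∈ X, ‖iteratedFDeriv ℝ j (fio X φ a u) x‖ ≤
          C * b ^ Q * A * sobSum X p R u) ∧
        ∀ x ∈ X, Integrable fun ξ => ∫ y in X, integrand φ a u x ξ y := by
  obtain ⟨C₁, Q, R, hC₁, h₁⟩ := exists_fioKernel_bound hX hKX hS (N + 1) m (n + 1)
  obtain ⟨C₃, hC₃, h₃⟩ := exists_setIntegral_jetSum_le (n := n) hp hXb
  have hW := weightInt_nonneg n (n + 1)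
  refine ⟨C₁ * weightInt n (n + 1) * C₃, Q, R + 3, by positivity, ?_⟩
  intro φ a b A u h hu
  obtain ⟨e1, e2, e3⟩ := fio_estimate hn hX hK hKX h.phase h.smooth (h.support_compact hS) hu.1
    (integrableOn_jetSum hp hXb hu R) le_rfl (h₁ h hu.1)
  refine ⟨e1, fun j hj x hx => (e2 j hj x hx).trans ?_, e3⟩
  have hA := h.amp.1
  have hb : 0 ≤ b := zero_le_one.trans h.one_le
  calc _ ≤ C₁ * b ^ Q * A * weightInt n (n + 1) * (C₃ * sobSum X p R u) := by
        gcongr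
        exact h₃ u hu R
    _ = C₁ * weightInt n (n + 1) * C₃ * b ^ Q * A * sobSum X p R u := by ring
    _ ≤ _ := by
        gcongr
        exact sobSum_mono (by omega) u

/-- The operator in the form that serves null families: for small `h` the derivatives of `u`, which
are only moderate, carry the factor `h`, while the power of `h⁻¹` meets only `‖u‖_{L^p(X)}`. -/
theorem exists_fio_interpolation (hn : 1 ≤ n) (hp : 1 ≤ p) (hX : IsOpen X)
    (hXb : Bornology.IsBounded X) (hK : IsCompact K) (hKX : K ⊆ X) (hS : S ⊆ X ×ˢ K) (m : ℕ) :
    ∃ C : ℝ, ∃ Q R e : ℕ, 0 ≤ C ∧ ∀ {φ : Euc n → Euc n → Euc n → ℝ}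
      {a : Euc n → Euc n → Euc n → ℂ} {b A : ℝ} {u : Euc n → ℂ},
      FIOData X S m R φ a b A → MemLpSmooth X p u → ∀ h : ℝ, 0 < h → ∀ x ∈ X,
        ‖fio X φ a u x‖ ≤ C * b ^ Q * A * (h * sobSum X p R u + h⁻¹ ^ e * derivNorm X p 0 u) := by
  obtain ⟨C₁, Q, R, hC₁, h₁⟩ := exists_fioKernel_bound hX hKX hS 0 m (n + 2)
  obtain ⟨C₃, hC₃, h₃⟩ := exists_setIntegral_jetSum_le (n := n) hp hXb
  have hW := weightInt_nonneg n (n + 1)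
  refine ⟨weightInt n (n + 1) * C₃ * (C₁ + 1), Q, R + 3, m + (n + 1), by positivity, ?_⟩
  intro φ a b A u h hu r hr x hx
  have hA := h.amp.1
  have hb : 0 ≤ b := zero_le_one.trans h.one_le
  have huint : IntegrableOn u X := integrableOn_of_memLp hp hXb
    ((memLp_congr_norm ((hu.1.continuousOn).aestronglyMeasurable hX.measurableSet) (hu.2 0).1
      (Eventually.of_forall fun y => by simp)).2 (hu.2 0))
  have h0 : ∫ y in X, ‖u y‖ ≤ C₃ * derivNorm X p 0 u := by
    simpa [jetSum] using h₃ u hu 0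
  have hbQ : 1 ≤ b ^ Q := one_le_pow₀ h.one_le
  have hs := sobSum_nonneg X p (R + 3) u
  have hd := derivNorm_nonneg X p 0 u
  refine (norm_fio_le_interpolation hn hX hK hKX h.phase h.smooth (h.support_compact hS) hu.1
    (integrableOn_jetSum hp hXb hu R) huint (h.mono (by omega)).amp (by positivity) (h₁ h hu.1) hr
    hx).trans ?_
  calc _ ≤ weightInt n (n + 1) * (r * (C₁ * b ^ Q * A * (C₃ * sobSum X p (R + 3) u)) +
          r⁻¹ ^ (m + (n + 1)) * (A * (C₃ * derivNorm X p 0 u))) := by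
        gcongr
        exact (h₃ u hu R).trans (mul_le_mul_of_nonneg_left (sobSum_mono (by omega) u) hC₃)
    _ = weightInt n (n + 1) * C₃ * A * (C₁ * b ^ Q * (r * sobSum X p (R + 3) u) +
          1 * (r⁻¹ ^ (m + (n + 1)) * derivNorm X p 0 u)) := by ring
    _ ≤ weightInt n (n + 1) * C₃ * A * ((C₁ + 1) * b ^ Q * (r * sobSum X p (R + 3) u) +
          (C₁ + 1) * b ^ Q * (r⁻¹ ^ (m + (n + 1)) * derivNorm X p 0 u)) := by
        gcongr
        · linarith
        · nlinarith
    _ = _ := by ring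

end Estimates

/-! ### Growth of nets -/

/-- A class of nets containing the constants and closed under sums and domination. -/
structure IsNetClass (𝒞 : Set (Eps → ℝ)) : Prop where
  one_mem : (fun _ => (1 : ℝ)) ∈ 𝒞
  add_mem : ∀ {f g : Eps → ℝ}, f ∈ 𝒞 → g ∈ 𝒞 → (fun ε => f ε + g ε) ∈ 𝒞
  of_isBigO : ∀ {f g : Eps → ℝ}, g ∈ 𝒞 → f =O[toZero] g → f ∈ 𝒞

/-- Nets of growth `O(ε^{-N})`. -/
def growthNets (N : ℕ) : Set (Eps → ℝ) := {f | f =O[toZero] fun ε => (ε : ℝ) ^ (-(N : ℤ))}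

/-- Nets of moderate growth. -/
def moderateNets : Set (Eps → ℝ) := {f | ∃ N, f ∈ growthNets N}

theorem isBigO_zpow_zpow {b c : ℤ} (h : c ≤ b) :
    (fun ε : Eps => (ε : ℝ) ^ b) =O[toZero] fun ε => (ε : ℝ) ^ c :=
  IsBigO.of_bound 1 (Eventually.of_forall fun ε => by
    rw [one_mul, Real.norm_of_nonneg (zpow_nonneg ε.2.1.le _),
      Real.norm_of_nonneg (zpow_nonneg ε.2.1.le _)]
    exact zpow_le_zpow_right_of_le_one₀ ε.2.1 ε.2.2 h)

theorem zpow_mul_zpow_eps (b c : ℤ) :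
    (fun ε : Eps => (ε : ℝ) ^ b * (ε : ℝ) ^ c) = fun ε : Eps => (ε : ℝ) ^ (b + c) :=
  funext fun ε => (zpow_add₀ ε.2.1.ne' b c).symm

theorem growthNets_mono {N N' : ℕ} (h : N ≤ N') : growthNets N ⊆ growthNets N' :=
  fun _ hf => IsBigO.trans hf (isBigO_zpow_zpow (by omega))

theorem mul_mem_growthNets {f g : Eps → ℝ} {N N' : ℕ} (hf : f ∈ growthNets N)
    (hg : g ∈ growthNets N') : (fun ε => f ε * g ε) ∈ growthNets (N + N') := by
  have := IsBigO.mul hf hg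
  rw [zpow_mul_zpow_eps] at this
  refine this.trans (isBigO_zpow_zpow ?_)
  push_cast
  omega

theorem isNetClass_growthNets (N : ℕ) : IsNetClass (growthNets N) where
  one_mem := by
    have := isBigO_zpow_zpow (b := 0) (c := -(N : ℤ)) (by omega)
    simp only [zpow_zero] at this
    exact this
  add_mem := IsBigO.add
  of_isBigO hg hf := IsBigO.trans hf hg

theorem isNetClass_moderateNets : IsNetClass moderateNets where
  one_mem := ⟨0, (isNetClass_growthNets 0).one_mem⟩
  add_mem := by
    rintro f g ⟨N, hf⟩ ⟨N', hg⟩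
    exact ⟨max N N', (isNetClass_growthNets _).add_mem (growthNets_mono (le_max_left _ _) hf)
      (growthNets_mono (le_max_right _ _) hg)⟩
  of_isBigO := fun ⟨N, hg⟩ hf => ⟨N, IsBigO.trans hf hg⟩

theorem mul_mem_moderateNets {f g : Eps → ℝ} (hf : f ∈ moderateNets) (hg : g ∈ moderateNets) :
    (fun ε => f ε * g ε) ∈ moderateNets := by
  obtain ⟨N, hf⟩ := hf
  obtain ⟨N', hg⟩ := hg
  exact ⟨N + N', mul_mem_growthNets hf hg⟩

theorem pow_mem_moderateNets {f : Eps → ℝ} (hf : f ∈ moderateNets) (q : ℕ) :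
    (fun ε => f ε ^ q) ∈ moderateNets := by
  induction q with
  | zero => simpa using isNetClass_moderateNets.one_mem
  | succ q ih => simpa only [pow_succ] using mul_mem_moderateNets ih hf

theorem isNetClass_slowScale : IsNetClass {s | IsSlowScale s} where
  one_mem := fun q => by
    have := isBigO_zpow_zpow (b := 0) (c := -1) (by omega)
    simpa [zpow_neg_one] using this
  add_mem := by
    intro f g hf hg q
    refine IsBigO.trans (g := fun ε => |f ε| ^ q + |g ε| ^ q) ?_ ((hf q).add (hg q))
    refine IsBigO.of_bound (2 ^ q) (Eventually.of_forall fun ε => ?_)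
    rw [Real.norm_of_nonneg (by positivity), Real.norm_of_nonneg (by positivity)]
    have h1 : |f ε + g ε| ≤ 2 * max |f ε| |g ε| := by
      have h2 := le_max_left |f ε| |g ε|
      have h3 := le_max_right |f ε| |g ε|
      linarith [abs_add_le (f ε) (g ε)]
    calc |f ε + g ε| ^ q ≤ (2 * max |f ε| |g ε|) ^ q := pow_le_pow_left₀ (abs_nonneg _) h1 q
      _ = 2 ^ q * max |f ε| |g ε| ^ q := mul_pow _ _ _
      _ ≤ _ := by
        gcongr
        rcases max_choice |f ε| |g ε| with h | h <;> rw [h]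
        · exact le_add_of_nonneg_right (by positivity)
        · exact le_add_of_nonneg_left (by positivity)
  of_isBigO := by
    intro f g hg hf q
    refine IsBigO.trans ?_ (hg q)
    exact hf.abs_left.abs_right.pow q

theorem IsNetClass.sum_mem {𝒞 : Set (Eps → ℝ)} (h : IsNetClass 𝒞) {f : ℕ → Eps → ℝ}
    (hf : ∀ k, f k ∈ 𝒞) (R : ℕ) : (fun ε => ∑ k ∈ Finset.range R, f k ε) ∈ 𝒞 := by
  induction R with
  | zero =>
    refine h.of_isBigO h.one_mem ?_
    simp only [Finset.range_zero, Finset.sum_empty]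
    exact isBigO_zero (fun _ : Eps => (1 : ℝ)) toZero
  | succ R ih => simpa only [Finset.sum_range_succ] using h.add_mem ih (hf R)

/-- A bound that is finite for every `ε` and `O(g_ε)` as `ε → 0` is a bound by a net that holds for
every `ε`. -/
theorem SupBigO.exists_net {α : Type*} {s : Set α} {f : Eps → α → ℝ} {g : Eps → ℝ}
    {𝒞 : Set (Eps → ℝ)} (h𝒞 : IsNetClass 𝒞) (hg : g ∈ 𝒞) (h : SupBigO s f g) :
    ∃ b ∈ 𝒞, (∀ ε, 0 ≤ b ε) ∧ ∀ ε, ∀ z ∈ s, f ε z ≤ b ε := by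
  obtain ⟨h1, C, h2⟩ := h
  choose c hc using h1
  classical
  refine ⟨fun ε => if ∀ z ∈ s, f ε z ≤ C * g ε then |C * g ε| else |c ε|,
    h𝒞.of_isBigO hg ?_, fun ε => ?_, fun ε z hz => ?_⟩
  · refine IsBigO.of_bound |C| (h2.mono fun ε hε => ?_)
    rw [if_pos hε, norm_abs_eq_norm, norm_mul, Real.norm_eq_abs]
  · dsimp only
    split_ifs <;> positivity
  · dsimp only
    split_ifs with hε
    · exact (hε z hz).trans (le_abs_self _)
    · exact (hc ε z hz).trans (le_abs_self _)

/-- The bounds for the phase, collected into a single net. -/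
theorem exists_phase_net {n : ℕ} {S : Set (Euc n × Euc n)}
    {φ : Eps → Euc n → Euc n → Euc n → ℝ} {𝒞 : Set (Eps → ℝ)} (h𝒞 : IsNetClass 𝒞)
    (h1 : ∀ k : ℕ, ∃ g ∈ 𝒞, SupBigO (overSphere S)
      (fun ε z => ‖iteratedFDeriv ℝ k (uncurry₃ (φ ε)) z‖) g)
    (h2 : ∃ g ∈ 𝒞, SupBigO (overSphere S)
      (fun ε z => |(uncurry₃ (mixedHessian (φ ε)) z).det|⁻¹) g) (R : ℕ) :
    ∃ b ∈ 𝒞, ∀ ε, 1 ≤ b ε ∧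
      (∀ k ≤ R, ∀ z ∈ overSphere S, ‖iteratedFDeriv ℝ k (uncurry₃ (φ ε)) z‖ ≤ b ε) ∧
      ∀ z ∈ overSphere S, |(uncurry₃ (mixedHessian (φ ε)) z).det|⁻¹ ≤ b ε := by
  choose g hg hsup using h1
  choose b hb hb0 hbs using fun k => (hsup k).exists_net h𝒞 (hg k)
  obtain ⟨g', hg', hsup'⟩ := h2
  obtain ⟨d, hd, hd0, hds⟩ := hsup'.exists_net h𝒞 hg'
  have hs0 : ∀ ε, 0 ≤ ∑ k ∈ Finset.range (R + 1), b k ε := fun ε =>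
    Finset.sum_nonneg fun k _ => hb0 k ε
  refine ⟨fun ε => (1 + ∑ k ∈ Finset.range (R + 1), b k ε) + d ε,
    h𝒞.add_mem (h𝒞.add_mem h𝒞.one_mem (h𝒞.sum_mem hb _)) hd, fun ε => ⟨?_, fun k hk z hz => ?_,
    fun z hz => ?_⟩⟩
  · linarith [hs0 ε, hd0 ε]
  · have := Finset.single_le_sum (f := fun k => b k ε) (fun k _ => hb0 k ε)
      (Finset.mem_range.2 (Nat.lt_succ_of_le hk))
    linarith [hbs k ε z hz, hd0 ε]
  · linarith [hds ε z hz, hs0 ε]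

theorem exists_amp_net {n : ℕ} {X : Set (Euc n)} {μ : ℝ} {m : ℕ} (hm : μ ≤ m)
    {a : Eps → Euc n → Euc n → Euc n → ℂ} {𝒞 : Set (Eps → ℝ)} (h𝒞 : IsNetClass 𝒞)
    (h : ∀ k : ℕ, ∃ g ∈ 𝒞, SupBigO (X ×ˢ X ×ˢ Set.univ) (fun ε => symbolSize μ k 0 (a ε)) g)
    (R : ℕ) : ∃ A ∈ 𝒞, ∀ ε, AmpBound X (a ε) m R (A ε) := by
  choose g hg hsup using h
  choose b hb hb0 hbs using fun k => (hsup k).exists_net h𝒞 (hg k)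
  refine ⟨fun ε => ∑ k ∈ Finset.range (R + 1), b k ε, h𝒞.sum_mem hb _, fun ε =>
    ⟨Finset.sum_nonneg fun k _ => hb0 k ε, fun w hw ξ k hk => ?_⟩⟩
  have h1 := hbs k ε (w.1, w.2, ξ) ⟨hw.1, hw.2, trivial⟩
  have h2 : b k ε ≤ ∑ k ∈ Finset.range (R + 1), b k ε :=
    Finset.single_le_sum (f := fun k => b k ε) (fun k _ => hb0 k ε)
      (Finset.mem_range.2 (Nat.lt_succ_of_le hk))
  have hpos : (0 : ℝ) < 1 + ‖ξ‖ := by positivity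
  simp only [symbolSize, norm_iteratedFDeriv_zero, Nat.cast_zero, zero_sub] at h1
  rw [Real.rpow_neg hpos.le, inv_mul_le_iff₀ (by positivity)] at h1
  have h3 : (1 + ‖ξ‖) ^ μ ≤ (1 + ‖ξ‖) ^ m := by
    rw [← Real.rpow_natCast]
    exact Real.rpow_le_rpow_of_exponent_le (by linarith [norm_nonneg ξ]) hm
  have h4 := hb0 k ε
  calc _ ≤ (1 + ‖ξ‖) ^ μ * b k ε := h1
    _ ≤ (1 + ‖ξ‖) ^ m * ∑ k ∈ Finset.range (R + 1), b k ε := by gcongr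
    _ = _ := mul_comm _ _

/-! ### The operator on families -/

section Families

variable {n : ℕ} {X K : Set (Euc n)} {S : Set (Euc n × Euc n)} {p : ℝ≥0∞} {m : ℕ}
  {φ : Eps → Euc n → Euc n → Euc n → ℝ} {a : Eps → Euc n → Euc n → Euc n → ℂ}

/-- The phases and amplitudes satisfy the bounds of every order `R`, with nets of the classes `𝒬`
and `𝒜`. -/
def FIOFamily (X : Set (Euc n)) (S : Set (Euc n × Euc n)) (m : ℕ)
    (φ : Eps → Euc n → Euc n → Euc n → ℝ) (a : Eps → Euc n → Euc n → Euc n → ℂ)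
    (𝒬 𝒜 : Set (Eps → ℝ)) : Prop :=
  ∀ R : ℕ, ∃ b ∈ 𝒬, ∃ A ∈ 𝒜, ∀ ε, FIOData X S m R (φ ε) (a ε) (b ε) (A ε)

theorem IsGenAmplitude.fioFamily {μ : ℝ} (hm : μ ≤ m) (hφ : ∀ ε, IsPhase X (φ ε))
    (ha : IsGenAmplitude X S μ a) {𝒬 𝒜 : Set (Eps → ℝ)} (h𝒬 : IsNetClass 𝒬) (h𝒜 : IsNetClass 𝒜)
    (h1 : ∀ k : ℕ, ∃ g ∈ 𝒬, SupBigO (overSphere S)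
      (fun ε z => ‖iteratedFDeriv ℝ k (uncurry₃ (φ ε)) z‖) g)
    (h2 : ∃ g ∈ 𝒬, SupBigO (overSphere S)
      (fun ε z => |(uncurry₃ (mixedHessian (φ ε)) z).det|⁻¹) g)
    (h3 : ∀ k : ℕ, ∃ g ∈ 𝒜, SupBigO (X ×ˢ X ×ˢ Set.univ) (fun ε => symbolSize μ k 0 (a ε)) g) :
    FIOFamily X S m φ a 𝒬 𝒜 := fun R => by
  obtain ⟨b, hb, hb'⟩ := exists_phase_net h𝒬 h1 h2 R
  obtain ⟨A, hA, hA'⟩ := exists_amp_net hm h𝒜 h3 R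
  exact ⟨b, hb, A, hA, fun ε => ⟨hφ ε, (hb' ε).1, (hb' ε).2.1, (hb' ε).2.2, ha.smooth ε,
    ha.support ε, hA' ε⟩⟩

/-- The operators are bounded from finitely many derivatives to finitely many derivatives, with
norms in the class `𝒢`. -/
def FIOBounded (X : Set (Euc n)) (p : ℝ≥0∞) (φ : Eps → Euc n → Euc n → Euc n → ℝ)
    (a : Eps → Euc n → Euc n → Euc n → ℂ) (𝒢 : Set (Eps → ℝ)) : Prop :=
  ∀ k : ℕ, ∃ R : ℕ, ∃ G ∈ 𝒢, ∀ ε, ∀ u : Euc n → ℂ, MemLpSmooth X p u → ∀ j ≤ k,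
    derivNorm X p j (fio X (φ ε) (a ε) u) ≤ G ε * sobSum X p R u

theorem FIOFamily.bounded (hn : 1 ≤ n) (hp : 1 ≤ p) (hX : IsOpen X) (hXb : Bornology.IsBounded X)
    (hK : IsCompact K) (hKX : K ⊆ X) (hS : S ⊆ X ×ˢ K) {𝒬 𝒜 𝒢 : Set (Eps → ℝ)}
    (hF : FIOFamily X S m φ a 𝒬 𝒜)
    (h𝒢 : ∀ b ∈ 𝒬, ∀ A ∈ 𝒜, ∀ Q : ℕ, ∀ c : ℝ, (fun ε => c * (b ε ^ Q * A ε)) ∈ 𝒢) :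
    FIOBounded X p φ a 𝒢 := fun k => by
  obtain ⟨C, Q, R, hC, h⟩ := exists_fio_bound (p := p) hn hp hX hXb hK hKX hS m k
  obtain ⟨b, hb, A, hA, hd⟩ := hF R
  obtain ⟨C', hC', h'⟩ := exists_derivNorm_le p hX hXb
  refine ⟨R, _, h𝒢 b hb A hA Q (C' * C), fun ε u hu j hj => ?_⟩
  have h1 := (h (hd ε) hu).2.1 j hj
  have hA0 := (hd ε).amp.1
  have hb0 : 0 ≤ b ε := zero_le_one.trans (hd ε).one_le
  have hs := sobSum_nonneg X p R u
  refine (h' _ j _ (by positivity) h1).trans (le_of_eq ?_)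
  ring

theorem FIOFamily.memLpSmooth (hn : 1 ≤ n) (hp : 1 ≤ p) (hX : IsOpen X)
    (hXb : Bornology.IsBounded X) (hK : IsCompact K) (hKX : K ⊆ X) (hS : S ⊆ X ×ˢ K)
    {𝒬 𝒜 : Set (Eps → ℝ)} (hF : FIOFamily X S m φ a 𝒬 𝒜) (ε : Eps) {u : Euc n → ℂ}
    (hu : MemLpSmooth X p u) : MemLpSmooth X p (fio X (φ ε) (a ε) u) := by
  have h : ∀ N : ℕ, ContDiffOn ℝ N (fio X (φ ε) (a ε) u) X ∧
      ∃ b, ∀ x ∈ X, ‖iteratedFDeriv ℝ N (fio X (φ ε) (a ε) u) x‖ ≤ b := fun N => by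
    obtain ⟨C, Q, R, -, h⟩ := exists_fio_bound (p := p) hn hp hX hXb hK hKX hS m N
    obtain ⟨b, -, A, -, hd⟩ := hF R
    exact ⟨(h (hd ε) hu).1, _, (h (hd ε) hu).2.1 N le_rfl⟩
  exact memLpSmooth_of_bounded hX hXb (contDiffOn_infty.2 fun N => (h N).1) fun k => (h k).2

theorem FIOFamily.integrable (hn : 1 ≤ n) (hp : 1 ≤ p) (hX : IsOpen X)
    (hXb : Bornology.IsBounded X) (hK : IsCompact K) (hKX : K ⊆ X) (hS : S ⊆ X ×ˢ K)
    {𝒬 𝒜 : Set (Eps → ℝ)} (hF : FIOFamily X S m φ a 𝒬 𝒜) (ε : Eps) {u : Euc n → ℂ}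
    (hu : MemLpSmooth X p u) {x : Euc n} (hx : x ∈ X) :
    (∀ ξ ≠ 0, IntegrableOn (integrand (φ ε) (a ε) u x ξ) X) ∧
      Integrable fun ξ => ∫ y in X, integrand (φ ε) (a ε) u x ξ y := by
  obtain ⟨C, Q, R, -, h⟩ := exists_fio_bound (p := p) hn hp hX hXb hK hKX hS m 0
  obtain ⟨b, -, A, -, hd⟩ := hF R
  exact ⟨fun ξ hξ => integrableOn_integrand hX hK hKX (hd ε).phase (hd ε).smooth
    ((hd ε).support_compact hS) hu.1 hξ hx, (h (hd ε) hu).2.2 x hx⟩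

theorem FIOFamily.fio_add (hn : 1 ≤ n) (hp : 1 ≤ p) (hX : IsOpen X)
    (hXb : Bornology.IsBounded X) (hK : IsCompact K) (hKX : K ⊆ X) (hS : S ⊆ X ×ˢ K)
    {𝒬 𝒜 : Set (Eps → ℝ)} (hF : FIOFamily X S m φ a 𝒬 𝒜) (ε : Eps) {u v : Euc n → ℂ}
    (hu : MemLpSmooth X p u) (hv : MemLpSmooth X p v) {x : Euc n} (hx : x ∈ X) :
    fio X (φ ε) (a ε) (u + v) x = fio X (φ ε) (a ε) u x + fio X (φ ε) (a ε) v x := by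
  have : Nonempty (Fin n) := ⟨⟨0, hn⟩⟩
  obtain ⟨hu1, hu2⟩ := hF.integrable hn hp hX hXb hK hKX hS ε hu hx
  obtain ⟨hv1, hv2⟩ := hF.integrable hn hp hX hXb hK hKX hS ε hv hx
  rw [fio, fio, fio, ← mul_add, ← integral_add hu2 hv2]
  congr 1
  have h0 : ∀ᵐ ξ : Euc n, ξ ∈ ({0}ᶜ : Set (Euc n)) := compl_mem_ae_iff.2 (by simp)
  refine integral_congr_ae (h0.mono fun ξ hξ => ?_)
  dsimp only
  rw [← integral_add (hu1 ξ hξ) (hv1 ξ hξ)]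
  congr 1
  funext y
  simp [integrand, mul_add]

theorem fio_smul (φ : Euc n → Euc n → Euc n → ℝ) (a : Euc n → Euc n → Euc n → ℂ) (c : ℂ)
    (u : Euc n → ℂ) : fio X φ a (c • u) = c • fio X φ a u := by
  funext x
  have h : ∀ ξ y, integrand φ a (c • u) x ξ y = c * integrand φ a u x ξ y := fun ξ y => by
    simp only [integrand, Pi.smul_apply, smul_eq_mul]
    ring
  simp only [fio, h, integral_const_mul, Pi.smul_apply, smul_eq_mul]
  ring

/-- The families whose members vanish on `X` are null, whatever their values off `X`. -/
theorem mem_null_of_eqOn_zero (hX : IsOpen X) (hp : 1 ≤ p) {w : Eps → Euc n → ℂ}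
    (hw : ∀ ε, Set.EqOn (w ε) 0 X) : w ∈ null X hX p hp := by
  have h1 : ∀ ε k, iteratedFDeriv ℝ k (w ε) =ᵐ[volume.restrict X] 0 := fun ε k => by
    refine (ae_restrict_iff' hX.measurableSet).2 (Eventually.of_forall fun x hx => ?_)
    rw [(((hw ε).eventuallyEq_of_mem (hX.mem_nhds hx)).iteratedFDeriv ℝ k).eq_of_nhds]
    simp [show iteratedFDeriv ℝ k (0 : Euc n → ℂ) = 0 from iteratedFDeriv_zero]
  have h2 : ∀ ε, MemLpSmooth X p (w ε) := fun ε =>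
    ⟨contDiffOn_const.congr (hw ε), fun k => (memLp_congr_ae (h1 ε k)).2 MemLp.zero⟩
  have h3 : ∀ k b, DerivO X p k b w := fun k b => by
    have : (fun ε => derivNorm X p k (w ε)) = fun _ => 0 := funext fun ε => by
      simp [derivNorm, eLpNorm_congr_ae (h1 ε k)]
    rw [DerivO, this]
    exact isBigO_zero _ _
  exact ⟨⟨h2, fun k => ⟨0, h3 k _⟩⟩, fun N => h3 0 _⟩

theorem sobSum_isBigO {R : ℕ} {c : ℤ} {w : Eps → Euc n → ℂ} (hw : ∀ j ≤ R, DerivO X p j c w) :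
    (fun ε => sobSum X p R (w ε)) =O[toZero] fun ε => (ε : ℝ) ^ c := by
  have h : (fun ε => sobSum X p R (w ε)) =
      ∑ j ∈ Finset.range (R + 1), fun ε => derivNorm X p j (w ε) := by
    funext ε
    simp [sobSum]
  rw [h]
  exact IsBigO.sum fun j hj => hw j (Nat.lt_succ_iff.1 (Finset.mem_range.1 hj))

/-- Operator norms of growth `ε^{-N}` cost `N` in the exponent. -/
theorem derivO_genFIO {k R N : ℕ} {c : ℤ} {G : Eps → ℝ} (hG : G ∈ growthNets N)
    (hb : ∀ ε, ∀ u : Euc n → ℂ, MemLpSmooth X p u → ∀ j ≤ k,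
      derivNorm X p j (fio X (φ ε) (a ε) u) ≤ G ε * sobSum X p R u)
    {w : Eps → Euc n → ℂ} (hw : ∀ ε, MemLpSmooth X p (w ε)) (hwc : ∀ j ≤ R, DerivO X p j c w)
    {j : ℕ} (hj : j ≤ k) {d : ℤ} (hd : d ≤ c - N) : DerivO X p j d (genFIO X φ a w) := by
  have h1 : (fun ε => G ε * sobSum X p R (w ε)) =O[toZero] fun ε => (ε : ℝ) ^ (-(N : ℤ) + c) := by
    rw [← zpow_mul_zpow_eps]
    exact IsBigO.mul hG (sobSum_isBigO hwc)
  refine IsBigO.trans (IsBigO.of_bound 1 (Eventually.of_forall fun ε => ?_))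
    (h1.trans (isBigO_zpow_zpow (c := d) (by omega)))
  rw [one_mul, Real.norm_of_nonneg (derivNorm_nonneg _ _ _ _)]
  exact (hb ε (w ε) (hw ε) j hj).trans (Real.le_norm_self _)

theorem exists_derivO_le {u : Eps → Euc n → ℂ} (hu : ∀ k : ℕ, ∃ N : ℕ, DerivO X p k (-(N : ℤ)) u)
    (R : ℕ) : ∃ N : ℕ, ∀ j ≤ R, DerivO X p j (-(N : ℤ)) u := by
  choose N hN using hu
  refine ⟨∑ j ∈ Finset.range (R + 1), N j, fun j hj => (hN j).mono ?_⟩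
  have : N j ≤ ∑ i ∈ Finset.range (R + 1), N i :=
    Finset.single_le_sum (fun _ _ => Nat.zero_le _) (Finset.mem_range.2 (by omega))
  omega

theorem FIOBounded.moderate_mem (hX : IsOpen X) (hp : 1 ≤ p) (hb : FIOBounded X p φ a moderateNets)
    (hmem : ∀ ε, ∀ u : Euc n → ℂ, MemLpSmooth X p u → MemLpSmooth X p (fio X (φ ε) (a ε) u))
    {u : Eps → Euc n → ℂ} (hu : u ∈ moderate X hX p hp) : genFIO X φ a u ∈ moderate X hX p hp := by
  refine ⟨fun ε => hmem ε _ (hu.1 ε), fun k => ?_⟩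
  obtain ⟨R, G, ⟨N, hG⟩, h⟩ := hb k
  obtain ⟨N', hN'⟩ := exists_derivO_le hu.2 R
  exact ⟨N + N', derivO_genFIO hG h hu.1 hN' le_rfl (by push_cast; omega)⟩

/-- The growth class of the norms must be the same for all orders of derivatives. -/
theorem FIOBounded.regular_mem (hX : IsOpen X) (hp : 1 ≤ p) {N : ℕ}
    (hb : FIOBounded X p φ a (growthNets N))
    (hmem : ∀ ε, ∀ u : Euc n → ℂ, MemLpSmooth X p u → MemLpSmooth X p (fio X (φ ε) (a ε) u))
    {u : Eps → Euc n → ℂ} (hu : u ∈ regular X hX p hp) : genFIO X φ a u ∈ regular X hX p hp := by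
  obtain ⟨hu1, N', hN'⟩ := hu
  refine ⟨fun ε => hmem ε _ (hu1 ε), N + N', fun k => ?_⟩
  obtain ⟨R, G, hG, h⟩ := hb k
  exact derivO_genFIO hG h hu1 (fun j _ => hN' j) le_rfl (by push_cast; omega)

/-- Null families are mapped to null families: cut the frequencies at a power `ε^{-L}` that is large
compared with the growth of the derivatives of the family. -/
theorem FIOFamily.null_mem (hn : 1 ≤ n) (hp : 1 ≤ p) (hX : IsOpen X)
    (hXb : Bornology.IsBounded X) (hK : IsCompact K) (hKX : K ⊆ X) (hS : S ⊆ X ×ˢ K)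
    (hF : FIOFamily X S m φ a moderateNets moderateNets)
    (hmod : ∀ u ∈ moderate X hX p hp, genFIO X φ a u ∈ moderate X hX p hp)
    {u : Eps → Euc n → ℂ} (hu : u ∈ null X hX p hp) : genFIO X φ a u ∈ null X hX p hp := by
  refine ⟨hmod u hu.1, fun N => ?_⟩
  obtain ⟨C, Q, R, e, hC, h⟩ := exists_fio_interpolation (p := p) hn hp hX hXb hK hKX hS m
  obtain ⟨b, hb, A, hA, hd⟩ := hF R
  obtain ⟨C', hC', h'⟩ := exists_derivNorm_le p hX hXb
  obtain ⟨N₁, hN₁⟩ := mul_mem_moderateNets (pow_mem_moderateNets hb Q) hA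
  obtain ⟨N₂, hN₂⟩ := exists_derivO_le hu.1.2 R
  -- `ε^L` absorbs the constant, of growth `ε^{-N₁}`, and the derivatives, of growth `ε^{-N₂}`
  set L : ℕ := N + N₁ + N₂ with hL
  set f : Eps → ℝ := fun ε => (b ε ^ Q * A ε) * ((ε : ℝ) ^ (L : ℤ) * sobSum X p R (u ε) +
    (ε : ℝ) ^ (-((L * e : ℕ) : ℤ)) * derivNorm X p 0 (u ε)) with hf
  have h1 : (fun ε : Eps => (ε : ℝ) ^ (L : ℤ) * sobSum X p R (u ε)) =O[toZero]
      fun ε => (ε : ℝ) ^ ((N + N₁ : ℕ) : ℤ) := by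
    have := (isBigO_refl (fun ε : Eps => (ε : ℝ) ^ (L : ℤ)) toZero).mul (sobSum_isBigO hN₂)
    rw [zpow_mul_zpow_eps] at this
    exact this.trans (isBigO_zpow_zpow (by push_cast; omega))
  have h2 : (fun ε : Eps => (ε : ℝ) ^ (-((L * e : ℕ) : ℤ)) * derivNorm X p 0 (u ε)) =O[toZero]
      fun ε => (ε : ℝ) ^ ((N + N₁ : ℕ) : ℤ) := by
    have := (isBigO_refl (fun ε : Eps => (ε : ℝ) ^ (-((L * e : ℕ) : ℤ))) toZero).mul
      (hu.2 (N + N₁ + L * e))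
    rw [zpow_mul_zpow_eps] at this
    exact this.trans (isBigO_zpow_zpow (by push_cast; linarith))
  have h3 : f =O[toZero] fun ε => (ε : ℝ) ^ (N : ℤ) := by
    have := IsBigO.mul hN₁ (h1.add h2)
    rw [zpow_mul_zpow_eps] at this
    exact this.trans (isBigO_zpow_zpow (by push_cast; linarith))
  refine IsBigO.trans (IsBigO.of_bound (C' * C) (Eventually.of_forall fun ε => ?_)) h3
  have hA0 := (hd ε).amp.1
  have hb0 : 0 ≤ b ε := zero_le_one.trans (hd ε).one_le
  have hs := sobSum_nonneg X p R (u ε)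
  have hd0 := derivNorm_nonneg X p 0 (u ε)
  have hε : (0 : ℝ) < ε := ε.2.1
  have h4 : ∀ x ∈ X, ‖iteratedFDeriv ℝ 0 (fio X (φ ε) (a ε) (u ε)) x‖ ≤ C * f ε := fun x hx => by
    rw [norm_iteratedFDeriv_zero]
    refine (h (hd ε) (hu.1.1 ε) ((ε : ℝ) ^ L) (by positivity) x hx).trans (le_of_eq ?_)
    simp only [hf, zpow_neg, zpow_natCast, inv_pow, pow_mul]
    ring
  have hf0 : 0 ≤ f ε := by positivity
  rw [Real.norm_of_nonneg (derivNorm_nonneg _ _ _ _), Real.norm_of_nonneg hf0, mul_assoc]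
  exact h' _ 0 _ (by positivity) h4

end Families

/-! ### Descent to the quotients -/

/-- A map that preserves two submodules and is linear modulo the smaller one descends to the
quotient. -/
theorem exists_quotient_map {V : Type*} [AddCommGroup V] [Module ℂ V] (E N : Submodule ℂ V)
    (T : V → V) (hE : ∀ u ∈ E, T u ∈ E) (hN : ∀ u ∈ E, u ∈ N → T u ∈ N)
    (hadd : ∀ u ∈ E, ∀ v ∈ E, T (u + v) - (T u + T v) ∈ N)
    (hsmul : ∀ (c : ℂ), ∀ u ∈ E, T (c • u) = c • T u) :
    ∃ L : (↥E ⧸ N.submoduleOf E) →ₗ[ℂ] (↥E ⧸ N.submoduleOf E), ∀ u : E,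
      L ((N.submoduleOf E).mkQ u) = (N.submoduleOf E).mkQ ⟨T u, hE u u.2⟩ := by
  let L₀ : ↥E →ₗ[ℂ] (↥E ⧸ N.submoduleOf E) :=
    { toFun := fun u => (N.submoduleOf E).mkQ ⟨T u, hE u u.2⟩
      map_add' := fun u v => by
        rw [← map_add]
        exact (Submodule.Quotient.eq _).2 (hadd u u.2 v v.2)
      map_smul' := fun c u => by
        rw [RingHom.id_apply, ← map_smul]
        congr 1
        exact Subtype.ext (hsmul c u u.2) }
  refine ⟨(N.submoduleOf E).liftQ L₀ fun u hu => ?_, fun u => rfl⟩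
  exact (Submodule.Quotient.mk_eq_zero _).2 (hN u u.2 hu)

section Main

variable {n : ℕ} {X K : Set (Euc n)} {S : Set (Euc n × Euc n)} {p : ℝ≥0∞} {m : ℕ}
  {φ : Eps → Euc n → Euc n → Euc n → ℝ} {a : Eps → Euc n → Euc n → Euc n → ℂ}

/-- Additivity holds only on `X`: off `X` the integrals need not converge, and what they are there
does not matter, since families that vanish on `X` are null. -/
theorem FIOFamily.add_sub_mem_null (hn : 1 ≤ n) (hp : 1 ≤ p) (hX : IsOpen X)
    (hXb : Bornology.IsBounded X) (hK : IsCompact K) (hKX : K ⊆ X) (hS : S ⊆ X ×ˢ K)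
    {𝒬 𝒜 : Set (Eps → ℝ)} (hF : FIOFamily X S m φ a 𝒬 𝒜) {u v : Eps → Euc n → ℂ}
    (hu : ∀ ε, MemLpSmooth X p (u ε)) (hv : ∀ ε, MemLpSmooth X p (v ε)) :
    genFIO X φ a (u + v) - (genFIO X φ a u + genFIO X φ a v) ∈ null X hX p hp :=
  mem_null_of_eqOn_zero hX hp fun ε x hx => by
    have := hF.fio_add hn hp hX hXb hK hKX hS ε (hu ε) (hv ε) hx
    simp [genFIO, this]

/-- Continuity: the neighbourhood of order `(k, m)` contains the image of the neighbourhood of order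
`(R, N + m)`, where `R` derivatives bound the first `k` derivatives of the image and `ε^{-N}` is the
growth of the operator norms. -/
theorem exists_colombeau_map (hp : 1 ≤ p) (hX : IsOpen X)
    (hmem : ∀ u ∈ moderate X hX p hp, genFIO X φ a u ∈ moderate X hX p hp)
    (hnull : ∀ u ∈ null X hX p hp, genFIO X φ a u ∈ null X hX p hp)
    (hadd : ∀ u ∈ moderate X hX p hp, ∀ v ∈ moderate X hX p hp,
      genFIO X φ a (u + v) - (genFIO X φ a u + genFIO X φ a v) ∈ null X hX p hp)
    (hb : FIOBounded X p φ a moderateNets) :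
    ∃ T : Colombeau X hX p hp →L[ℂ] Colombeau X hX p hp, ∀ u : moderate X hX p hp,
      ∃ h : genFIO X φ a u.1 ∈ moderate X hX p hp,
        T (Colombeau.mk X hX p hp u) = Colombeau.mk X hX p hp ⟨genFIO X φ a u.1, h⟩ := by
  obtain ⟨L, hL⟩ := exists_quotient_map (moderate X hX p hp) (null X hX p hp) (genFIO X φ a) hmem
    (fun u _ hu => hnull u hu) hadd fun c u _ => funext fun ε => fio_smul _ _ c (u ε)
  let L' : Colombeau X hX p hp →ₗ[ℂ] Colombeau X hX p hp := L
  have hL' : ∀ u : moderate X hX p hp, L' (Colombeau.mk X hX p hp u) =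
    Colombeau.mk X hX p hp ⟨genFIO X φ a u, hmem u u.2⟩ := hL
  refine ⟨⟨L', ?_⟩, fun u => ⟨hmem u u.2, hL' u⟩⟩
  -- openness in the quotient is openness of the preimage, which unfolds to a condition on families
  refine continuous_def.2 fun V hV => ?_
  have hV' : ∀ u ∈ (Colombeau.mk X hX p hp) ⁻¹' V, ∃ k m : ℕ, ∀ w : moderate X hX p hp,
      (∀ j ≤ k, DerivO X p j (m : ℤ) w.1) → u + w ∈ (Colombeau.mk X hX p hp) ⁻¹' V := hV
  change ∀ u ∈ (Colombeau.mk X hX p hp) ⁻¹' (L' ⁻¹' V), ∃ k m : ℕ, ∀ w : moderate X hX p hp,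
      (∀ j ≤ k, DerivO X p j (m : ℤ) w.1) → u + w ∈ (Colombeau.mk X hX p hp) ⁻¹' (L' ⁻¹' V)
  intro u hu
  have hu' : (⟨genFIO X φ a u, hmem u u.2⟩ : moderate X hX p hp) ∈
      (Colombeau.mk X hX p hp) ⁻¹' V := by
    rw [Set.mem_preimage, ← hL']
    exact hu
  obtain ⟨k, m, hkm⟩ := hV' _ hu'
  obtain ⟨R, G, ⟨N, hG⟩, hbd⟩ := hb k
  refine ⟨R, N + m, fun w hw => ?_⟩
  have h1 := hkm ⟨genFIO X φ a w, hmem w w.2⟩ fun j hj =>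
    derivO_genFIO hG hbd w.2.1 hw hj (by push_cast; omega)
  rw [Set.mem_preimage, map_add, ← hL', ← hL', ← map_add, ← map_add] at h1
  exact h1

/-- As the growth `ε^{-N}` of the operator norms does not depend on the number of derivatives, a shift
by `N` in the exponent serves all orders at once. -/
theorem exists_regularColombeau_map (hp : 1 ≤ p) (hX : IsOpen X)
    (hmem : ∀ u ∈ regular X hX p hp, genFIO X φ a u ∈ regular X hX p hp)
    (hnull : ∀ u ∈ null X hX p hp, genFIO X φ a u ∈ null X hX p hp)
    (hadd : ∀ u ∈ regular X hX p hp, ∀ v ∈ regular X hX p hp,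
      genFIO X φ a (u + v) - (genFIO X φ a u + genFIO X φ a v) ∈ null X hX p hp)
    {N : ℕ} (hb : FIOBounded X p φ a (growthNets N)) :
    ∃ T : RegularColombeau X hX p hp →L[ℂ] RegularColombeau X hX p hp,
      ∀ u : regular X hX p hp, ∃ h : genFIO X φ a u.1 ∈ regular X hX p hp,
        T (RegularColombeau.mk X hX p hp u) =
          RegularColombeau.mk X hX p hp ⟨genFIO X φ a u.1, h⟩ := by
  obtain ⟨L, hL⟩ := exists_quotient_map (regular X hX p hp) (null X hX p hp) (genFIO X φ a) hmem
    (fun u _ hu => hnull u hu) hadd fun c u _ => funext fun ε => fio_smul _ _ c (u ε)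
  let L' : RegularColombeau X hX p hp →ₗ[ℂ] RegularColombeau X hX p hp := L
  have hL' : ∀ u : regular X hX p hp, L' (RegularColombeau.mk X hX p hp u) =
    RegularColombeau.mk X hX p hp ⟨genFIO X φ a u, hmem u u.2⟩ := hL
  refine ⟨⟨L', ?_⟩, fun u => ⟨hmem u u.2, hL' u⟩⟩
  -- openness in the quotient is openness of the preimage, which unfolds to a condition on families
  refine continuous_def.2 fun V hV => ?_
  have hV' : ∀ u ∈ (RegularColombeau.mk X hX p hp) ⁻¹' V, ∃ m : ℕ, ∀ w : regular X hX p hp,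
      (∀ j : ℕ, DerivO X p j (m : ℤ) w.1) → u + w ∈ (RegularColombeau.mk X hX p hp) ⁻¹' V := hV
  change ∀ u ∈ (RegularColombeau.mk X hX p hp) ⁻¹' (L' ⁻¹' V), ∃ m : ℕ,
      ∀ w : regular X hX p hp, (∀ j : ℕ, DerivO X p j (m : ℤ) w.1) →
        u + w ∈ (RegularColombeau.mk X hX p hp) ⁻¹' (L' ⁻¹' V)
  intro u hu
  have hu' : (⟨genFIO X φ a u, hmem u u.2⟩ : regular X hX p hp) ∈
      (RegularColombeau.mk X hX p hp) ⁻¹' V := by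
    rw [Set.mem_preimage, ← hL']
    exact hu
  obtain ⟨m, hm⟩ := hV' _ hu'
  refine ⟨N + m, fun w hw => ?_⟩
  have h1 := hm ⟨genFIO X φ a w, hmem w w.2⟩ fun j => by
    obtain ⟨R, G, hG, hbd⟩ := hb j
    exact derivO_genFIO hG hbd w.2.1 (fun i _ => hw i) le_rfl (by push_cast; omega)
  rw [Set.mem_preimage, map_add, ← hL', ← hL', ← map_add, ← map_add] at h1
  exact h1

end Main

end ColombeauFIO

theorem mainTheorem1 {n : ℕ} (hn : 1 ≤ n) (p : ℝ≥0∞) (hp : 1 ≤ p)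
    (X : Set (ColombeauFIO.Euc n)) (hX : IsOpen X) (hXb : Bornology.IsBounded X)
    (K : Set (ColombeauFIO.Euc n)) (hK : IsCompact K) (hKX : K ⊆ X)
    (S : Set (ColombeauFIO.Euc n × ColombeauFIO.Euc n)) (hS : S ⊆ X ×ˢ K) (μ : ℝ)
    (φ : ColombeauFIO.Eps →
      ColombeauFIO.Euc n → ColombeauFIO.Euc n → ColombeauFIO.Euc n → ℝ)
    (a : ColombeauFIO.Eps →
      ColombeauFIO.Euc n → ColombeauFIO.Euc n → ColombeauFIO.Euc n → ℂ)
    (hφ : ColombeauFIO.IsGenPhase X S φ) (ha : ColombeauFIO.IsGenAmplitude X S μ a) :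
    -- the integrals defining the operator converge absolutely
    (∀ ε, ∀ u : ColombeauFIO.Euc n → ℂ, ColombeauFIO.MemLpSmooth X p u → ∀ x ∈ X,
      (∀ ξ ≠ 0, IntegrableOn (ColombeauFIO.integrand (φ ε) (a ε) u x ξ) X) ∧
        Integrable (fun ξ => ∫ y in X, ColombeauFIO.integrand (φ ε) (a ε) u x ξ y)) ∧
    -- the operator is well defined and continuous on the Colombeau space
    (∃ T : ColombeauFIO.Colombeau X hX p hp →L[ℂ] ColombeauFIO.Colombeau X hX p hp,
      ∀ u : ColombeauFIO.moderate X hX p hp,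
        ∃ h : ColombeauFIO.genFIO X φ a u.1 ∈ ColombeauFIO.moderate X hX p hp,
          T (ColombeauFIO.Colombeau.mk X hX p hp u) =
            ColombeauFIO.Colombeau.mk X hX p hp ⟨ColombeauFIO.genFIO X φ a u.1, h⟩) ∧
    -- in the slow scale case, also on the regular Colombeau space
    (ColombeauFIO.IsSlowScalePhase S φ → ColombeauFIO.IsRegularAmplitude X μ a →
      ∃ T : ColombeauFIO.RegularColombeau X hX p hp →L[ℂ]
          ColombeauFIO.RegularColombeau X hX p hp,
        ∀ u : ColombeauFIO.regular X hX p hp,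
          ∃ h : ColombeauFIO.genFIO X φ a u.1 ∈ ColombeauFIO.regular X hX p hp,
            T (ColombeauFIO.RegularColombeau.mk X hX p hp u) =
              ColombeauFIO.RegularColombeau.mk X hX p hp
                ⟨ColombeauFIO.genFIO X φ a u.1, h⟩) := by
  -- amplitudes of order `μ` are amplitudes of every larger order
  obtain ⟨m, hm⟩ := exists_nat_ge μ
  have hF : ColombeauFIO.FIOFamily X S m φ a ColombeauFIO.moderateNets
      ColombeauFIO.moderateNets :=
    ha.fioFamily hm hφ.phase ColombeauFIO.isNetClass_moderateNets
      ColombeauFIO.isNetClass_moderateNets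
      (fun k => let ⟨N, hN⟩ := hφ.moderate k; ⟨_, ⟨N, isBigO_refl _ _⟩, hN⟩)
      (let ⟨N, hN⟩ := hφ.nondegenerate; ⟨_, ⟨N, isBigO_refl _ _⟩, hN⟩)
      (fun k => let ⟨N, hN⟩ := ha.moderate k 0; ⟨_, ⟨N, isBigO_refl _ _⟩, hN⟩)
  have hmem : ∀ ε, ∀ u : ColombeauFIO.Euc n → ℂ, ColombeauFIO.MemLpSmooth X p u →
      ColombeauFIO.MemLpSmooth X p (ColombeauFIO.fio X (φ ε) (a ε) u) := fun ε _ hu =>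
    hF.memLpSmooth hn hp hX hXb hK hKX hS ε hu
  have hbd : ColombeauFIO.FIOBounded X p φ a ColombeauFIO.moderateNets :=
    hF.bounded hn hp hX hXb hK hKX hS fun b hb A hA Q c =>
      ColombeauFIO.isNetClass_moderateNets.of_isBigO
        (ColombeauFIO.mul_mem_moderateNets (ColombeauFIO.pow_mem_moderateNets hb Q) hA)
        (isBigO_const_mul_self c _ _)
  have hnull : ∀ u ∈ ColombeauFIO.null X hX p hp,
      ColombeauFIO.genFIO X φ a u ∈ ColombeauFIO.null X hX p hp := fun u hu =>
    hF.null_mem hn hp hX hXb hK hKX hS (fun _ hv => hbd.moderate_mem hX hp hmem hv) hu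
  refine ⟨fun ε u hu x hx => hF.integrable hn hp hX hXb hK hKX hS ε hu hx, ?_, fun hs hr => ?_⟩
  · exact ColombeauFIO.exists_colombeau_map hp hX (fun _ hu => hbd.moderate_mem hX hp hmem hu)
      hnull (fun u hu v hv => hF.add_sub_mem_null hn hp hX hXb hK hKX hS hu.1 hv.1) hbd
  · obtain ⟨N, hN⟩ := hr
    have hF' : ColombeauFIO.FIOFamily X S m φ a {s | ColombeauFIO.IsSlowScale s}
        (ColombeauFIO.growthNets N) :=
      ha.fioFamily hm hφ.phase ColombeauFIO.isNetClass_slowScale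
        (ColombeauFIO.isNetClass_growthNets N) hs.slow hs.nondegenerate
        (fun k => ⟨_, isBigO_refl _ _, hN k 0⟩)
    -- powers of slow scale nets cost only one power of `ε⁻¹`, whatever the exponent
    have hbd' : ColombeauFIO.FIOBounded X p φ a (ColombeauFIO.growthNets (1 + N)) :=
      hF'.bounded hn hp hX hXb hK hKX hS fun b hb A hA Q c => by
        have h1 : (fun ε => b ε ^ Q) ∈ ColombeauFIO.growthNets 1 := by
          have h2 := hb Q
          simp only [← abs_pow] at h2
          have h3 := h2.of_abs_left
          simp only [← zpow_neg_one] at h3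
          exact h3
        exact (ColombeauFIO.isNetClass_growthNets _).of_isBigO
          (ColombeauFIO.mul_mem_growthNets h1 hA) (isBigO_const_mul_self c _ _)
    exact ColombeauFIO.exists_regularColombeau_map hp hX
      (fun _ hu => hbd'.regular_mem hX hp hmem hu) hnull
      (fun u hu v hv => hF.add_sub_mem_null hn hp hX hXb hK hKX hS hu.1 hv.1) hbd'
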